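/- Conventions. Let $1\le p\le\infty$. For a complex Hilbert space $H$, $S^p(H)$ is the Schatten class: the compact operators with the operator norm if $p=\infty$, and the bounded operators $A$ with $\|A\|_p=\mathrm{Tr}(|A|^p)^{1/p}<\infty$ if $p<\infty$. A linear map $T:S^p(H)\to S^p(H)$ is completely bounded with cb-norm $\le C$ if for every Hilbert space $K$ the map $T\otimes \mathrm{id}$ on $S^p(H)\otimes S^p(K)$ extends to a bounded linear map on $S^p(H\otimes_2 K)$ of norm $\le C$. For a $\sigma$-finite measure $\mu$ on $X$, identify $S^2(L^2(X,\mu))$ with $L^2(X\times X,\mu\otimes\mu)$ through integral kernels. A function $\varphi:X\times X\to\mathbb C$ defines a bounded (resp. completely bounded) Schur multiplier on $S^p(L^2(X,\mu))$ of norm (resp. cb-norm) $\le C$ if $\varphi\in L^\infty(X\times X,\mu\otimes\mu)$ and multiplication of kernels by $\varphi$ maps $S^2\cap S^p$ into $S^p$ and extends to a bounded (resp. completely bounded) linear map on $S^p(L^2(X,\mu))$ of norm (resp. cb-norm) $\le C$. The least such $C$ is the norm (resp. cb-norm) of the multiplier, and it is $\infty$ if there is none. For a finite set $F$, the Schur multiplier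 on $S^p(\ell^2(F))$ with symbol $(\varphi_{x,y})_{x,y\in F}$ is $(a_{x,y})\mapsto(\varphi_{x,y}a_{x,y})$. Theorem. Let $X$ be a locally compact Hausdorff space, $\mu$ a $\sigma$-finite Radon measure on $X$, $\varphi:X\times X\to\mathbb C$ a continuous function and $1\le p\le\infty$. (a) For every $C\ge 0$, the following are equivalent: (i) $\varphi$ defines a bounded Schur multiplier on $S^p(L^2(X,\mu))$ of norm $\le C$; (ii) for every finite subset $F$ of the support of $\mu$, the Schur multiplier with symbol $(\varphi(x,y))_{x,y\in F}$ on $S^p(\ell^2(F))$ has norm $\le C$. (b) The same equivalence holds with completely bounded Schur multipliers in (i) and cb-norms in (i) and (ii). (c) The norm and the cb-norm of the multiplier with symbol $\varphi$ depend on $\mu$ only through its support: if $\nu$ is another $\sigma$-finite Radon measure on $X$ with the same support as $\mu$, then $\varphi$ has the same norm on $S^p(L^2(X,\nu))$ as on $S^p(L^2(X,\mu))$, and the same cb-norm. (d) If the support of $\mu$ has no isolated point, then the norm and the cb-norm of the multiplier with symbol $\varphi$ on $S^p(L^2(X,\mu))$ coincide (both may be $\infty$). -/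

import Mathlib

open scoped ENNReal NNReal TensorProduct InnerProductSpace Matrix
open MeasureTheory

universe u v w

noncomputable section

/-! ### Schatten classes -/

section Schatten

variable {H : Type v} [NormedAddCommGroup H] [InnerProductSpace ℂ H]

/-- The trace, with values in `[0, ∞]`, of a positive operator `T`: the supremum of
`∑ e ∈ s, ⟨e, T e⟩` over the finite orthonormal sets `s`.
For positive `T` this is `∑ i, ⟨b i, T (b i)⟩` for any Hilbert basis `b`. -/
def opTrace (T : H →L[ℂ] H) : ℝ≥0∞ :=
  ⨆ (s : Finset H) (_ : Orthonormal ℂ (fun e : s => (e : H))),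
    ∑ e ∈ s, ENNReal.ofReal (inner ℂ e (T e)).re

variable [CompleteSpace H]

/-- The Schatten norm: `‖A‖_p = Tr(|A|^p)^{1/p}` for `p < ∞`, where `|A| = (A* A)^{1/2}` and the
powers are taken in the continuous functional calculus; `‖A‖_∞` is the operator norm. -/
def schattenNorm (p : ℝ≥0∞) (A : H →L[ℂ] H) : ℝ≥0∞ :=
  if p = ∞ then ‖A‖ₑ
  else opTrace (CFC.rpow (CFC.abs A) p.toReal) ^ (1 / p.toReal)

/-- The Schatten class `S^p(H)`: compact operators if `p = ∞`, operators of finite Schatten norm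
if `p < ∞`. -/
def schattenClass (p : ℝ≥0∞) (H : Type v) [NormedAddCommGroup H] [InnerProductSpace ℂ H]
    [CompleteSpace H] : Set (H →L[ℂ] H) :=
  {A | if p = ∞ then IsCompactOperator A else schattenNorm p A < ∞}

/-- `T` restricts to a linear map `S^p(H) → S^p(H)` (the values of `T` outside of `S^p(H)` are
irrelevant). -/
structure IsSchattenLinear (p : ℝ≥0∞) (T : (H →L[ℂ] H) → (H →L[ℂ] H)) : Prop where
  mapsTo : ∀ A ∈ schattenClass p H, T A ∈ schattenClass p H
  map_add : ∀ A ∈ schattenClass p H, ∀ B ∈ schattenClass p H, T (A + B) = T A + T B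
  map_smul : ∀ (c : ℂ), ∀ A ∈ schattenClass p H, T (c • A) = c • T A

/-- `T` restricts to a bounded linear map `S^p(H) → S^p(H)` of norm at most `C`. -/
def SchattenNormLE (p : ℝ≥0∞) (T : (H →L[ℂ] H) → (H →L[ℂ] H)) (C : ℝ≥0) : Prop :=
  IsSchattenLinear p T ∧ ∀ A ∈ schattenClass p H, schattenNorm p (T A) ≤ C * schattenNorm p A

end Schatten

/-! ### Hilbert tensor products and completely bounded maps -/

section Tensor

variable {H : Type v} [NormedAddCommGroup H] [InnerProductSpace ℂ H] [CompleteSpace H]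
variable {K : Type w} [NormedAddCommGroup K] [InnerProductSpace ℂ K] [CompleteSpace K]

theorem inner_map_tensor (A : H →L[ℂ] H) (B : K →L[ℂ] K) (z t : H ⊗[ℂ] K) :
    inner ℂ (TensorProduct.map (A : H →ₗ[ℂ] H) (B : K →ₗ[ℂ] K) z) t =
      inner ℂ z (TensorProduct.map ((star A : H →L[ℂ] H) : H →ₗ[ℂ] H)
        ((star B : K →L[ℂ] K) : K →ₗ[ℂ] K) t) := by
  induction z with
  | zero => simp
  | add x y hx hy => simp only [map_add, inner_add_left, hx, hy]
  | tmul x y =>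
    induction t with
    | zero => simp
    | add a b ha hb => simp only [map_add, inner_add_right, ha, hb]
    | tmul a b =>
      simp [ContinuousLinearMap.star_eq_adjoint, ContinuousLinearMap.adjoint_inner_right]

theorem norm_map_tensor_left_le (A : H →L[ℂ] H) (z : H ⊗[ℂ] K) :
    ‖TensorProduct.map (A : H →ₗ[ℂ] H) (LinearMap.id : K →ₗ[ℂ] K) z‖ ≤ ‖A‖ * ‖z‖ := by
  have h0 : 0 ≤ algebraMap ℝ (H →L[ℂ] H) (‖A‖ ^ 2) - star A * A :=
    sub_nonneg.2 CStarAlgebra.star_mul_le_algebraMap_norm_sq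
  obtain ⟨R, hR⟩ := CStarAlgebra.nonneg_iff_eq_star_mul_self.1 h0
  have key : ∀ S : H →L[ℂ] H,
      inner ℂ (TensorProduct.map (S : H →ₗ[ℂ] H) (LinearMap.id : K →ₗ[ℂ] K) z)
        (TensorProduct.map (S : H →ₗ[ℂ] H) (LinearMap.id : K →ₗ[ℂ] K) z) =
      inner ℂ z (TensorProduct.map ((star S * S : H →L[ℂ] H) : H →ₗ[ℂ] H)
        (LinearMap.id : K →ₗ[ℂ] K) z) := by
    intro S
    have h := inner_map_tensor S (1 : K →L[ℂ] K) z
      (TensorProduct.map (S : H →ₗ[ℂ] H) (LinearMap.id : K →ₗ[ℂ] K) z)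
    rw [star_one] at h
    have h1 : ((1 : K →L[ℂ] K) : K →ₗ[ℂ] K) = LinearMap.id := rfl
    rw [h1, ← LinearMap.comp_apply, ← TensorProduct.map_comp] at h
    exact h
  have hsum : star A * A + star R * R = algebraMap ℝ (H →L[ℂ] H) (‖A‖ ^ 2) := by
    rw [← hR]; abel
  have hs : inner ℂ z (TensorProduct.map ((star A * A : H →L[ℂ] H) : H →ₗ[ℂ] H)
        (LinearMap.id : K →ₗ[ℂ] K) z) +
      inner ℂ z (TensorProduct.map ((star R * R : H →L[ℂ] H) : H →ₗ[ℂ] H)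
        (LinearMap.id : K →ₗ[ℂ] K) z) = ((‖A‖ ^ 2 : ℝ) : ℂ) * inner ℂ z z := by
    refine (inner_add_right (𝕜 := ℂ) z _ _).symm.trans ?_
    rw [← LinearMap.add_apply, ← TensorProduct.map_add_left,
      ← ContinuousLinearMap.toLinearMap_add, hsum]
    have h2 : ((algebraMap ℝ (H →L[ℂ] H) (‖A‖ ^ 2) : H →L[ℂ] H) : H →ₗ[ℂ] H) =
        ((‖A‖ ^ 2 : ℝ) : ℂ) • LinearMap.id := by
      ext x
      rw [Algebra.algebraMap_eq_smul_one]
      exact (Complex.coe_smul _ x).symm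
    rw [h2, TensorProduct.map_smul_left, TensorProduct.map_id, LinearMap.smul_apply,
      LinearMap.id_apply]
    exact inner_smul_right (𝕜 := ℂ) z z _
  rw [← key A, ← key R] at hs
  have hn : ∀ t : H ⊗[ℂ] K, inner ℂ t t = ((‖t‖ ^ 2 : ℝ) : ℂ) := fun t =>
    (inner_self_eq_norm_sq_to_K (𝕜 := ℂ) t).trans (by push_cast; rfl)
  rw [hn, hn, hn] at hs
  have hs' : ‖TensorProduct.map (A : H →ₗ[ℂ] H) (LinearMap.id : K →ₗ[ℂ] K) z‖ ^ 2 +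
      ‖TensorProduct.map (R : H →ₗ[ℂ] H) (LinearMap.id : K →ₗ[ℂ] K) z‖ ^ 2 =
      ‖A‖ ^ 2 * ‖z‖ ^ 2 := by exact_mod_cast hs
  refine abs_le_of_sq_le_sq' ?_ (by positivity) |>.2
  nlinarith [sq_nonneg ‖TensorProduct.map (R : H →ₗ[ℂ] H) (LinearMap.id : K →ₗ[ℂ] K) z‖]

theorem norm_map_tensor_le (A : H →L[ℂ] H) (B : K →L[ℂ] K) (z : H ⊗[ℂ] K) :
    ‖TensorProduct.map (A : H →ₗ[ℂ] H) (B : K →ₗ[ℂ] K) z‖ ≤ ‖A‖ * ‖B‖ * ‖z‖ := by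
  have h1 : TensorProduct.map (A : H →ₗ[ℂ] H) (B : K →ₗ[ℂ] K) z =
      TensorProduct.map (A : H →ₗ[ℂ] H) (LinearMap.id : K →ₗ[ℂ] K)
        (TensorProduct.map (LinearMap.id : H →ₗ[ℂ] H) (B : K →ₗ[ℂ] K) z) := by
    rw [← LinearMap.comp_apply, ← TensorProduct.map_comp]; rfl
  have h2 : ‖TensorProduct.map (LinearMap.id : H →ₗ[ℂ] H) (B : K →ₗ[ℂ] K) z‖ ≤ ‖B‖ * ‖z‖ := by
    have h := norm_map_tensor_left_le (K := H) B (TensorProduct.comm ℂ H K z)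
    rw [TensorProduct.map_comm, TensorProduct.norm_comm, TensorProduct.norm_comm] at h
    exact h
  rw [h1, mul_assoc]
  exact (norm_map_tensor_left_le A _).trans (mul_le_mul_of_nonneg_left h2 (norm_nonneg _))

variable (H K) in
/-- The Hilbert space tensor product `H ⊗₂ K`. -/
abbrev HilbertTensor : Type (max v w) := UniformSpace.Completion (H ⊗[ℂ] K)

/-- The bounded operator `A ⊗ B` on `H ⊗₂ K`, with `(A ⊗ B) (x ⊗ y) = A x ⊗ B y`. -/
def opTensor (A : H →L[ℂ] H) (B : K →L[ℂ] K) : HilbertTensor H K →L[ℂ] HilbertTensor H K :=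
  ((TensorProduct.map (A : H →ₗ[ℂ] H) (B : K →ₗ[ℂ] K)).mkContinuous (‖A‖ * ‖B‖)
    (norm_map_tensor_le A B)).completion

/-- `T : S^p(H) → S^p(H)` is linear and completely bounded with cb-norm at most `C`: for every
Hilbert space `K`, the map `A ⊗ B ↦ T A ⊗ B` on the algebraic tensor product `S^p(H) ⊗ S^p(K)`
extends to a bounded linear map on `S^p(H ⊗₂ K)` of norm at most `C`. -/
def SchattenCBNormLE (p : ℝ≥0∞) (T : (H →L[ℂ] H) → (H →L[ℂ] H)) (C : ℝ≥0) : Prop :=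
  IsSchattenLinear p T ∧
    ∀ (K : Type w) [NormedAddCommGroup K] [InnerProductSpace ℂ K] [CompleteSpace K],
      ∃ N : (HilbertTensor H K →L[ℂ] HilbertTensor H K) →
          (HilbertTensor H K →L[ℂ] HilbertTensor H K),
        SchattenNormLE p N C ∧
        ∀ A ∈ schattenClass p H, ∀ B ∈ schattenClass p K,
          N (opTensor A B) = opTensor (T A) B

end Tensor

/-! ### Schur multipliers -/

/-- The Schur multiplier with symbol the matrix `φ`, acting on the operators on `ℓ²_n`:
`(a i j) ↦ (φ i j * a i j)`. -/
def matrixSchur {n : Type u} [Fintype n] [DecidableEq n] (φ : Matrix n n ℂ)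
    (A : EuclideanSpace ℂ n →L[ℂ] EuclideanSpace ℂ n) :
    EuclideanSpace ℂ n →L[ℂ] EuclideanSpace ℂ n :=
  Matrix.toEuclideanCLM (n := n) (𝕜 := ℂ)
    (φ ⊙ (Matrix.toEuclideanCLM (n := n) (𝕜 := ℂ)).symm A)

section Multiplier

variable {X : Type u}

open Classical in
/-- The Schur multiplier on the operators on `ℓ²(F)` with symbol the restriction of `φ` to
`F × F`. -/
def finsetSchur (φ : X × X → ℂ) (F : Finset X) :
    (EuclideanSpace ℂ F →L[ℂ] EuclideanSpace ℂ F) → (EuclideanSpace ℂ F →L[ℂ] EuclideanSpace ℂ F) :=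
  matrixSchur (Matrix.of fun i j : F => φ (i, j))

variable [MeasurableSpace X]

/-- `A` is the Hilbert-Schmidt operator on `L²(X, μ)` with kernel `k ∈ L²(X × X, μ ⊗ μ)`.
The elements of `S²(L²(X, μ))` are exactly the operators that have such a kernel, and the kernel
is unique almost everywhere. -/
def HasKernel (μ : Measure X) (A : Lp ℂ 2 μ →L[ℂ] Lp ℂ 2 μ) (k : X × X → ℂ) : Prop :=
  MemLp k 2 (μ.prod μ) ∧
    ∀ ξ : Lp ℂ 2 μ, ∀ᵐ x ∂μ, A ξ x = ∫ y, k (x, y) * ξ y ∂μ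

/-- On `S² ∩ S^p`, the map `M` is the multiplication of kernels by `φ`. -/
def ExtendsKernelMul (φ : X × X → ℂ) (μ : Measure X) (p : ℝ≥0∞)
    (M : (Lp ℂ 2 μ →L[ℂ] Lp ℂ 2 μ) → (Lp ℂ 2 μ →L[ℂ] Lp ℂ 2 μ)) : Prop :=
  ∀ A ∈ schattenClass p (Lp ℂ 2 μ), ∀ k : X × X → ℂ, HasKernel μ A k →
    HasKernel μ (M A) (fun z => φ z * k z)

/-- `φ ∈ L^∞(X × X, μ ⊗ μ)` and the Schur multiplier with symbol `φ` maps `S² ∩ S^p` to `S^p` and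
extends to a bounded linear map on `S^p(L²(X, μ))` of norm at most `C`. -/
def SchurNormLE (φ : X × X → ℂ) (μ : Measure X) (p : ℝ≥0∞) (C : ℝ≥0) : Prop :=
  MemLp φ ∞ (μ.prod μ) ∧
    ∃ M : (Lp ℂ 2 μ →L[ℂ] Lp ℂ 2 μ) → (Lp ℂ 2 μ →L[ℂ] Lp ℂ 2 μ),
      ExtendsKernelMul φ μ p M ∧ SchattenNormLE p M C

/-- `φ ∈ L^∞(X × X, μ ⊗ μ)` and the Schur multiplier with symbol `φ` maps `S² ∩ S^p` to `S^p` and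
extends to a completely bounded map on `S^p(L²(X, μ))` of cb-norm at most `C`. -/
def SchurCBNormLE (φ : X × X → ℂ) (μ : Measure X) (p : ℝ≥0∞) (C : ℝ≥0) : Prop :=
  MemLp φ ∞ (μ.prod μ) ∧
    ∃ M : (Lp ℂ 2 μ →L[ℂ] Lp ℂ 2 μ) → (Lp ℂ 2 μ →L[ℂ] Lp ℂ 2 μ),
      ExtendsKernelMul φ μ p M ∧ SchattenCBNormLE.{u, w} p M C

/-- The norm `‖φ‖_{MS^p(L²(X, μ))}`, equal to `∞` if `φ` is not a bounded multiplier. -/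
def schurNorm (φ : X × X → ℂ) (μ : Measure X) (p : ℝ≥0∞) : ℝ≥0∞ :=
  ⨅ (C : ℝ≥0) (_ : SchurNormLE φ μ p C), (C : ℝ≥0∞)

/-- The norm `‖φ‖_{cbMS^p(L²(X, μ))}`, equal to `∞` if `φ` is not a completely bounded
multiplier. -/
def schurCBNorm (φ : X × X → ℂ) (μ : Measure X) (p : ℝ≥0∞) : ℝ≥0∞ :=
  ⨅ (C : ℝ≥0) (_ : SchurCBNormLE.{u, w} φ μ p C), (C : ℝ≥0∞)

end Multiplier

end

/-! Everything rests on a description of the Schatten norm by finite tests: for 1 ≤ p ≤ ∞, ‖A‖_p is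
the supremum of the ℓ^p norms of (⟨f i, A (e i)⟩)_i over finite Bessel families e, f
(`schattenNorm_eq_varNorm`). The triangle inequality, the ideal property and lower semicontinuity
under weak operator limits follow from it, without duality or interpolation.

All finite multipliers are instances of `blockSchur a φ`, where the a i : K → H are isometries with
orthogonal ranges. K = ℂ gives scalar matrices, and a i = v i ⊗ · gives their ampliations. For fixed
K the bound does not depend on H or a (`SchurBound.transfer`), so ℓ²(F) may be replaced by the span
of an orthonormal family in L²(X, μ).

From the measure to finite sets: compress the multiplier to normalized indicators of small disjoint
neighbourhoods of the points of F, which have positive measure because F lies in the support. The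
compressed symbol consists of averages of φ, close to the values φ(x, y) (`exists_compression`);
bounds pass to the limit.

From finite sets to the measure: cut a compact set into finitely many atoms on which φ nearly
factors through one support point per atom. Tested on indicators of prescribed compact sets, the
resulting finite multiplier agrees with multiplication of the kernel k by φ up to ε ∫ |k|
(`exists_step`). A weak limit along an ultrafilter is the required map. For p = ∞ its values must
also be shown compact: rank one operators have Hilbert-Schmidt images with uniform bounds, and
finite rank operators are dense in the compact ones (`schattenNormLE_weakLimit`).

Independence of the measure is then clear, since finite sections see only the support. Without
isolated points, each point of F can be split into m distinct nearby support points; continuity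
turns ordinary bounds for these larger sections into bounds for φ with multiplicity m, and all m
together control every ampliation (`schurBound_of_inflation`). -/

noncomputable section

/-! ### Functional calculus on eigenvectors and diagonalization of compact positive operators. -/

section Eigenvectors

variable {H : Type v} [NormedAddCommGroup H] [InnerProductSpace ℂ H] [CompleteSpace H]

/-- The eigenvalue lies in the spectrum. The identity holds for constants and for the coordinate
function, survives sums and products, and is a closed condition on f, so Stone-Weierstrass gives it
for all continuous f. -/
theorem cfc_real_apply_eigenvector {a : H →L[ℂ] H} (ha : IsSelfAdjoint a) {x : H} (hx : x ≠ 0)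
    {t : ℝ} (h : a x = (t : ℂ) • x) (f : ℝ → ℝ) (hf : Continuous f) :
    cfc f a x = ((f t : ℝ) : ℂ) • x := by
  have ht : t ∈ spectrum ℝ a := by
    intro hu
    rw [resolventSet, Set.mem_ofPred_eq] at hu
    obtain ⟨b, hb⟩ := hu.exists_left_inv
    apply hx
    have : (b * (algebraMap ℝ (H →L[ℂ] H) t - a)) x = x := by rw [hb]; rfl
    rw [← this, mul_apply_eq_comp, sub_apply, h,
      Algebra.algebraMap_eq_smul_one]
    have : (t • (1 : H →L[ℂ] H)) x = (t : ℂ) • x := (Complex.coe_smul _ x).symm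
    simp [this]
  rw [cfc_apply f a]
  generalize hg : (⟨_, _⟩ : C(spectrum ℝ a, ℝ)) = g
  have key : cfcHom (p := IsSelfAdjoint) ha g x = ((g ⟨t, ht⟩ : ℝ) : ℂ) • x := by
    clear hg
    induction g using ContinuousMap.induction_on_of_compact with
    | const r =>
      have : (ContinuousMap.const (spectrum ℝ a) r) = algebraMap ℝ C(spectrum ℝ a, ℝ) r := rfl
      rw [this, AlgHomClass.commutes, Algebra.algebraMap_eq_smul_one]
      exact (Complex.coe_smul _ x).symm
    | id =>
      have := cfcHom_id (R := ℝ) ha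
      rw [this, h]; simp
    | star_id =>
      rw [map_star, cfcHom_id (R := ℝ) ha, ha.star_eq, h]; simp
    | add f g hf hg => rw [map_add, add_apply, hf, hg, ← add_smul]; simp
    | mul f g hf hg =>
      rw [map_mul, mul_apply_eq_comp, hg, map_smul, hf, smul_smul]
      simp [mul_comm]
    | frequently f hf =>
      have hc : IsClosed {f : C(spectrum ℝ a, ℝ) |
          cfcHom (p := IsSelfAdjoint) ha f x = ((f ⟨t, ht⟩ : ℝ) : ℂ) • x} := by
        refine isClosed_eq ?_ ?_
        · have := cfcHom_continuous (R := ℝ) (p := IsSelfAdjoint) ha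
          exact (ContinuousLinearMap.apply ℂ H x).continuous.comp this
        · have : Continuous fun f : C(spectrum ℝ a, ℝ) => f ⟨t, ht⟩ :=
            continuous_eval_const _
          fun_prop
      have := hc.closure_eq ▸ mem_closure_of_frequently_of_tendsto hf Filter.tendsto_id
      exact this
  rw [key, ← hg]; rfl

theorem rpow_apply_eigenvector {a : H →L[ℂ] H} (ha : 0 ≤ a) {x : H} {t : ℝ≥0}
    (h : a x = ((t : ℝ) : ℂ) • x) {y : ℝ} (hy : 0 ≤ y) :
    (CFC.rpow a y) x = (((t ^ y : ℝ≥0) : ℝ) : ℂ) • x := by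
  by_cases hx : x = 0
  · simp [hx]
  rw [CFC.rpow, cfc_nnreal_eq_real ..]
  rw [cfc_real_apply_eigenvector ha.isSelfAdjoint hx h _ ?_]
  · simp
  · have : Continuous fun z : ℝ≥0 => z ^ y := NNReal.continuous_rpow_const hy
    fun_prop

theorem abs_apply_eigenvector (A : H →L[ℂ] H) {x : H} {t : ℝ≥0}
    (h : (star A * A) x = (((t ^ 2 : ℝ≥0) : ℝ) : ℂ) • x) :
    (CFC.abs A) x = ((t : ℝ) : ℂ) • x := by
  by_cases hx : x = 0
  · simp [hx]
  have h0 : 0 ≤ star A * A := star_mul_self_nonneg A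
  have : CFC.abs A = CFC.rpow (star A * A) (1 / 2) := by
    rw [CFC.abs, CFC.sqrt_eq_rpow]; rfl
  rw [this, rpow_apply_eigenvector h0 h (by norm_num)]
  congr
  rw [← NNReal.rpow_natCast, ← NNReal.rpow_mul]; norm_num

-- Hilbert bases of the eigenspaces, put together, are orthonormal. A vector orthogonal to all of
-- them is orthogonal to every eigenspace, hence zero by the spectral theorem. The kernel is one of
-- the eigenspaces, so H need not be separable.
open scoped ComplexOrder in
theorem exists_hilbertBasis_eigenvectors {T : H →L[ℂ] H} (hT : IsCompactOperator T)
    (h0 : 0 ≤ T) : ∃ (ι : Type v) (b : HilbertBasis ι ℂ H) (t : ι → ℝ≥0),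
      ∀ i, T (b i) = ((t i : ℝ) : ℂ) • b i := by
  have hs : T.IsSymmetric := (ContinuousLinearMap.isSelfAdjoint_iff_isSymmetric.1 h0.isSelfAdjoint)
  let E : ℂ → Submodule ℂ H := fun c => Module.End.eigenspace (T : Module.End ℂ H) c
  have hE : ∀ c, IsClosed (E c : Set H) := fun c => by
    have : (E c : Set H) = {x | T x = c • x} := by
      ext x; exact Module.End.mem_eigenspace_iff
    rw [this]
    exact isClosed_eq T.continuous (continuous_const_smul c)
  have : ∀ c, CompleteSpace (E c) := fun c => (hE c).completeSpace_coe
  choose w b hb using fun c => exists_hilbertBasis ℂ (E c)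
  have ho : Orthonormal ℂ (fun a : Σ c, w c => ((b a.1 a.2 : E a.1) : H)) :=
    hs.orthogonalFamily_eigenspaces.orthonormal_sigma_orthonormal fun c => (b c).orthonormal
  have hbot : (Submodule.span ℂ (Set.range fun a : Σ c, w c => ((b a.1 a.2 : E a.1) : H)))ᗮ = ⊥ := by
    rw [eq_bot_iff, ← ContinuousLinearMap.orthogonalComplement_iSup_eigenspaces_eq_bot hT hs]
    intro x hx
    rw [← Submodule.iInf_orthogonal, Submodule.mem_iInf]
    intro c y hy
    have hd : Submodule.topologicalClosure (Submodule.span ℂ (Set.range (b c))) = ⊤ :=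
      (b c).dense_span
    have h1 : (⟨y, hy⟩ : E c) ∈ closure (Submodule.span ℂ (Set.range (b c)) : Set (E c)) := by
      rw [← Submodule.topologicalClosure_coe, hd]; trivial
    have h2 : closure (Submodule.span ℂ (Set.range (b c)) : Set (E c)) ⊆
        {z : E c | inner ℂ (z : H) x = 0} := by
      refine closure_minimal ?_ (isClosed_eq (by fun_prop) continuous_const)
      intro z hz
      induction hz using Submodule.span_induction with
      | mem z hz =>
        obtain ⟨i, rfl⟩ := hz
        exact hx _ (Submodule.subset_span ⟨⟨c, i⟩, rfl⟩)
      | zero => simp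
      | add y z _ _ h1 h2 =>
        simp only [Set.mem_ofPred_eq, Submodule.coe_add, inner_add_left] at *
        rw [h1, h2, add_zero]
      | smul a y _ h1 =>
        simp only [Set.mem_ofPred_eq, Submodule.coe_smul, inner_smul_left] at *
        rw [h1, mul_zero]
    exact h2 h1
  let B := HilbertBasis.mkOfOrthogonalEqBot ho hbot
  have hB : ∀ a, B a = ((b a.1 a.2 : E a.1) : H) := fun a => by simp [B]
  have hev : ∀ a : Σ c, w c, ∃ t : ℝ≥0, T (B a) = ((t : ℝ) : ℂ) • B a := by
    intro a
    have h1 : T (B a) = a.1 • B a := by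
      rw [hB]; exact Module.End.mem_eigenspace_iff.1 (b a.1 a.2).2
    have h2 : 0 ≤ inner ℂ (B a) (T (B a)) := by
      have := (ContinuousLinearMap.nonneg_iff_isPositive T).1 h0
      exact this.inner_nonneg_right (B a)
    rw [h1, inner_smul_right, inner_self_eq_norm_sq_to_K, B.orthonormal.1 a] at h2
    simp only [Complex.coe_algebraMap, Complex.ofReal_one, one_pow, mul_one] at h2
    refine ⟨⟨a.1.re, (Complex.nonneg_iff.1 h2).1⟩, ?_⟩
    rw [h1]
    congr 1
    exact Complex.ext rfl (by simpa using (Complex.nonneg_iff.1 h2).2.symm)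
  choose t ht using hev
  exact ⟨Σ c, w c, B, t, ht⟩

end Eigenvectors

/-! ### Non-compactness detected on orthonormal sequences. -/

section Dichotomy

variable {H : Type v} [NormedAddCommGroup H] [InnerProductSpace ℂ H] [CompleteSpace H]

theorem isCompactOperator_of_finrank {H₁ H₂ : Type*} [NormedAddCommGroup H₁] [NormedSpace ℂ H₁]
    [NormedAddCommGroup H₂] [NormedSpace ℂ H₂] [FiniteDimensional ℂ H₁] (A : H₁ →L[ℂ] H₂) :
    IsCompactOperator A := by
  have : ProperSpace H₁ := FiniteDimensional.proper ℂ H₁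
  refine ⟨A '' Metric.closedBall 0 1, (isCompact_closedBall 0 1).image A.continuous, ?_⟩
  filter_upwards [Metric.closedBall_mem_nhds (0 : H₁) one_pos] with x hx using ⟨x, hx, rfl⟩

/-- A non-compact operator is bounded below on an infinite orthonormal sequence with orthogonal
images. -/
theorem exists_orthonormal_of_not_isCompactOperator {A : H →L[ℂ] H}
    (hA : ¬ IsCompactOperator A) : ∃ δ : ℝ, 0 < δ ∧ ∃ e : ℕ → H, Orthonormal ℂ e ∧
      (∀ n, δ ≤ ‖A (e n)‖) ∧ ∀ m n, m ≠ n → inner ℂ (A (e m)) (A (e n)) = 0 := by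
  by_contra! hcon
  apply hA
  have key : ∀ δ : ℝ, 0 < δ → ∃ P : H →L[ℂ] H, IsCompactOperator P ∧ ‖P - A‖ ≤ δ := by
    intro δ hδ
    -- If every finite family could be prolonged, the resulting sequence would contradict `hcon`;
    -- hence some finite family `s` cannot be.
    have h1 : ¬ ∀ s : Finset H, (∀ x ∈ s, ‖x‖ = 1 ∧ δ ≤ ‖A x‖) →
        ∃ y : H, (‖y‖ = 1 ∧ δ ≤ ‖A y‖) ∧
          ∀ x ∈ s, inner ℂ x y = 0 ∧ inner ℂ (A x) (A y) = 0 := by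
      intro h
      obtain ⟨e, he, hr⟩ := exists_seq_of_forall_finset_exists
        (fun x : H => ‖x‖ = 1 ∧ δ ≤ ‖A x‖) (fun x y => inner ℂ x y = 0 ∧ inner ℂ (A x) (A y) = 0) h
      have hr' : ∀ m n, m ≠ n → inner ℂ (e m) (e n) = 0 ∧ inner ℂ (A (e m)) (A (e n)) = 0 := by
        intro m n hmn
        rcases lt_or_gt_of_ne hmn with h | h
        · exact hr m n h
        · exact ⟨inner_eq_zero_symm.1 (hr n m h).1, inner_eq_zero_symm.1 (hr n m h).2⟩
      obtain ⟨m, n, hmn, h0⟩ := hcon δ hδ e ⟨fun n => (he n).1, fun m n hmn => (hr' m n hmn).1⟩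
        fun n => (he n).2
      exact h0 (hr' m n hmn).2
    push Not at h1
    obtain ⟨s, -, hs⟩ := h1
    -- Being orthogonal to A*A x means having image orthogonal to A x. So a unit vector y of Vᗮ with
    -- ‖A y‖ ≥ δ would prolong `s`, and A is within δ of its finite rank restriction to V.
    let V : Submodule ℂ H := Submodule.span ℂ ((s : Set H) ∪ (star A * A) '' s)
    have : FiniteDimensional ℂ V :=
      FiniteDimensional.span_of_finite ℂ (s.finite_toSet.union (s.finite_toSet.image _))
    refine ⟨A ∘L V.starProjection, ?_, ?_⟩
    · have : IsCompactOperator (A ∘L V.subtypeL) := isCompactOperator_of_finrank _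
      exact this.comp_clm V.orthogonalProjectionOnto
    · refine ContinuousLinearMap.opNorm_le_bound _ hδ.le fun x => ?_
      set y := x - V.starProjection x with hy
      have hyV : y ∈ Vᗮ := V.sub_starProjection_mem_orthogonal x
      have hyx : ‖y‖ ≤ ‖x‖ := by
        have := V.norm_sq_eq_add_norm_sq_starProjection x
        rw [V.starProjection_orthogonal_val] at this
        nlinarith [norm_nonneg x, norm_nonneg y, sq_nonneg ‖V.starProjection x‖]
      have h2 : ‖A y‖ ≤ δ * ‖y‖ := by
        by_contra! hlt
        have hy0 : y ≠ 0 := by rintro h; simp [h] at hlt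
        have hny : 0 < ‖y‖ := norm_pos_iff.2 hy0
        obtain ⟨z, hz, hne⟩ := hs (((‖y‖⁻¹ : ℝ) : ℂ) • y) ⟨by simp [norm_smul, hny.ne'], by
          rw [map_smul, norm_smul]
          simp only [Complex.norm_real, norm_inv, norm_norm]
          rw [inv_mul_eq_div, le_div_iff₀ hny]; exact hlt.le⟩
        refine hne ?_ ?_
        · rw [inner_smul_right, hyV z (Submodule.subset_span (Or.inl hz)), mul_zero]
        · have := hyV _ (Submodule.subset_span (Or.inr ⟨z, hz, rfl⟩))
          rw [mul_apply_eq_comp, ContinuousLinearMap.star_eq_adjoint,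
            ContinuousLinearMap.adjoint_inner_left] at this
          rw [map_smul, inner_smul_right, this, mul_zero]
      have h3 : (A ∘L V.starProjection - A) x = -A y := by
        simp [hy]
      rw [h3, norm_neg]
      exact h2.trans (mul_le_mul_of_nonneg_left hyx hδ.le)
  have hcl : IsClosed {T : H →L[ℂ] H | IsCompactOperator T} := isClosed_setOfPred_isCompactOperator
  rw [← Set.mem_ofPred_eq (p := fun T : H →L[ℂ] H => IsCompactOperator T), ← hcl.closure_eq,
    Metric.mem_closure_iff]
  intro ε hε
  obtain ⟨P, hP, hPA⟩ := key (ε / 2) (by positivity)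
  refine ⟨P, hP, ?_⟩
  rw [dist_comm, dist_eq_norm]; linarith

end Dichotomy
-- Finite Bessel families.
section Bessel

variable {H : Type*} [NormedAddCommGroup H] [InnerProductSpace ℂ H]
variable {ι : Type*} [Fintype ι]

/-- A finite family satisfying Bessel's inequality, i.e. the image of an orthonormal family under a
contraction. -/
def Bessel (e : ι → H) : Prop := ∀ x, ∑ i, ‖inner ℂ (e i) x‖ ^ 2 ≤ ‖x‖ ^ 2

theorem Orthonormal.bessel {e : ι → H} (he : Orthonormal ℂ e) : Bessel e :=
  fun x => he.sum_inner_products_le x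

theorem Bessel.norm_le_one {e : ι → H} (he : Bessel e) (i : ι) : ‖e i‖ ≤ 1 := by
  have h1 : ‖inner ℂ (e i) (e i)‖ ^ 2 ≤ ‖e i‖ ^ 2 :=
    (Finset.single_le_sum (f := fun j => ‖inner ℂ (e j) (e i)‖ ^ 2) (fun j _ => by positivity)
      (Finset.mem_univ i)).trans (he (e i))
  rw [inner_self_eq_norm_sq_to_K] at h1
  simp only [Complex.coe_algebraMap, norm_pow, Complex.norm_real, norm_norm] at h1
  by_contra! h
  have : 1 < ‖e i‖ ^ 2 := one_lt_pow₀ h two_ne_zero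
  nlinarith

/-- This stability under contractions, which orthonormal families lack, is why the tests use Bessel
families. -/
theorem Bessel.map {H' : Type*} [NormedAddCommGroup H'] [InnerProductSpace ℂ H']
    [CompleteSpace H] [CompleteSpace H'] {e : ι → H} (he : Bessel e) {T : H →L[ℂ] H'}
    (hT : ‖T‖ ≤ 1) : Bessel fun i => T (e i) := by
  intro x
  simp_rw [← ContinuousLinearMap.adjoint_inner_right]
  refine (he _).trans ?_
  have : ‖T.adjoint x‖ ≤ ‖x‖ := by
    refine (T.adjoint.le_opNorm x).trans ?_
    rw [LinearIsometryEquiv.norm_map]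
    exact mul_le_of_le_one_left (norm_nonneg _) hT
  gcongr

theorem Bessel.comp_equiv {κ : Type*} [Fintype κ] {e : ι → H} (he : Bessel e) (σ : κ ≃ ι) :
    Bessel fun i => e (σ i) :=
  fun x => (σ.sum_comp fun i => ‖inner ℂ (e i) x‖ ^ 2).le.trans (he x)

theorem bessel_of_unique [Unique ι] {e : ι → H} (he : ‖e default‖ ≤ 1) : Bessel e := by
  intro x
  rw [Fintype.sum_unique]
  have := (norm_inner_le_norm (𝕜 := ℂ) (e default) x).trans
    (mul_le_of_le_one_left (norm_nonneg _) he)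
  gcongr

/-- Cauchy-Schwarz for the coefficients, in the form that makes the products weights of total mass
at most one. -/
theorem Bessel.sum_enorm_mul_enorm_le {H' : Type*} [NormedAddCommGroup H'] [InnerProductSpace ℂ H']
    {e : ι → H} {f : ι → H'} (he : Bessel e) (hf : Bessel f) {x : H} {y : H'} (hx : ‖x‖ ≤ 1)
    (hy : ‖y‖ ≤ 1) : ∑ i, ‖inner ℂ (e i) x‖ₑ * ‖inner ℂ (f i) y‖ₑ ≤ 1 := by
  have h : ∑ i, ‖inner ℂ (e i) x‖ * ‖inner ℂ (f i) y‖ ≤ 1 := by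
    have h1 : ∑ i, ‖inner ℂ (e i) x‖ * ‖inner ℂ (f i) y‖ ≤
        ∑ i, (‖inner ℂ (e i) x‖ ^ 2 + ‖inner ℂ (f i) y‖ ^ 2) / 2 :=
      Finset.sum_le_sum fun i _ => by
        nlinarith [sq_nonneg (‖inner ℂ (e i) x‖ - ‖inner ℂ (f i) y‖)]
    rw [← Finset.sum_div, Finset.sum_add_distrib] at h1
    have := he x
    have := hf y
    nlinarith [norm_nonneg x, norm_nonneg y]
  have h2 := ENNReal.ofReal_le_ofReal h
  rw [ENNReal.ofReal_sum_of_nonneg fun i _ => by positivity, ENNReal.ofReal_one] at h2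
  refine le_trans (le_of_eq (Finset.sum_congr rfl fun i _ => ?_)) h2
  rw [ENNReal.ofReal_mul (norm_nonneg _), ofReal_norm, ofReal_norm]

end Bessel

/-- Jensen's inequality for subprobability weights, from the weighted Hölder inequality on finite
sums. -/
theorem ENNReal.rpow_tsum_mul_le_tsum {κ : Type*} {r : ℝ} (hr : 1 ≤ r) (w f : κ → ℝ≥0∞)
    (hw : ∑' k, w k ≤ 1) : (∑' k, w k * f k) ^ r ≤ ∑' k, w k * f k ^ r := by
  have h0 : 0 < r := by linarith
  rw [← ENNReal.le_rpow_inv_iff h0, ENNReal.tsum_eq_iSup_sum]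
  refine iSup_le fun t => (ENNReal.inner_le_weight_mul_Lp_of_nonneg t hr w f).trans ?_
  calc _ ≤ 1 * (∑ i ∈ t, w i * f i ^ r) ^ r⁻¹ := by
        gcongr
        refine ENNReal.rpow_le_one ((ENNReal.sum_le_tsum t).trans hw) ?_
        rw [sub_nonneg]; exact inv_le_one_of_one_le₀ hr
    _ ≤ _ := by
        rw [one_mul]
        gcongr
        exact ENNReal.sum_le_tsum t

/-! ### Traces and diagonal coefficients through singular values. -/

section SingularValues

variable {H : Type v} [NormedAddCommGroup H] [InnerProductSpace ℂ H]
variable {κ : Type*}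

/-- Since ⟨e, S e⟩ = ∑ t k |⟨b k, e⟩|², summing over an orthonormal set gives each t k a weight at
most 1 by Bessel; finite pieces of b give the reverse inequality. -/
theorem opTrace_of_diagonal {S : H →L[ℂ] H} (hS : S.IsSymmetric) (b : HilbertBasis κ ℂ H)
    (t : κ → ℝ≥0) (h : ∀ k, S (b k) = ((t k : ℝ) : ℂ) • b k) :
    opTrace S = ∑' k, (t k : ℝ≥0∞) := by
  have hsum : ∀ e : H, ENNReal.ofReal (inner ℂ e (S e)).re =
      ∑' k, (t k : ℝ≥0∞) * ‖inner ℂ (b k) e‖ₑ ^ 2 := by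
    intro e
    have h1 := b.hasSum_inner_mul_inner e (S e)
    have h2 : ∀ k, inner ℂ e (b k) * inner ℂ (b k) (S e) =
        (((t k : ℝ) * ‖inner ℂ (b k) e‖ ^ 2 : ℝ) : ℂ) := by
      intro k
      have h3 : inner ℂ (b k) (S e) = (t k : ℝ) * inner ℂ (b k) e := by
        rw [← ContinuousLinearMap.coe_coe, ← hS, ContinuousLinearMap.coe_coe, h, inner_smul_left,
          Complex.conj_ofReal]
      rw [h3, ← inner_conj_symm e (b k), mul_left_comm, Complex.conj_mul']
      push_cast; rfl
    simp_rw [h2] at h1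
    have h4 := Complex.hasSum_re h1
    simp only [Complex.ofReal_re] at h4
    rw [← h4.tsum_eq, ENNReal.ofReal_tsum_of_nonneg (fun k => by positivity) h4.summable]
    refine tsum_congr fun k => ?_
    rw [ENNReal.ofReal_mul (by positivity), ENNReal.ofReal_pow (norm_nonneg _),
      ofReal_norm, ENNReal.ofReal_coe_nnreal]
  refine le_antisymm ?_ ?_
  · refine iSup₂_le fun s hs => ?_
    simp_rw [hsum]
    rw [← Summable.tsum_finsetSum (fun _ _ => ENNReal.summable)]
    refine ENNReal.tsum_le_tsum fun k => ?_
    rw [← Finset.mul_sum]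
    refine mul_le_of_le_one_right' ?_
    have := hs.bessel.sum_enorm_mul_enorm_le hs.bessel (b.orthonormal.1 k).le (b.orthonormal.1 k).le
    rw [← Finset.sum_coe_sort]
    refine le_trans (le_of_eq (Finset.sum_congr rfl fun e _ => ?_)) this
    rw [← enorm_norm, norm_inner_symm, enorm_norm, sq]
  · classical
    rw [ENNReal.tsum_eq_iSup_sum]
    refine iSup_le fun s => ?_
    have hinj : Function.Injective b := b.orthonormal.linearIndependent.injective
    have ho : Orthonormal ℂ (fun e : s.image b => (e : H)) :=
      b.orthonormal.toSubtypeRange.comp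
        (fun e : s.image b => (⟨e, by
          obtain ⟨k, -, hk⟩ := Finset.mem_image.1 e.2; exact ⟨k, hk⟩⟩ : Set.range b))
        fun x y hxy => Subtype.ext (congrArg (fun z : Set.range b => (z : H)) hxy)
    refine le_trans (le_of_eq ?_) (le_iSup₂ (f := fun (s : Finset H)
      (_ : Orthonormal ℂ (fun e : s => (e : H))) => _) (s.image b) ho)
    rw [Finset.sum_image hinj.injOn]
    refine Finset.sum_congr rfl fun k _ => ?_
    rw [h, inner_smul_right, inner_self_eq_norm_sq_to_K, b.orthonormal.1 k]
    simp

variable [CompleteSpace H]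

theorem opTrace_abs_rpow (A : H →L[ℂ] H) (b : HilbertBasis κ ℂ H) (s : κ → ℝ≥0)
    (h : ∀ k, (star A * A) (b k) = (((s k ^ 2 : ℝ≥0) : ℝ) : ℂ) • b k) {r : ℝ} (hr : 0 ≤ r) :
    opTrace (CFC.rpow (CFC.abs A) r) = ∑' k, (s k : ℝ≥0∞) ^ r := by
  have h0 : 0 ≤ CFC.rpow (CFC.abs A) r := CFC.rpow_nonneg
  rw [opTrace_of_diagonal (ContinuousLinearMap.isSelfAdjoint_iff_isSymmetric.1 h0.isSelfAdjoint) b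
    (fun k => s k ^ r) fun k =>
      rpow_apply_eigenvector (CFC.abs_nonneg A) (abs_apply_eigenvector A (h k)) hr]
  refine tsum_congr fun k => ?_
  rw [ENNReal.coe_rpow_of_nonneg _ hr]

theorem inner_map_map_of_star_mul_self (A : H →L[ℂ] H) (x y : H) :
    inner ℂ (A x) (A y) = inner ℂ x ((star A * A) y) := by
  rw [mul_apply_eq_comp, ContinuousLinearMap.star_eq_adjoint,
    ContinuousLinearMap.adjoint_inner_right]

/-- The left singular vectors of `A`, zero where the singular value vanishes. -/
theorem exists_left_singular_vectors (A : H →L[ℂ] H) (b : HilbertBasis κ ℂ H) (s : κ → ℝ≥0)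
    (h : ∀ k, (star A * A) (b k) = (((s k ^ 2 : ℝ≥0) : ℝ) : ℂ) • b k) :
    ∃ u : κ → H, (∀ k, A (b k) = ((s k : ℝ) : ℂ) • u k) ∧
      (∀ t : Finset κ, Bessel fun k : t => u k) ∧ ∀ k, s k ≠ 0 → ‖u k‖ = 1 := by
  classical
  have hin : ∀ k l, inner ℂ (A (b k)) (A (b l)) =
      if k = l then (((s k ^ 2 : ℝ≥0) : ℝ) : ℂ) else 0 := by
    intro k l
    rw [inner_map_map_of_star_mul_self, h, inner_smul_right, orthonormal_iff_ite.1 b.orthonormal]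
    split_ifs with hkl
    · rw [hkl, mul_one]
    · rw [mul_zero]
  have hz : ∀ k, s k = 0 → A (b k) = 0 := fun k hk => by
    rw [← inner_self_eq_zero (𝕜 := ℂ), hin, if_pos rfl, hk]; simp
  -- As 0⁻¹ = 0, u vanishes at zero singular values; the family is orthonormal off these indices,
  -- hence Bessel overall.
  let u : κ → H := fun k => (((s k)⁻¹ : ℝ) : ℂ) • A (b k)
  have ho : Orthonormal ℂ fun k : {k // s k ≠ 0} => u k := by
    rw [orthonormal_iff_ite]
    rintro ⟨k, hk⟩ ⟨l, hl⟩
    simp only [u, inner_smul_left, inner_smul_right, hin, Subtype.mk.injEq]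
    split_ifs with hkl
    · subst hkl
      have : ((s k : ℝ) : ℂ) ≠ 0 := by simpa using hk
      rw [Complex.conj_ofReal]
      push_cast
      field_simp
    · simp
  refine ⟨u, fun k => ?_, fun t x => ?_, fun k hk => ho.1 ⟨k, hk⟩⟩
  · by_cases hk : s k = 0
    · rw [hz k hk, hk]; simp
    · have : ((s k : ℝ) : ℂ) ≠ 0 := by simpa using hk
      simp only [u, smul_smul]
      push_cast
      rw [mul_inv_cancel₀ this, one_smul]
  · have h1 := ho.sum_inner_products_le x (s := t.subtype fun k => s k ≠ 0)
    rw [Finset.sum_subtype_eq_sum_filter (f := fun k => ‖inner ℂ (u k) x‖ ^ 2)] at h1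
    rw [Finset.sum_coe_sort t (fun k => ‖inner ℂ (u k) x‖ ^ 2)]
    refine le_trans (le_of_eq ?_) h1
    rw [Finset.sum_filter_of_ne]
    intro k _ hne hk
    apply hne
    simp [u, hk]

/-- With W i k = |⟨e i, b k⟩| |⟨f i, u k⟩|, the coefficient of index i is at most ∑ W i k s k. Both
row and column sums of W are at most 1: Jensen uses the rows, the final summation the columns. -/
theorem sum_enorm_inner_rpow_le (A : H →L[ℂ] H) (b : HilbertBasis κ ℂ H) (s : κ → ℝ≥0)
    (h : ∀ k, (star A * A) (b k) = (((s k ^ 2 : ℝ≥0) : ℝ) : ℂ) • b k) {r : ℝ} (hr : 1 ≤ r)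
    {ι : Type*} [Fintype ι] {e f : ι → H} (he : Bessel e) (hf : Bessel f) :
    ∑ i, ‖inner ℂ (f i) (A (e i))‖ₑ ^ r ≤ ∑' k, (s k : ℝ≥0∞) ^ r := by
  obtain ⟨u, hu, hub, hun⟩ := exists_left_singular_vectors A b s h
  have hu1 : ∀ k, ‖u k‖ ≤ 1 := fun k => (hub {k}).norm_le_one ⟨k, Finset.mem_singleton_self k⟩
  let W : ι → κ → ℝ≥0∞ := fun i k => ‖inner ℂ (e i) (b k)‖ₑ * ‖inner ℂ (f i) (u k)‖ₑ
  have hW1 : ∀ i, ∑' k, W i k ≤ 1 := by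
    intro i
    rw [ENNReal.tsum_eq_iSup_sum]
    refine iSup_le fun t => ?_
    have hbt : Bessel fun k : t => b k :=
      (b.orthonormal.comp (fun k : t => (k : κ)) Subtype.val_injective).bessel
    have := hbt.sum_enorm_mul_enorm_le (hub t) (he.norm_le_one i) (hf.norm_le_one i)
    rw [← Finset.sum_coe_sort]
    refine le_trans (le_of_eq (Finset.sum_congr rfl fun k _ => ?_)) this
    simp only [W]
    rw [← enorm_norm, norm_inner_symm, enorm_norm, ← enorm_norm (inner ℂ (f i) _),
      norm_inner_symm, enorm_norm]
  have hi : ∀ i, ‖inner ℂ (f i) (A (e i))‖ₑ ≤ ∑' k, W i k * s k := by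
    intro i
    have h1 := ((b.hasSum_repr (e i)).mapL A).mapL (innerSL ℂ (f i))
    rw [innerSL_apply_apply] at h1
    rw [← h1.tsum_eq]
    refine enorm_tsum_le_tsum_enorm.trans (ENNReal.tsum_le_tsum fun k => ?_)
    simp only [map_smul, hu, innerSL_apply_apply, smul_eq_mul, enorm_mul, b.repr_apply_apply, W]
    rw [← enorm_norm (inner ℂ (b k) _), norm_inner_symm, enorm_norm]
    have : ‖((s k : ℝ) : ℂ)‖ₑ = s k := by
      rw [← ofReal_norm, Complex.norm_real, Real.norm_of_nonneg (NNReal.coe_nonneg _),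
        ENNReal.ofReal_coe_nnreal]
    rw [this, mul_assoc, mul_comm (s k : ℝ≥0∞)]
  calc ∑ i, ‖inner ℂ (f i) (A (e i))‖ₑ ^ r ≤ ∑ i, ∑' k, W i k * (s k : ℝ≥0∞) ^ r :=
        Finset.sum_le_sum fun i _ => (ENNReal.rpow_le_rpow (hi i) (by linarith)).trans
          (ENNReal.rpow_tsum_mul_le_tsum hr _ _ (hW1 i))
    _ = ∑' k, (∑ i, W i k) * (s k : ℝ≥0∞) ^ r := by
        rw [← Summable.tsum_finsetSum (fun _ _ => ENNReal.summable)]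
        simp_rw [Finset.sum_mul]
    _ ≤ _ := ENNReal.tsum_le_tsum fun k => by
        refine mul_le_of_le_one_left' ?_
        exact he.sum_enorm_mul_enorm_le hf (b.orthonormal.1 k).le (hu1 k)

end SingularValues

/-! ### The variational norm. -/

section VarNorm

variable {H : Type v} [NormedAddCommGroup H] [InnerProductSpace ℂ H]

/-- The diagonal coefficients of `A` with respect to two finite families. -/
def diagCoeff {ι : Type*} (p : ℝ≥0∞) (e f : ι → H) (A : H →L[ℂ] H) : PiLp p (fun _ : ι => ℂ) :=
  WithLp.toLp p fun i => inner ℂ (f i) (A (e i))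

variable (p : ℝ≥0∞) [Fact (1 ≤ p)]

/-- The supremum of the `ℓ^p` norms of the diagonal coefficients of `A` with respect to finite
Bessel families. -/
def varNorm (A : H →L[ℂ] H) : ℝ≥0∞ :=
  ⨆ (n : ℕ) (e : Fin n → H) (f : Fin n → H) (_ : Bessel e) (_ : Bessel f), ‖diagCoeff p e f A‖ₑ

theorem varNorm_le_iff {A : H →L[ℂ] H} {c : ℝ≥0∞} : varNorm p A ≤ c ↔
    ∀ (n : ℕ) (e f : Fin n → H), Bessel e → Bessel f → ‖diagCoeff p e f A‖ₑ ≤ c := by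
  simp only [varNorm, iSup_le_iff]

variable {p} in
theorem enorm_diagCoeff_rpow (hp : p ≠ ∞) {ι : Type*} [Fintype ι] (e f : ι → H) (A : H →L[ℂ] H) :
    ‖diagCoeff p e f A‖ₑ ^ p.toReal = ∑ i, ‖inner ℂ (f i) (A (e i))‖ₑ ^ p.toReal := by
  have h0 : 0 < p.toReal := ENNReal.toReal_pos (zero_lt_one.trans_le Fact.out).ne' hp
  rw [enorm_eq_nnnorm, PiLp.nnnorm_eq_sum hp, ← ENNReal.coe_rpow_of_nonneg _ h0.le,
    ← NNReal.rpow_mul, one_div, inv_mul_cancel₀ h0.ne', NNReal.rpow_one]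
  push_cast
  refine Finset.sum_congr rfl fun i _ => ?_
  rw [ENNReal.coe_rpow_of_nonneg _ h0.le]; rfl

/-- Needed because `varNorm` ranges over the types `Fin n`, while families arise on other finite
types. -/
theorem enorm_diagCoeff_comp_equiv {ι κ : Type*} [Fintype ι] [Fintype κ] (σ : κ ≃ ι)
    (e f : ι → H) (A : H →L[ℂ] H) :
    ‖diagCoeff p (fun k => e (σ k)) (fun k => f (σ k)) A‖ₑ = ‖diagCoeff p e f A‖ₑ := by
  rcases eq_or_ne p ∞ with rfl | hp
  · simp only [enorm_eq_nnnorm, PiLp.nnnorm_eq_ciSup]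
    congr 1
    exact σ.iSup_congr fun _ => rfl
  · have h0 : 0 < p.toReal := ENNReal.toReal_pos (zero_lt_one.trans_le Fact.out).ne' hp
    rw [← (ENNReal.rpow_left_injective h0.ne').eq_iff]
    rw [enorm_diagCoeff_rpow hp, enorm_diagCoeff_rpow hp]
    exact σ.sum_comp fun i => ‖inner ℂ (f i) (A (e i))‖ₑ ^ p.toReal

theorem enorm_diagCoeff_le_varNorm {ι : Type*} [Fintype ι] {e f : ι → H} (he : Bessel e)
    (hf : Bessel f) (A : H →L[ℂ] H) : ‖diagCoeff p e f A‖ₑ ≤ varNorm p A := by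
  rw [← enorm_diagCoeff_comp_equiv p (Fintype.equivFin ι).symm]
  exact (varNorm_le_iff p).1 le_rfl _ _ _ (he.comp_equiv _) (hf.comp_equiv _)

theorem varNorm_top_eq (A : H →L[ℂ] H) : varNorm ∞ A = ‖A‖ₑ := by
  refine le_antisymm ((varNorm_le_iff ∞).2 fun n e f he hf => ?_) ?_
  · rw [enorm_le_iff_norm_le, PiLp.norm_eq_ciSup]
    refine Real.iSup_le (fun i => ?_) (norm_nonneg _)
    refine (norm_inner_le_norm _ _).trans ?_
    refine (mul_le_of_le_one_left (norm_nonneg _) (hf.norm_le_one i)).trans ?_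
    exact (A.le_opNorm _).trans (mul_le_of_le_one_right (norm_nonneg _) (he.norm_le_one i))
  · rcases eq_or_ne (varNorm ∞ A) ∞ with h | h
    · rw [h]; exact le_top
    lift varNorm ∞ A to ℝ≥0 using h with c hc
    have key : ∀ x y : H, ‖x‖ = 1 → ‖y‖ = 1 → ‖inner ℂ y (A x)‖ ≤ c := by
      intro x y hx hy
      have h1 := enorm_diagCoeff_le_varNorm ∞ (e := fun _ : Unit => x) (f := fun _ : Unit => y)
        (bessel_of_unique hx.le) (bessel_of_unique hy.le) A
      rw [← hc, enorm_eq_nnnorm, ENNReal.coe_le_coe, ← NNReal.coe_le_coe, coe_nnnorm] at h1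
      exact (PiLp.norm_apply_le (diagCoeff ∞ (fun _ : Unit => x) (fun _ : Unit => y) A) ()).trans h1
    rw [enorm_eq_nnnorm, ENNReal.coe_le_coe, ← NNReal.coe_le_coe, coe_nnnorm]
    refine A.opNorm_le_of_unit_norm c.2 fun x hx => ?_
    by_cases h0 : A x = 0
    · rw [h0, norm_zero]; exact c.2
    have hn : 0 < ‖A x‖ := norm_pos_iff.2 h0
    have h2 := key x (((‖A x‖⁻¹ : ℝ) : ℂ) • A x) hx (by simp [norm_smul, hn.ne'])
    rw [inner_smul_left, inner_self_eq_norm_sq_to_K, norm_mul] at h2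
    simp only [Complex.conj_ofReal, Complex.norm_real, norm_inv, norm_norm, norm_pow,
      Complex.coe_algebraMap] at h2
    rwa [sq, inv_mul_cancel_left₀ hn.ne'] at h2

end VarNorm
-- The Schatten norm equals the variational norm.
section SchattenVariational

variable {H : Type v} [NormedAddCommGroup H] [InnerProductSpace ℂ H] [CompleteSpace H]
variable {p : ℝ≥0∞} [Fact (1 ≤ p)]

theorem toReal_one_le_of_fact (hp : p ≠ ∞) : 1 ≤ p.toReal := by
  rw [← ENNReal.toReal_one]
  exact ENNReal.toReal_mono hp Fact.out

/-- `A` has a singular value decomposition with right singular vectors forming a Hilbert basis. -/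
def HasSingularBasis (A : H →L[ℂ] H) : Prop :=
  ∃ (κ : Type v) (b : HilbertBasis κ ℂ H) (s : κ → ℝ≥0),
    ∀ k, (star A * A) (b k) = (((s k ^ 2 : ℝ≥0) : ℝ) : ℂ) • b k

theorem IsCompactOperator.hasSingularBasis {A : H →L[ℂ] H} (hA : IsCompactOperator A) :
    HasSingularBasis A := by
  have h : IsCompactOperator (star A * A) := hA.clm_comp (star A)
  obtain ⟨κ, b, t, ht⟩ := exists_hilbertBasis_eigenvectors h (star_mul_self_nonneg A)
  exact ⟨κ, b, fun k => NNReal.sqrt (t k), fun k => by rw [ht, NNReal.sq_sqrt]⟩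

/-- Along an orthonormal sequence with ‖R (e k)‖ ≥ δ, the first n vectors contribute at least n δ².
-/
theorem opTrace_star_mul_self_eq_top {R : H →L[ℂ] H} (hR : ¬ IsCompactOperator R) :
    opTrace (star R * R) = ∞ := by
  classical
  obtain ⟨δ, hδ, e, he, hle, -⟩ := exists_orthonormal_of_not_isCompactOperator hR
  refine ENNReal.eq_top_of_forall_nnreal_le fun r => ?_
  obtain ⟨n, hn⟩ := exists_nat_ge ((r : ℝ) / δ ^ 2)
  rw [div_le_iff₀ (by positivity)] at hn
  have hinj : Function.Injective e := he.linearIndependent.injective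
  let s : Finset H := (Finset.range n).image e
  have ho : Orthonormal ℂ (fun x : s => (x : H)) :=
    he.toSubtypeRange.comp
      (fun x : s => (⟨x, by
        obtain ⟨k, -, hk⟩ := Finset.mem_image.1 x.2; exact ⟨k, hk⟩⟩ : Set.range e))
      fun x y hxy => Subtype.ext (congrArg (fun z : Set.range e => (z : H)) hxy)
  refine le_trans ?_ (le_iSup₂ (f := fun (s : Finset H)
      (_ : Orthonormal ℂ (fun e : s => (e : H))) => _) s ho)
  rw [Finset.sum_image hinj.injOn]
  have h1 : ∀ k ∈ Finset.range n, ENNReal.ofReal (δ ^ 2) ≤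
      ENNReal.ofReal (inner ℂ (e k) ((star R * R) (e k))).re := by
    intro k _
    rw [← inner_map_map_of_star_mul_self, inner_self_eq_norm_sq_to_K]
    refine ENNReal.ofReal_le_ofReal ?_
    have : (((‖R (e k)‖ : ℝ) : ℂ) ^ 2).re = ‖R (e k)‖ ^ 2 := by
      rw [← Complex.ofReal_pow, Complex.ofReal_re]
    refine le_trans ?_ this.ge
    have := hle k
    gcongr
  refine le_trans ?_ (Finset.sum_le_sum h1)
  rw [Finset.sum_const, Finset.card_range, nsmul_eq_mul, ← ENNReal.ofReal_natCast,
    ← ENNReal.ofReal_mul (by positivity), ← ENNReal.ofReal_coe_nnreal]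
  exact ENNReal.ofReal_le_ofReal hn

/-- Finite trace of |A|^r = R*R with R = |A|^(r/2) makes R compact, hence diagonal in some basis;
and A*A = R^(4/r) is diagonal in the same basis. An eigenvalue t of R corresponds to the singular
value t^(2/r). -/
theorem hasSingularBasis_of_opTrace {A : H →L[ℂ] H} {r : ℝ} (hr : 0 < r)
    (h : opTrace (CFC.rpow (CFC.abs A) r) ≠ ∞) : HasSingularBasis A := by
  have habs : 0 ≤ CFC.abs A := CFC.abs_nonneg A
  set R : H →L[ℂ] H := CFC.abs A ^ (r / 2) with hRdef
  have hR0 : 0 ≤ R := CFC.rpow_nonneg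
  have hRR : star R * R = CFC.rpow (CFC.abs A) r := by
    rw [hR0.isSelfAdjoint.star_eq, ← sq, ← CFC.rpow_natCast R 2 hR0, hRdef,
      CFC.rpow_rpow_of_exponent_nonneg _ _ _ (by positivity) (by positivity)]
    rw [CFC.rpow_eq_pow]; congr 1; push_cast; ring
  have hRc : IsCompactOperator R := by
    by_contra hc
    exact h (hRR ▸ opTrace_star_mul_self_eq_top hc)
  have hAA : star A * A = CFC.rpow R (4 / r) := by
    rw [CFC.rpow_eq_pow, hRdef,
      CFC.rpow_rpow_of_exponent_nonneg _ _ _ (by positivity) (by positivity),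
      ← CFC.abs_mul_abs, ← sq, ← CFC.rpow_natCast _ 2 habs]
    congr 1; field_simp; norm_num
  obtain ⟨κ, b, t, ht⟩ := exists_hilbertBasis_eigenvectors hRc hR0
  refine ⟨κ, b, fun k => t k ^ (2 / r), fun k => ?_⟩
  rw [hAA, rpow_apply_eigenvector hR0 (ht k) (by positivity), ← NNReal.rpow_natCast,
    ← NNReal.rpow_mul]
  congr 4
  push_cast; ring

/-- Pairing an orthonormal sequence with its normalized orthogonal images gives diagonal
coefficients at least δ, so n δ^p stays below the p-th power of the norm for every n. -/
theorem isCompactOperator_of_varNorm (hp : p ≠ ∞) {A : H →L[ℂ] H} (h : varNorm p A ≠ ∞) :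
    IsCompactOperator A := by
  by_contra hc
  have hr := toReal_one_le_of_fact hp
  have hr0 : 0 < p.toReal := by linarith
  obtain ⟨δ, hδ, e, he, hle, horth⟩ := exists_orthonormal_of_not_isCompactOperator hc
  have hpos : ∀ k, 0 < ‖A (e k)‖ := fun k => hδ.trans_le (hle k)
  let f : ℕ → H := fun k => ((‖A (e k)‖⁻¹ : ℝ) : ℂ) • A (e k)
  have hf : Orthonormal ℂ f := by
    refine ⟨fun k => by simp [f, norm_smul, (hpos k).ne'], fun k l hkl => ?_⟩
    simp only [f, inner_smul_left, inner_smul_right, horth k l hkl, mul_zero]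
  have hn : ∀ n : ℕ, (n : ℝ≥0∞) * ENNReal.ofReal δ ^ p.toReal ≤ varNorm p A ^ p.toReal := by
    intro n
    have h1 := enorm_diagCoeff_le_varNorm p
      (he.comp (fun i : Fin n => (i : ℕ)) Fin.val_injective).bessel
      (hf.comp (fun i : Fin n => (i : ℕ)) Fin.val_injective).bessel A
    have h2 := ENNReal.rpow_le_rpow h1 hr0.le
    rw [enorm_diagCoeff_rpow hp] at h2
    refine le_trans ?_ h2
    have h3 : ∀ i ∈ (Finset.univ : Finset (Fin n)), ENNReal.ofReal δ ^ p.toReal ≤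
        ‖inner ℂ ((f ∘ fun i : Fin n => (i : ℕ)) i) (A ((e ∘ fun i : Fin n => (i : ℕ)) i))‖ₑ
          ^ p.toReal := by
      intro i _
      refine ENNReal.rpow_le_rpow ?_ hr0.le
      rw [← ofReal_norm]
      refine ENNReal.ofReal_le_ofReal ((hle i).trans (le_of_eq ?_))
      simp only [Function.comp, f, inner_smul_left, inner_self_eq_norm_sq_to_K, norm_mul,
        Complex.conj_ofReal, Complex.norm_real, norm_inv, norm_norm, norm_pow,
        Complex.coe_algebraMap]
      rw [sq, inv_mul_cancel_left₀ (hpos _).ne']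
    refine le_trans ?_ (Finset.sum_le_sum h3)
    simp
  have htop : varNorm p A ^ p.toReal ≠ ∞ := ENNReal.rpow_ne_top_of_nonneg hr0.le h
  have hd : ENNReal.ofReal δ ^ p.toReal ≠ 0 := by
    simp [ENNReal.rpow_eq_zero_iff, hr0, hr0.not_gt, hδ]
  obtain ⟨n, hnlt⟩ := ENNReal.exists_nat_gt (ENNReal.div_lt_top htop hd).ne
  refine absurd (hn n) (not_le.2 ?_)
  rwa [ENNReal.div_lt_iff (Or.inl hd) (Or.inr htop)] at hnlt

/-- For p < ∞ and A with a singular basis, right and left singular vectors are optimal test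
families, and `sum_enorm_inner_rpow_le` shows that no others do better. -/
theorem schattenNorm_eq_varNorm (A : H →L[ℂ] H) : schattenNorm p A = varNorm p A := by
  rcases eq_or_ne p ∞ with rfl | hp
  · rw [varNorm_top_eq, schattenNorm, if_pos rfl]
  have hr := toReal_one_le_of_fact hp
  have hr0 : 0 < p.toReal := by linarith
  rw [schattenNorm, if_neg hp]
  by_cases hA : HasSingularBasis A
  · obtain ⟨κ, b, s, hs⟩ := hA
    rw [opTrace_abs_rpow A b s hs hr0.le]
    refine le_antisymm ?_ ?_
    · rw [one_div, ENNReal.rpow_inv_le_iff hr0, ENNReal.tsum_eq_iSup_sum]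
      refine iSup_le fun t => ?_
      obtain ⟨u, hu, hub, hun⟩ := exists_left_singular_vectors A b s hs
      have hbt : Bessel fun k : t => b k :=
        (b.orthonormal.comp (fun k : t => (k : κ)) Subtype.val_injective).bessel
      have h1 := ENNReal.rpow_le_rpow (enorm_diagCoeff_le_varNorm p hbt (hub t) A) hr0.le
      rw [enorm_diagCoeff_rpow hp] at h1
      refine le_trans (le_of_eq ?_) h1
      rw [← Finset.sum_coe_sort]
      refine Finset.sum_congr rfl fun k _ => ?_
      congr 1
      rw [hu, inner_smul_right, inner_self_eq_norm_sq_to_K, enorm_mul]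
      have h2 : ‖((s k : ℝ) : ℂ)‖ₑ = s k := by
        rw [← ofReal_norm, Complex.norm_real, Real.norm_of_nonneg (NNReal.coe_nonneg _),
          ENNReal.ofReal_coe_nnreal]
      rw [h2]
      by_cases hk : s k = 0
      · simp [hk]
      · rw [hun _ hk]; simp
    · refine (varNorm_le_iff p).2 fun n e f he hf => ?_
      rw [one_div, ENNReal.le_rpow_inv_iff hr0, enorm_diagCoeff_rpow hp]
      exact sum_enorm_inner_rpow_le A b s hs hr he hf
  -- Without a singular basis both sides are infinite, since finiteness of either would produce one.
  · have h1 : opTrace (CFC.rpow (CFC.abs A) p.toReal) = ∞ := by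
      by_contra h; exact hA (hasSingularBasis_of_opTrace hr0 h)
    have h2 : varNorm p A = ∞ := by
      by_contra h; exact hA (isCompactOperator_of_varNorm hp h).hasSingularBasis
    rw [h1, h2, ENNReal.top_rpow_of_pos (by positivity)]

end SchattenVariational

/-! ### Norm, ideal and semicontinuity properties of the Schatten classes. -/

section SchattenProperties

variable {H : Type v} [NormedAddCommGroup H] [InnerProductSpace ℂ H] [CompleteSpace H]
variable {H' : Type w} [NormedAddCommGroup H'] [InnerProductSpace ℂ H'] [CompleteSpace H']
variable {p : ℝ≥0∞} [Fact (1 ≤ p)]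

theorem schattenNorm_le_iff {A : H →L[ℂ] H} {c : ℝ≥0∞} : schattenNorm p A ≤ c ↔
    ∀ (n : ℕ) (e f : Fin n → H), Bessel e → Bessel f → ‖diagCoeff p e f A‖ₑ ≤ c := by
  rw [schattenNorm_eq_varNorm, varNorm_le_iff]

theorem enorm_diagCoeff_le {ι : Type*} [Fintype ι] {e f : ι → H} (he : Bessel e)
    (hf : Bessel f) (A : H →L[ℂ] H) : ‖diagCoeff p e f A‖ₑ ≤ schattenNorm p A := by
  rw [schattenNorm_eq_varNorm]; exact enorm_diagCoeff_le_varNorm p he hf A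

theorem schattenNorm_add_le (A B : H →L[ℂ] H) :
    schattenNorm p (A + B) ≤ schattenNorm p A + schattenNorm p B := by
  refine schattenNorm_le_iff.2 fun n e f he hf => ?_
  have : diagCoeff p e f (A + B) = diagCoeff p e f A + diagCoeff p e f B := by
    ext i; simp [diagCoeff]
  rw [this]
  exact (enorm_add_le _ _).trans
    (add_le_add (enorm_diagCoeff_le he hf A) (enorm_diagCoeff_le he hf B))

theorem schattenNorm_smul_le (c : ℂ) (A : H →L[ℂ] H) :
    schattenNorm p (c • A) ≤ ‖c‖ₑ * schattenNorm p A := by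
  refine schattenNorm_le_iff.2 fun n e f he hf => ?_
  have : diagCoeff p e f (c • A) = c • diagCoeff p e f A := by
    ext i; simp [diagCoeff]
  rw [this, enorm_smul]
  gcongr
  exact enorm_diagCoeff_le he hf A

theorem schattenNorm_zero : schattenNorm p (0 : H →L[ℂ] H) = 0 := by
  have := schattenNorm_smul_le (p := p) 0 (0 : H →L[ℂ] H)
  simpa using this

theorem schattenNorm_sum_le {ι : Type*} (s : Finset ι) (A : ι → H →L[ℂ] H) :
    schattenNorm p (∑ i ∈ s, A i) ≤ ∑ i ∈ s, schattenNorm p (A i) := by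
  classical
  induction s using Finset.induction_on with
  | empty => simp [schattenNorm_zero]
  | insert a s ha ih =>
    rw [Finset.sum_insert ha, Finset.sum_insert ha]
    exact (schattenNorm_add_le _ _).trans (by gcongr)

/-- Testing S A T on e, f is testing A on T e, S* f, which are again Bessel. -/
theorem schattenNorm_conj_le_of_norm_le_one (S : H →L[ℂ] H') (T : H' →L[ℂ] H) (hS : ‖S‖ ≤ 1)
    (hT : ‖T‖ ≤ 1) (A : H →L[ℂ] H) : schattenNorm p (S ∘L A ∘L T) ≤ schattenNorm p A := by
  refine schattenNorm_le_iff.2 fun n e f he hf => ?_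
  have : diagCoeff p e f (S ∘L A ∘L T) =
      diagCoeff p (fun i => T (e i)) (fun i => S.adjoint (f i)) A := by
    ext i; simp [diagCoeff, ContinuousLinearMap.adjoint_inner_left]
  rw [this]
  exact enorm_diagCoeff_le (he.map hT) (hf.map (by rwa [LinearIsometryEquiv.norm_map])) A

theorem schattenNorm_conj_le (S : H →L[ℂ] H') (T : H' →L[ℂ] H) (A : H →L[ℂ] H) :
    schattenNorm p (S ∘L A ∘L T) ≤ ‖S‖ₑ * ‖T‖ₑ * schattenNorm p A := by
  by_cases hS0 : S = 0
  · simp [hS0, schattenNorm_zero]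
  by_cases hT0 : T = 0
  · simp [hT0, schattenNorm_zero]
  have hS : ‖S‖ ≠ 0 := norm_ne_zero_iff.2 hS0
  have hT : ‖T‖ ≠ 0 := norm_ne_zero_iff.2 hT0
  have h1 : S ∘L A ∘L T = ((‖S‖ * ‖T‖ : ℝ) : ℂ) •
      ((((‖S‖⁻¹ : ℝ) : ℂ) • S) ∘L A ∘L (((‖T‖⁻¹ : ℝ) : ℂ) • T)) := by
    ext x
    simp only [ContinuousLinearMap.comp_apply, smul_apply, map_smul, smul_smul]
    have : ((‖S‖ * ‖T‖ : ℝ) : ℂ) * (((‖T‖⁻¹ : ℝ) : ℂ) * ((‖S‖⁻¹ : ℝ) : ℂ)) = 1 := by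
      have hS' : (‖S‖ : ℂ) ≠ 0 := by exact_mod_cast hS
      have hT' : (‖T‖ : ℂ) ≠ 0 := by exact_mod_cast hT
      push_cast
      field_simp
    rw [this, one_smul]
  rw [h1]
  refine (schattenNorm_smul_le _ _).trans ?_
  have h2 : ‖((‖S‖ * ‖T‖ : ℝ) : ℂ)‖ₑ = ‖S‖ₑ * ‖T‖ₑ := by
    rw [← ofReal_norm, Complex.norm_real, Real.norm_of_nonneg (by positivity),
      ENNReal.ofReal_mul (norm_nonneg _), ofReal_norm, ofReal_norm]
  rw [h2]
  gcongr
  refine schattenNorm_conj_le_of_norm_le_one _ _ ?_ ?_ A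
  · simp [norm_smul, hS]
  · simp [norm_smul, hT]

theorem enorm_le_schattenNorm (A : H →L[ℂ] H) : ‖A‖ₑ ≤ schattenNorm p A := by
  rw [← varNorm_top_eq]
  refine (varNorm_le_iff ∞).2 fun n e f he hf => ?_
  have h : ∀ i, ‖inner ℂ (f i) (A (e i))‖ₑ ≤ schattenNorm p A := by
    intro i
    refine le_trans ?_ (enorm_diagCoeff_le (p := p) (e := fun _ : Unit => e i)
      (f := fun _ : Unit => f i) (bessel_of_unique (he.norm_le_one i))
      (bessel_of_unique (hf.norm_le_one i)) A)
    rw [enorm_le_iff_norm_le]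
    exact PiLp.norm_apply_le (diagCoeff p (fun _ : Unit => e i) (fun _ : Unit => f i) A) ()
  rw [enorm_eq_nnnorm, PiLp.nnnorm_eq_ciSup]
  rcases isEmpty_or_nonempty (Fin n) with h0 | h0
  · simp
  · obtain ⟨i, hi⟩ := exists_eq_ciSup_of_finite (f := fun i => ‖(diagCoeff ∞ e f A) i‖₊)
    rw [← hi]; exact h i

/-- Each test involves finitely many matrix coefficients, so it is weakly continuous; a supremum of
such tests is lower semicontinuous. -/
theorem schattenNorm_le_of_tendsto {ι : Type*} {l : Filter ι} [l.NeBot] {F : ι → H →L[ℂ] H}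
    {A : H →L[ℂ] H} {c : ℝ≥0∞}
    (h : ∀ x y, Filter.Tendsto (fun i => inner ℂ x (F i y)) l (nhds (inner ℂ x (A y))))
    (hc : ∀ᶠ i in l, schattenNorm p (F i) ≤ c) : schattenNorm p A ≤ c := by
  refine schattenNorm_le_iff.2 fun n e f he hf => ?_
  have h1 : Filter.Tendsto (fun i => diagCoeff p e f (F i)) l (nhds (diagCoeff p e f A)) := by
    refine ((PiLp.continuous_toLp p (fun _ : Fin n => ℂ)).tendsto _).comp ?_
    exact tendsto_pi_nhds.2 fun i => h _ _
  refine le_of_tendsto h1.enorm ?_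
  filter_upwards [hc] with i hi using (enorm_diagCoeff_le he hf _).trans hi

theorem enorm_toLp_le_sum {ι : Type*} [Fintype ι] (a : ι → ℂ) :
    ‖(WithLp.toLp p a : PiLp p fun _ : ι => ℂ)‖ₑ ≤ ∑ i, ‖a i‖ₑ := by
  classical
  have h : (WithLp.toLp p a : PiLp p fun _ : ι => ℂ) =
      ∑ i, (WithLp.toLp p (Pi.single i (a i)) : PiLp p fun _ : ι => ℂ) := by
    rw [← WithLp.toLp_sum, Finset.univ_sum_single]
  rw [h]
  refine (enorm_sum_le _ _).trans (Finset.sum_le_sum fun i _ => le_of_eq ?_)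
  rw [PiLp.toLp_single, enorm_eq_nnnorm, PiLp.nnnorm_single]; rfl

/-- Factor through ℂ, whose identity has norm at most 1 because the ℓ^p norm is at most the ℓ^1
norm. -/
theorem schattenNorm_rankOne_le (x y : H) :
    schattenNorm p (InnerProductSpace.rankOne ℂ x y) ≤ ‖x‖ₑ * ‖y‖ₑ := by
  have h1 : schattenNorm p (ContinuousLinearMap.id ℂ ℂ) ≤ 1 := by
    refine schattenNorm_le_iff.2 fun n e f he hf => (enorm_toLp_le_sum _).trans ?_
    have h2 := he.sum_enorm_mul_enorm_le hf (x := 1) (y := 1) (by simp) (by simp)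
    refine le_trans (le_of_eq (Finset.sum_congr rfl fun i _ => ?_)) h2
    have h3 : ∀ z : ℂ, ‖inner ℂ z (1 : ℂ)‖ₑ = ‖z‖ₑ := fun z => by
      rw [← ofReal_norm, ← ofReal_norm]; simp
    have h4 : ‖inner ℂ (f i) (e i)‖ₑ = ‖f i‖ₑ * ‖e i‖ₑ := by
      rw [← ofReal_norm, ← ofReal_norm, ← ofReal_norm, ← ENNReal.ofReal_mul (norm_nonneg _)]
      congr 1
      simp [mul_comm]
    rw [ContinuousLinearMap.id_apply, h3, h3, h4, mul_comm]
  have h2 : InnerProductSpace.rankOne ℂ x y = ContinuousLinearMap.toSpanSingleton ℂ x ∘L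
      ContinuousLinearMap.id ℂ ℂ ∘L innerSL ℂ y := by
    ext z; simp
  rw [h2]
  refine (schattenNorm_conj_le _ _ _).trans ?_
  have h3 : ‖ContinuousLinearMap.toSpanSingleton ℂ x‖ₑ = ‖x‖ₑ := by
    rw [← ofReal_norm, ContinuousLinearMap.norm_toSpanSingleton, ofReal_norm]
  have h4 : ‖innerSL ℂ y‖ₑ = ‖y‖ₑ := by
    rw [← ofReal_norm, innerSL_apply_norm, ofReal_norm]
  rw [h3, h4]
  exact mul_le_of_le_one_right' h1

/-! ### The Schatten class is an operator ideal -/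

theorem mem_schattenClass_top {A : H →L[ℂ] H} : A ∈ schattenClass ∞ H ↔ IsCompactOperator A := by
  simp [schattenClass]

theorem mem_schattenClass_of_ne_top {p : ℝ≥0∞} (hp : p ≠ ∞) {A : H →L[ℂ] H} :
    A ∈ schattenClass p H ↔ schattenNorm p A < ∞ := by
  simp [schattenClass, hp]

theorem schattenNorm_lt_top {A : H →L[ℂ] H} (hA : A ∈ schattenClass p H) :
    schattenNorm p A < ∞ := by
  rcases eq_or_ne p ∞ with rfl | hp
  · rw [schattenNorm, if_pos rfl]; exact enorm_lt_top
  · exact (mem_schattenClass_of_ne_top hp).1 hA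

theorem isCompactOperator_of_mem_schattenClass {A : H →L[ℂ] H} (hA : A ∈ schattenClass p H) :
    IsCompactOperator A := by
  rcases eq_or_ne p ∞ with rfl | hp
  · exact mem_schattenClass_top.1 hA
  · refine isCompactOperator_of_varNorm hp ?_
    rw [← schattenNorm_eq_varNorm]
    exact (schattenNorm_lt_top hA).ne

/-- Members of the class are compact of finite norm for every p, so checking both conditions removes
the case distinction at p = ∞. -/
theorem mem_schattenClass_of_isCompactOperator {A : H →L[ℂ] H} (hA : IsCompactOperator A)
    (h : schattenNorm p A < ∞) : A ∈ schattenClass p H := by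
  rcases eq_or_ne p ∞ with rfl | hp
  · exact mem_schattenClass_top.2 hA
  · exact (mem_schattenClass_of_ne_top hp).2 h

theorem add_mem_schattenClass {A B : H →L[ℂ] H} (hA : A ∈ schattenClass p H)
    (hB : B ∈ schattenClass p H) : A + B ∈ schattenClass p H :=
  mem_schattenClass_of_isCompactOperator
    ((isCompactOperator_of_mem_schattenClass hA).add (isCompactOperator_of_mem_schattenClass hB))
    ((schattenNorm_add_le A B).trans_lt
      (ENNReal.add_lt_top.2 ⟨schattenNorm_lt_top hA, schattenNorm_lt_top hB⟩))

theorem zero_mem_schattenClass : (0 : H →L[ℂ] H) ∈ schattenClass p H :=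
  mem_schattenClass_of_isCompactOperator isCompactOperator_zero
    (by rw [schattenNorm_zero]; exact ENNReal.zero_lt_top)

theorem smul_mem_schattenClass (c : ℂ) {A : H →L[ℂ] H} (hA : A ∈ schattenClass p H) :
    c • A ∈ schattenClass p H :=
  mem_schattenClass_of_isCompactOperator ((isCompactOperator_of_mem_schattenClass hA).smul c)
    ((schattenNorm_smul_le c A).trans_lt (ENNReal.mul_lt_top enorm_lt_top (schattenNorm_lt_top hA)))

theorem sum_mem_schattenClass {ι : Type*} (s : Finset ι) {A : ι → H →L[ℂ] H}
    (hA : ∀ i ∈ s, A i ∈ schattenClass p H) : ∑ i ∈ s, A i ∈ schattenClass p H :=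
  Finset.sum_induction _ (· ∈ schattenClass p H) (fun _ _ => add_mem_schattenClass)
    zero_mem_schattenClass hA

theorem conj_mem_schattenClass (S : H →L[ℂ] H') (T : H' →L[ℂ] H) {A : H →L[ℂ] H}
    (hA : A ∈ schattenClass p H) : S ∘L A ∘L T ∈ schattenClass p H' :=
  mem_schattenClass_of_isCompactOperator
    (((isCompactOperator_of_mem_schattenClass hA).comp_clm T).clm_comp S)
    ((schattenNorm_conj_le S T A).trans_lt (ENNReal.mul_lt_top
      (ENNReal.mul_lt_top enorm_lt_top enorm_lt_top) (schattenNorm_lt_top hA)))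

theorem rankOne_mem_schattenClass (x y : H) :
    InnerProductSpace.rankOne ℂ x y ∈ schattenClass p H := by
  refine mem_schattenClass_of_isCompactOperator ?_ ((schattenNorm_rankOne_le x y).trans_lt
    (ENNReal.mul_lt_top enorm_lt_top enorm_lt_top))
  rw [InnerProductSpace.rankOne_def']
  exact (isCompactOperator_of_finrank (ContinuousLinearMap.toSpanSingleton ℂ x)).comp_clm
    (innerSL ℂ y)

end SchattenProperties
-- Block Schur multipliers relative to orthogonal isometries.
section BlockSchur

variable {H : Type*} [NormedAddCommGroup H] [InnerProductSpace ℂ H] [CompleteSpace H]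
variable {H' : Type*} [NormedAddCommGroup H'] [InnerProductSpace ℂ H'] [CompleteSpace H']
variable {K : Type*} [NormedAddCommGroup K] [InnerProductSpace ℂ K] [CompleteSpace K]
variable {ι : Type*} [Fintype ι]

open Classical in
/-- A family of isometries with pairwise orthogonal ranges. -/
def OrthoIsom (a : ι → K →L[ℂ] H) : Prop :=
  ∀ i j, (a i).adjoint ∘L a j = if i = j then ContinuousLinearMap.id ℂ K else 0

open Classical in
theorem OrthoIsom.adjoint_apply {a : ι → K →L[ℂ] H} (ha : OrthoIsom a) (i j : ι) (x : K) :
    (a i).adjoint (a j x) = if i = j then x else 0 := by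
  rw [← ContinuousLinearMap.comp_apply, ha]
  split_ifs <;> simp

theorem OrthoIsom.adjoint_sum {a : ι → K →L[ℂ] H} (ha : OrthoIsom a) (i : ι) (y : ι → K) :
    (a i).adjoint (∑ j, a j (y j)) = y i := by
  classical
  rw [map_sum]
  simp_rw [ha.adjoint_apply]
  simp

theorem OrthoIsom.norm_sum_sq {a : ι → K →L[ℂ] H} (ha : OrthoIsom a) (y : ι → K) :
    ‖∑ i, a i (y i)‖ ^ 2 = ∑ i, ‖y i‖ ^ 2 := by
  have h : inner ℂ (∑ i, a i (y i)) (∑ i, a i (y i)) = ∑ i, inner ℂ (y i) (y i) := by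
    rw [sum_inner]
    refine Finset.sum_congr rfl fun i _ => ?_
    rw [← ContinuousLinearMap.adjoint_inner_right, ha.adjoint_sum]
  simp_rw [inner_self_eq_norm_sq_to_K] at h
  exact_mod_cast h

theorem OrthoIsom.norm_sum_le {a : ι → K →L[ℂ] H} (ha : OrthoIsom a) (z : H) :
    ‖∑ i, a i ((a i).adjoint z)‖ ≤ ‖z‖ := by
  set t := ∑ i, a i ((a i).adjoint z) with ht
  have h1 : inner ℂ z t = ((‖t‖ ^ 2 : ℝ) : ℂ) := by
    rw [ht, ha.norm_sum_sq, inner_sum]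
    push_cast
    refine Finset.sum_congr rfl fun i _ => ?_
    rw [← ContinuousLinearMap.adjoint_inner_left, inner_self_eq_norm_sq_to_K]; rfl
  have h2 := norm_inner_le_norm (𝕜 := ℂ) z t
  rw [h1, Complex.norm_real, Real.norm_of_nonneg (by positivity), sq] at h2
  rcases (norm_nonneg t).eq_or_lt with h | h
  · rw [← h]; exact norm_nonneg z
  · exact le_of_mul_le_mul_right h2 h

theorem OrthoIsom.sum_norm_sq_le {a : ι → K →L[ℂ] H} (ha : OrthoIsom a) (z : H) :
    ∑ i, ‖(a i).adjoint z‖ ^ 2 ≤ ‖z‖ ^ 2 := by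
  rw [← ha.norm_sum_sq]
  have := ha.norm_sum_le z
  gcongr

theorem OrthoIsom.comp_injective {κ : Type*} [Fintype κ] {a : ι → K →L[ℂ] H} (ha : OrthoIsom a)
    {σ : κ → ι} (hσ : Function.Injective σ) : OrthoIsom fun k => a (σ k) := by
  intro i j
  change (a (σ i)).adjoint ∘L a (σ j) = _
  rw [ha]
  by_cases h : i = j
  · simp [h]
  · rw [if_neg h, if_neg (hσ.ne h)]

/-- The partial isometry that intertwines two families of isometries. -/
def intertwiner (a : ι → K →L[ℂ] H) (b : ι → K →L[ℂ] H') : H →L[ℂ] H' :=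
  ∑ i, b i ∘L (a i).adjoint

theorem intertwiner_apply (a : ι → K →L[ℂ] H) (b : ι → K →L[ℂ] H') (z : H) :
    intertwiner a b z = ∑ i, b i ((a i).adjoint z) := by
  simp [intertwiner]

theorem OrthoIsom.intertwiner_apply_apply {a : ι → K →L[ℂ] H} (ha : OrthoIsom a)
    (b : ι → K →L[ℂ] H') (i : ι) (x : K) : intertwiner a b (a i x) = b i x := by
  classical
  rw [intertwiner_apply]
  simp_rw [ha.adjoint_apply]
  rw [Finset.sum_eq_single i] <;> simp +contextual

theorem OrthoIsom.norm_intertwiner_le {a : ι → K →L[ℂ] H} (ha : OrthoIsom a)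
    {b : ι → K →L[ℂ] H'} (hb : OrthoIsom b) : ‖intertwiner a b‖ ≤ 1 := by
  refine ContinuousLinearMap.opNorm_le_bound _ zero_le_one fun z => ?_
  rw [one_mul, intertwiner_apply]
  refine abs_le_of_sq_le_sq' ?_ (norm_nonneg _) |>.2
  rw [hb.norm_sum_sq]
  exact ha.sum_norm_sq_le z

/-- The Schur multiplier with symbol `φ` acting on the blocks of `B` relative to the family `a`. -/
def blockSchur (a : ι → K →L[ℂ] H) (φ : ι → ι → ℂ) : (H →L[ℂ] H) →ₗ[ℂ] (H →L[ℂ] H) where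
  toFun B := ∑ i, ∑ j, φ i j • (a i ∘L ((a i).adjoint ∘L B ∘L a j) ∘L (a j).adjoint)
  map_add' A B := by
    rw [← Finset.sum_add_distrib]
    refine Finset.sum_congr rfl fun i _ => ?_
    rw [← Finset.sum_add_distrib]
    refine Finset.sum_congr rfl fun j _ => ?_
    rw [← smul_add]
    congr 1
    ext x
    simp
  map_smul' c A := by
    rw [RingHom.id_apply, Finset.smul_sum]
    refine Finset.sum_congr rfl fun i _ => ?_
    rw [Finset.smul_sum]
    refine Finset.sum_congr rfl fun j _ => ?_
    rw [smul_comm]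
    congr 1
    ext x
    simp

theorem blockSchur_def (a : ι → K →L[ℂ] H) (φ : ι → ι → ℂ) (B : H →L[ℂ] H) : blockSchur a φ B =
    ∑ i, ∑ j, φ i j • (a i ∘L ((a i).adjoint ∘L B ∘L a j) ∘L (a j).adjoint) := rfl

theorem blockSchur_apply (a : ι → K →L[ℂ] H) (φ : ι → ι → ℂ) (B : H →L[ℂ] H) (x : H) :
    blockSchur a φ B x =
      ∑ i, ∑ j, φ i j • a i ((a i).adjoint (B (a j ((a j).adjoint x)))) := by
  simp [blockSchur_def]

theorem inner_blockSchur (a : ι → K →L[ℂ] H) (φ : ι → ι → ℂ) (B : H →L[ℂ] H) (x y : H) :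
    inner ℂ x (blockSchur a φ B y) =
      ∑ i, ∑ j, φ i j * inner ℂ (a i ((a i).adjoint x)) (B (a j ((a j).adjoint y))) := by
  rw [blockSchur_apply, inner_sum]
  refine Finset.sum_congr rfl fun i _ => ?_
  rw [inner_sum]
  refine Finset.sum_congr rfl fun j _ => ?_
  rw [inner_smul_right, ← ContinuousLinearMap.adjoint_inner_left,
    ContinuousLinearMap.adjoint_inner_right]

theorem blockSchur_comp_equiv {κ : Type*} [Fintype κ] (σ : κ ≃ ι) (a : ι → K →L[ℂ] H)
    (φ : ι → ι → ℂ) (B : H →L[ℂ] H) :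
    blockSchur (fun k => a (σ k)) (fun k l => φ (σ k) (σ l)) B = blockSchur a φ B := by
  rw [blockSchur_def, blockSchur_def, ← σ.sum_comp]
  refine Finset.sum_congr rfl fun i _ => ?_
  rw [← σ.sum_comp]

/-- The intertwiner W satisfies W a i = b i, and its adjoint satisfies (a i)* W* = (b i)*, so
conjugation by W moves the blocks of one family to those of the other. -/
theorem OrthoIsom.blockSchur_conj {a : ι → K →L[ℂ] H} (ha : OrthoIsom a)
    (b : ι → K →L[ℂ] H') (φ : ι → ι → ℂ) (B : H' →L[ℂ] H') :
    blockSchur b φ B = intertwiner a b ∘L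
      blockSchur a φ ((intertwiner a b).adjoint ∘L B ∘L intertwiner a b) ∘L
        (intertwiner a b).adjoint := by
  have hadj : ∀ i z, (a i).adjoint ((intertwiner a b).adjoint z) = (b i).adjoint z := by
    intro i z
    refine ext_inner_right ℂ fun x => ?_
    rw [ContinuousLinearMap.adjoint_inner_left, ContinuousLinearMap.adjoint_inner_left,
      ContinuousLinearMap.adjoint_inner_left, ha.intertwiner_apply_apply]
  ext x
  rw [ContinuousLinearMap.comp_apply, ContinuousLinearMap.comp_apply, blockSchur_apply,
    blockSchur_apply, map_sum]
  refine Finset.sum_congr rfl fun i _ => ?_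
  rw [map_sum]
  refine Finset.sum_congr rfl fun j _ => ?_
  simp only [map_smul, ContinuousLinearMap.comp_apply, hadj, ha.intertwiner_apply_apply]

theorem blockSchur_mem_schattenClass {p : ℝ≥0∞} [Fact (1 ≤ p)] (a : ι → K →L[ℂ] H)
    (φ : ι → ι → ℂ) {B : H →L[ℂ] H} (hB : B ∈ schattenClass p H) :
    blockSchur a φ B ∈ schattenClass p H :=
  sum_mem_schattenClass _ fun _ _ => sum_mem_schattenClass _ fun _ _ =>
    smul_mem_schattenClass _ (conj_mem_schattenClass _ _ (conj_mem_schattenClass _ _ hB))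

/-- The Schur multiplier with symbol `φ` on the blocks relative to `a` has norm at most `C` on the
Schatten class. -/
def SchurBound (p : ℝ≥0∞) (a : ι → K →L[ℂ] H) (φ : ι → ι → ℂ) (C : ℝ≥0) : Prop :=
  ∀ B ∈ schattenClass p H, schattenNorm p (blockSchur a φ B) ≤ C * schattenNorm p B

variable {p : ℝ≥0∞} [Fact (1 ≤ p)] {C : ℝ≥0} {φ : ι → ι → ℂ}

theorem SchurBound.schattenNormLE {a : ι → K →L[ℂ] H} (h : SchurBound p a φ C) :
    SchattenNormLE p (blockSchur a φ) C :=
  ⟨⟨fun _ hA => blockSchur_mem_schattenClass a φ hA, fun _ _ _ _ => map_add _ _ _,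
    fun _ _ _ => map_smul _ _ _⟩, h⟩

theorem SchurBound.transfer {a : ι → K →L[ℂ] H} (h : SchurBound p a φ C) (ha : OrthoIsom a)
    {b : ι → K →L[ℂ] H'} (hb : OrthoIsom b) : SchurBound p b φ C := by
  intro B hB
  have hW := ha.norm_intertwiner_le hb
  have hW' : ‖(intertwiner a b).adjoint‖ ≤ 1 := by rwa [LinearIsometryEquiv.norm_map]
  rw [ha.blockSchur_conj b φ B]
  refine (schattenNorm_conj_le_of_norm_le_one _ _ hW hW' _).trans ?_
  refine (h _ (conj_mem_schattenClass _ _ hB)).trans ?_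
  gcongr
  exact schattenNorm_conj_le_of_norm_le_one _ _ hW' hW _

/-- The matrix coefficients of the output are linear in the finitely many entries of the symbol, so
convergence of symbols is weak convergence of outputs. -/
theorem SchurBound.of_tendsto {a : ι → K →L[ℂ] H} {α : Type*} {l : Filter α} [l.NeBot]
    {ψ : α → ι → ι → ℂ} (h : ∀ᶠ k in l, SchurBound p a (ψ k) C)
    (hψ : ∀ i j, Filter.Tendsto (fun k => ψ k i j) l (nhds (φ i j))) : SchurBound p a φ C := by
  intro B hB
  refine schattenNorm_le_of_tendsto (l := l) (F := fun k => blockSchur a (ψ k) B)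
    (fun x y => ?_) (h.mono fun k hk => hk B hB)
  simp_rw [inner_blockSchur]
  exact tendsto_finsetSum _ fun i _ => tendsto_finsetSum _ fun j _ => (hψ i j).mul_const _

theorem SchurBound.of_approx {a : ι → K →L[ℂ] H}
    (h : ∀ ε : ℝ, 0 < ε → ∃ ψ : ι → ι → ℂ, (∀ i j, ‖ψ i j - φ i j‖ ≤ ε) ∧ SchurBound p a ψ C) :
    SchurBound p a φ C := by
  choose! ψ hψ hb using h
  have h0 : Filter.Tendsto (fun n : ℕ => 1 / ((n : ℝ) + 1)) Filter.atTop (nhds 0) :=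
    tendsto_one_div_add_atTop_nhds_zero_nat
  refine SchurBound.of_tendsto (l := Filter.atTop) (ψ := fun n : ℕ => ψ (1 / ((n : ℝ) + 1)))
    (Filter.Eventually.of_forall fun n => hb _ (by positivity)) fun i j => ?_
  refine tendsto_iff_norm_sub_tendsto_zero.2 (squeeze_zero (fun _ => norm_nonneg _)
    (fun n => hψ _ (by positivity) i j) h0)

/-- A bound that uses only the size of the entries and is uniform in ι and K; it serves to keep weak
limits compact when p = ∞. -/
theorem schattenNorm_two_blockSchur_rankOne_le {a : ι → K →L[ℂ] H} (ha : OrthoIsom a)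
    (hφ : ∀ i j, ‖φ i j‖ ≤ C) (x y : H) :
    schattenNorm 2 (blockSchur a φ (InnerProductSpace.rankOne ℂ x y)) ≤ C * (‖x‖ₑ * ‖y‖ₑ) := by
  -- Row i of the symbol applied to y, conjugated because it enters the first slot of the inner
  -- product. The output is z ↦ ∑ a i (⟨w i, z⟩ (a i)* x), with ‖w i‖ ≤ C ‖y‖.
  let w : ι → H := fun i => ∑ j, a j ((starRingEnd ℂ) (φ i j) • (a j).adjoint y)
  have hS : ∀ z, blockSchur a φ (InnerProductSpace.rankOne ℂ x y) z =
      ∑ i, a i (inner ℂ (w i) z • (a i).adjoint x) := by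
    intro z
    rw [blockSchur_apply]
    refine Finset.sum_congr rfl fun i _ => ?_
    simp only [w, sum_inner, InnerProductSpace.rankOne_apply, map_smul, Finset.sum_smul, map_sum]
    refine Finset.sum_congr rfl fun j _ => ?_
    rw [inner_smul_left, Complex.conj_conj, mul_smul]
    congr 2
    rw [← ContinuousLinearMap.adjoint_inner_left, ContinuousLinearMap.adjoint_inner_right]
  have hw : ∀ i, ‖w i‖ ≤ C * ‖y‖ := by
    intro i
    refine abs_le_of_sq_le_sq' ?_ (by positivity) |>.2
    rw [ha.norm_sum_sq, mul_pow]
    refine le_trans ?_ (mul_le_mul_of_nonneg_left (ha.sum_norm_sq_le y) (by positivity))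
    rw [Finset.mul_sum]
    refine Finset.sum_le_sum fun j _ => ?_
    rw [norm_smul, mul_pow, RCLike.norm_conj]
    have := hφ i j
    gcongr
  refine schattenNorm_le_iff.2 fun n e f he hf => ?_
  have hgoal : ‖diagCoeff 2 e f (blockSchur a φ (InnerProductSpace.rankOne ℂ x y))‖ ≤
      C * (‖x‖ * ‖y‖) := by
    refine abs_le_of_sq_le_sq' ?_ (by positivity) |>.2
    rw [PiLp.norm_sq_eq_of_L2]
    calc ∑ k, ‖inner ℂ (f k) (blockSchur a φ (InnerProductSpace.rankOne ℂ x y) (e k))‖ ^ 2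
        ≤ ∑ k, ∑ i, ‖inner ℂ (w i) (e k)‖ ^ 2 * ‖(a i).adjoint x‖ ^ 2 := by
          refine Finset.sum_le_sum fun k _ => ?_
          have h1 := (norm_inner_le_norm (𝕜 := ℂ) (f k)
            (blockSchur a φ (InnerProductSpace.rankOne ℂ x y) (e k))).trans
            (mul_le_of_le_one_left (norm_nonneg _) (hf.norm_le_one k))
          refine (pow_le_pow_left₀ (norm_nonneg _) h1 2).trans (le_of_eq ?_)
          rw [hS, ha.norm_sum_sq]
          simp_rw [norm_smul, mul_pow]
      _ = ∑ i, (∑ k, ‖inner ℂ (e k) (w i)‖ ^ 2) * ‖(a i).adjoint x‖ ^ 2 := by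
          rw [Finset.sum_comm]
          simp_rw [Finset.sum_mul, norm_inner_symm]
      _ ≤ ∑ i, (C * ‖y‖) ^ 2 * ‖(a i).adjoint x‖ ^ 2 := by
          refine Finset.sum_le_sum fun i _ => ?_
          have h1 := hw i
          have h2 := (he (w i)).trans (pow_le_pow_left₀ (norm_nonneg _) h1 2)
          gcongr
      _ ≤ (C * ‖y‖) ^ 2 * ‖x‖ ^ 2 := by
          rw [← Finset.mul_sum]
          have := ha.sum_norm_sq_le x
          gcongr
      _ = _ := by ring
  rw [← ofReal_norm]
  refine (ENNReal.ofReal_le_ofReal hgoal).trans (le_of_eq ?_)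
  rw [ENNReal.ofReal_mul (by positivity), ENNReal.ofReal_mul (by positivity), ofReal_norm,
    ofReal_norm, ENNReal.ofReal_coe_nnreal]

end BlockSchur
-- Hilbert tensor products and ampliations as block multipliers.
section Ampliation

variable {H : Type v} [NormedAddCommGroup H] [InnerProductSpace ℂ H] [CompleteSpace H]
variable {K : Type w} [NormedAddCommGroup K] [InnerProductSpace ℂ K] [CompleteSpace K]
variable {ι : Type*} [Fintype ι]

/-- The rank one isometries `c ↦ c • v i`. -/
def plainIsom (v : ι → H) (i : ι) : ℂ →L[ℂ] H := ContinuousLinearMap.toSpanSingleton ℂ (v i)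

theorem plainIsom_apply (v : ι → H) (i : ι) (c : ℂ) : plainIsom v i c = c • v i := rfl

theorem adjoint_plainIsom_apply (v : ι → H) (i : ι) (x : H) :
    (plainIsom v i).adjoint x = inner ℂ (v i) x := by
  refine ext_inner_left ℂ fun c => ?_
  rw [ContinuousLinearMap.adjoint_inner_right, plainIsom_apply, inner_smul_left]
  simp [mul_comm]

theorem Orthonormal.orthoIsom_plainIsom {v : ι → H} (hv : Orthonormal ℂ v) :
    OrthoIsom (plainIsom v) := by
  classical
  intro i j
  ext
  simp only [ContinuousLinearMap.comp_apply, plainIsom_apply, one_smul, adjoint_plainIsom_apply,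
    orthonormal_iff_ite.1 hv]
  split_ifs <;> simp

variable (K) in
/-- The operator `k ↦ x ⊗ k`. -/
def tensorLeft (x : H) : K →L[ℂ] HilbertTensor H K :=
  UniformSpace.Completion.toComplL ∘L TensorProduct.mkL ℂ H K x

theorem tensorLeft_apply (x : H) (k : K) :
    tensorLeft K x k = ((x ⊗ₜ[ℂ] k : H ⊗[ℂ] K) : HilbertTensor H K) := rfl

theorem tensorLeft_smul (c : ℂ) (x : H) : tensorLeft K (c • x) = c • tensorLeft K x := by
  ext k
  simp [tensorLeft]

theorem tensorLeft_sum {α : Type*} (s : Finset α) (x : α → H) :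
    tensorLeft K (∑ i ∈ s, x i) = ∑ i ∈ s, tensorLeft K (x i) := by
  ext k
  simp [tensorLeft]

theorem inner_tensorLeft (x y : H) (k l : K) :
    inner ℂ (tensorLeft K x k) (tensorLeft K y l) = inner ℂ x y * inner ℂ k l := by
  rw [tensorLeft_apply, tensorLeft_apply, UniformSpace.Completion.inner_coe,
    TensorProduct.inner_tmul]

theorem adjoint_tensorLeft_apply (x y : H) (k : K) :
    (tensorLeft K x).adjoint (tensorLeft K y k) = inner ℂ x y • k := by
  refine ext_inner_left ℂ fun l => ?_
  rw [ContinuousLinearMap.adjoint_inner_right, inner_tensorLeft, inner_smul_right]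

theorem dense_span_tensorLeft :
    Dense (Submodule.span ℂ {z : HilbertTensor H K | ∃ x k, z = tensorLeft K x k} :
      Set (HilbertTensor H K)) := by
  refine (UniformSpace.Completion.denseRange_coe (α := H ⊗[ℂ] K)).mono ?_
  rintro _ ⟨z, rfl⟩
  induction z with
  | zero =>
    rw [UniformSpace.Completion.coe_zero]
    exact Submodule.zero_mem _
  | tmul x k => exact Submodule.subset_span ⟨x, k, rfl⟩
  | add a b ha hb =>
    rw [UniformSpace.Completion.coe_add]
    exact Submodule.add_mem _ ha hb

theorem hilbertTensor_clm_ext {G : Type*} [NormedAddCommGroup G] [NormedSpace ℂ G]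
    {S T : HilbertTensor H K →L[ℂ] G}
    (h : ∀ x k, S (tensorLeft K x k) = T (tensorLeft K x k)) : S = T := by
  refine ContinuousLinearMap.ext_on dense_span_tensorLeft ?_
  rintro _ ⟨x, k, rfl⟩
  exact h x k

theorem opTensor_tensorLeft (A : H →L[ℂ] H) (B : K →L[ℂ] K) (x : H) (k : K) :
    opTensor A B (tensorLeft K x k) = tensorLeft K (A x) (B k) := by
  rw [tensorLeft_apply, tensorLeft_apply, opTensor, ContinuousLinearMap.completion_apply_coe]
  rfl

theorem norm_opTensor_le (A : H →L[ℂ] H) (B : K →L[ℂ] K) : ‖opTensor A B‖ ≤ ‖A‖ * ‖B‖ := by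
  refine ContinuousLinearMap.opNorm_le_bound _ (by positivity) fun z => ?_
  induction z using UniformSpace.Completion.induction_on with
  | hp => exact isClosed_le (by fun_prop) (by fun_prop)
  | ih z =>
    rw [opTensor, ContinuousLinearMap.completion_apply_coe, UniformSpace.Completion.norm_coe,
      UniformSpace.Completion.norm_coe]
    exact norm_map_tensor_le A B z

/-- A matrix unit tensored with B is an operator with the single block B; this links the definition
of complete boundedness to blocks. -/
theorem opTensor_rankOne (x y : H) (B : K →L[ℂ] K) :
    opTensor (InnerProductSpace.rankOne ℂ x y) B =
      tensorLeft K x ∘L B ∘L (tensorLeft K y).adjoint := by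
  refine hilbertTensor_clm_ext fun z k => ?_
  rw [opTensor_tensorLeft, ContinuousLinearMap.comp_apply, ContinuousLinearMap.comp_apply,
    adjoint_tensorLeft_apply, InnerProductSpace.rankOne_apply, tensorLeft_smul]
  simp

theorem adjoint_tensorLeft_comp_opTensor (A : H →L[ℂ] H) (B : K →L[ℂ] K) (x y : H) :
    (tensorLeft K x).adjoint ∘L opTensor A B ∘L tensorLeft K y = inner ℂ x (A y) • B := by
  ext k
  simp only [ContinuousLinearMap.comp_apply, opTensor_tensorLeft, adjoint_tensorLeft_apply,
    smul_apply]

variable (K) in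
/-- The isometries `k ↦ v i ⊗ k`. -/
def tensorIsom (v : ι → H) (i : ι) : K →L[ℂ] HilbertTensor H K := tensorLeft K (v i)

theorem Orthonormal.orthoIsom_tensorIsom {v : ι → H} (hv : Orthonormal ℂ v) :
    OrthoIsom (tensorIsom K v) := by
  classical
  intro i j
  ext k
  simp only [ContinuousLinearMap.comp_apply, tensorIsom, adjoint_tensorLeft_apply,
    orthonormal_iff_ite.1 hv]
  split_ifs <;> simp

theorem blockSchur_tensorIsom_opTensor (v : ι → H) (φ : ι → ι → ℂ) (A : H →L[ℂ] H)
    (B : K →L[ℂ] K) : blockSchur (tensorIsom K v) φ (opTensor A B) =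
      opTensor (blockSchur (plainIsom v) φ A) B := by
  refine hilbertTensor_clm_ext fun x k => ?_
  rw [opTensor_tensorLeft, blockSchur_apply, blockSchur_apply, tensorLeft_sum, sum_apply]
  refine Finset.sum_congr rfl fun i _ => ?_
  rw [tensorLeft_sum, sum_apply]
  refine Finset.sum_congr rfl fun j _ => ?_
  simp only [tensorIsom, adjoint_tensorLeft_apply, plainIsom_apply, adjoint_plainIsom_apply,
    map_smul, opTensor_tensorLeft, tensorLeft_smul, smul_apply, smul_smul]

end Ampliation

/-! ### From maps on the Schatten class to multipliers; multiplicity. -/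

section Compression

variable {H : Type*} [NormedAddCommGroup H] [InnerProductSpace ℂ H] [CompleteSpace H]
variable {K : Type*} [NormedAddCommGroup K] [InnerProductSpace ℂ K] [CompleteSpace K]
variable {ι : Type*} [Fintype ι] {p : ℝ≥0∞} [Fact (1 ≤ p)] {C : ℝ≥0}

theorem IsSchattenLinear.map_sum {T : (H →L[ℂ] H) → (H →L[ℂ] H)} (hT : IsSchattenLinear p T)
    {α : Type*} (s : Finset α) {A : α → H →L[ℂ] H} (hA : ∀ i ∈ s, A i ∈ schattenClass p H) :
    T (∑ i ∈ s, A i) = ∑ i ∈ s, T (A i) := by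
  classical
  induction s using Finset.induction_on with
  | empty =>
    have := hT.map_smul 0 0 zero_mem_schattenClass
    simpa using this
  | insert a s ha ih =>
    have h1 : ∀ i ∈ s, A i ∈ schattenClass p H := fun i hi => hA i (Finset.mem_insert_of_mem hi)
    rw [Finset.sum_insert ha, Finset.sum_insert ha, hT.map_add _ (hA a (Finset.mem_insert_self a s))
      _ (sum_mem_schattenClass s h1), ih h1]

/-- The all-ones symbol is compression by the projection ∑ a i (a i)*. -/
theorem schattenNorm_blockSchur_one_le {a : ι → K →L[ℂ] H} (ha : OrthoIsom a) (B : H →L[ℂ] H) :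
    schattenNorm p (blockSchur a (fun _ _ => 1) B) ≤ schattenNorm p B := by
  have h1 : blockSchur a (fun _ _ => 1) B = intertwiner a a ∘L B ∘L intertwiner a a := by
    ext x
    rw [ContinuousLinearMap.comp_apply, ContinuousLinearMap.comp_apply, blockSchur_apply,
      intertwiner_apply a a x, intertwiner_apply]
    refine Finset.sum_congr rfl fun i _ => ?_
    simp only [map_sum, one_smul]
  rw [h1]
  exact schattenNorm_conj_le_of_norm_le_one _ _ (ha.norm_intertwiner_le ha)
    (ha.norm_intertwiner_le ha) B

open Classical in
/-- A bounded map acting diagonally on matrix units after compression gives a bounded Schur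
multiplier. -/
theorem SchattenNormLE.schurBound {a : ι → K →L[ℂ] H} (ha : OrthoIsom a)
    {N : (H →L[ℂ] H) → (H →L[ℂ] H)} (hN : SchattenNormLE p N C) {ψ : ι → ι → ℂ}
    (h : ∀ b ∈ schattenClass p K, ∀ i j k l,
      (a k).adjoint ∘L N (a i ∘L b ∘L (a j).adjoint) ∘L a l =
        if i = k ∧ j = l then ψ i j • b else 0) : SchurBound p a ψ C := by
  intro B hB
  let b : ι → ι → K →L[ℂ] K := fun i j => (a i).adjoint ∘L B ∘L a j
  have hb : ∀ i j, b i j ∈ schattenClass p K := fun i j => conj_mem_schattenClass _ _ hB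
  have hab : ∀ i j, a i ∘L b i j ∘L (a j).adjoint ∈ schattenClass p H :=
    fun i j => conj_mem_schattenClass _ _ (hb i j)
  have h1 : blockSchur a (fun _ _ => 1) B = ∑ i, ∑ j, a i ∘L b i j ∘L (a j).adjoint := by
    simp only [blockSchur_def, one_smul, b]
  have h2 : N (blockSchur a (fun _ _ => 1) B) =
      ∑ i, ∑ j, N (a i ∘L b i j ∘L (a j).adjoint) := by
    rw [h1, hN.1.map_sum _ fun i _ => sum_mem_schattenClass _ fun j _ => hab i j]
    exact Finset.sum_congr rfl fun i _ => hN.1.map_sum _ fun j _ => hab i j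
  -- The multiplier is N between two compressions: only block (k, l) of the input contributes to
  -- block (k, l) of the output.
  have h3 : blockSchur a ψ B = blockSchur a (fun _ _ => 1) (N (blockSchur a (fun _ _ => 1) B)) := by
    rw [blockSchur_def a ψ, blockSchur_def a _ (N _)]
    refine Finset.sum_congr rfl fun k _ => Finset.sum_congr rfl fun l _ => ?_
    have h4 : (a k).adjoint ∘L N (blockSchur a (fun _ _ => 1) B) ∘L a l = ψ k l • b k l := by
      have h5 : ∀ i j, (a k).adjoint ∘L N (a i ∘L b i j ∘L (a j).adjoint) ∘L a l =
          if i = k ∧ j = l then ψ i j • b i j else 0 := fun i j => h _ (hb i j) i j k l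
      have h6 : (a k).adjoint ∘L N (blockSchur a (fun _ _ => 1) B) ∘L a l =
          ∑ i, ∑ j, (a k).adjoint ∘L N (a i ∘L b i j ∘L (a j).adjoint) ∘L a l := by
        rw [h2]; ext x; simp
      rw [h6]
      simp_rw [h5]
      rw [Finset.sum_eq_single k, Finset.sum_eq_single l]
      · simp
      · intro j _ hj; simp [hj]
      · simp
      · intro i _ hi; simp [hi]
      · simp
    rw [h4, one_smul]
    ext x
    simp [b]
  rw [h3]
  refine (schattenNorm_blockSchur_one_le ha _).trans ?_
  refine (hN.2 _ (blockSchur_mem_schattenClass a _ hB)).trans ?_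
  gcongr
  exact schattenNorm_blockSchur_one_le ha B

/-- Enlarging a Schur multiplier by constant blocks controls it with arbitrary multiplicity. -/
theorem schurBound_of_inflation {φ : ι → ι → ℂ}
    (h : ∀ m : ℕ, ∃ (G : Type u) (_ : NormedAddCommGroup G) (_ : InnerProductSpace ℂ G)
      (_ : CompleteSpace G) (c : ι × Fin m → ℂ →L[ℂ] G), OrthoIsom c ∧
        SchurBound p c (fun s t => φ s.1 t.1) C)
    {a : ι → K →L[ℂ] H} (ha : OrthoIsom a) : SchurBound p a φ C := by
  classical
  intro B hB
  refine schattenNorm_le_iff.2 fun n e f he hf => ?_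
  -- One test with e, f only sees the components of these vectors in K, which span a
  -- finite-dimensional L. Multiplicity m = dim L is enough for this test.
  let L : Submodule ℂ K := Submodule.span ℂ
    (Set.range (fun q : ι × Fin n => (a q.1).adjoint (e q.2)) ∪
      Set.range (fun q : ι × Fin n => (a q.1).adjoint (f q.2)))
  have : FiniteDimensional ℂ L :=
    FiniteDimensional.span_of_finite ℂ ((Set.finite_range _).union (Set.finite_range _))
  let k := stdOrthonormalBasis ℂ L
  let m := Module.finrank ℂ L
  let d : ι × Fin m → ℂ →L[ℂ] H :=
    fun s => a s.1 ∘L ContinuousLinearMap.toSpanSingleton ℂ ((k s.2 : L) : K)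
  have hd1 : ∀ s z, (d s).adjoint z = inner ℂ ((k s.2 : L) : K) ((a s.1).adjoint z) := by
    intro s z
    refine ext_inner_left ℂ fun c => ?_
    rw [ContinuousLinearMap.adjoint_inner_right]
    simp only [d, ContinuousLinearMap.comp_apply, ContinuousLinearMap.toSpanSingleton_apply,
      map_smul, inner_smul_left, ← ContinuousLinearMap.adjoint_inner_right]
    simp [mul_comm]
  have hd : OrthoIsom d := by
    intro s t
    ext
    rw [ContinuousLinearMap.comp_apply, hd1]
    simp only [d, ContinuousLinearMap.comp_apply, ContinuousLinearMap.toSpanSingleton_apply,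
      one_smul, ha.adjoint_apply]
    have hk := orthonormal_iff_ite.1 k.orthonormal s.2 t.2
    rw [Submodule.coe_inner] at hk
    by_cases h1 : s.1 = t.1
    · rw [if_pos h1, hk]
      by_cases h2 : s.2 = t.2
      · rw [if_pos h2, if_pos (Prod.ext h1 h2)]; simp
      · rw [if_neg h2, if_neg fun h => h2 (congrArg Prod.snd h)]; simp
    · rw [if_neg h1, inner_zero_right, if_neg fun h => h1 (congrArg Prod.fst h)]; simp
  obtain ⟨G, _, _, _, c, hc, hcb⟩ := h m
  have hdb := hcb.transfer hc hd
  have hrec : ∀ i z, (a i).adjoint z ∈ L →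
      ∑ s : Fin m, d (i, s) ((d (i, s)).adjoint z) = a i ((a i).adjoint z) := by
    intro i z hz
    have h1 := congrArg (fun y : L => (y : K)) (k.sum_repr' ⟨_, hz⟩)
    simp only [AddSubmonoidClass.coe_finsetSum, Submodule.coe_smul, Submodule.coe_inner] at h1
    conv_rhs => rw [← h1]
    rw [map_sum]
    refine Finset.sum_congr rfl fun s _ => ?_
    rw [hd1, map_smul]
    simp [d]
  -- An orthonormal basis of L splits each block into scalar entries carrying the same value of φ,
  -- so on these test vectors the block multiplier and the inflated scalar one agree.
  have hkey : diagCoeff p e f (blockSchur a φ B) =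
      diagCoeff p e f (blockSchur d (fun s t => φ s.1 t.1) B) := by
    refine congrArg (WithLp.toLp p) (funext fun q => ?_)
    rw [inner_blockSchur, inner_blockSchur, Fintype.sum_prod_type]
    refine Finset.sum_congr rfl fun i _ => ?_
    simp_rw [Fintype.sum_prod_type]
    rw [Finset.sum_comm]
    refine Finset.sum_congr rfl fun j _ => ?_
    rw [← hrec i (f q) (Submodule.subset_span (Or.inr ⟨(i, q), rfl⟩)),
      ← hrec j (e q) (Submodule.subset_span (Or.inl ⟨(j, q), rfl⟩)), sum_inner, Finset.mul_sum]
    refine Finset.sum_congr rfl fun s _ => ?_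
    rw [map_sum, inner_sum, Finset.mul_sum]
  rw [hkey]
  exact (enorm_diagCoeff_le he hf _).trans (hdb B hB)

theorem SchurBound.comp_unitary {K' : Type*} [NormedAddCommGroup K'] [InnerProductSpace ℂ K']
    [CompleteSpace K'] {a : ι → K →L[ℂ] H} {φ : ι → ι → ℂ} (h : SchurBound p a φ C)
    (u : K' →L[ℂ] K) (hu : u ∘L u.adjoint = ContinuousLinearMap.id ℂ K) :
    SchurBound p (fun i => a i ∘L u) φ C := by
  intro B hB
  have hu' : ∀ x, u (u.adjoint x) = x := fun x => congrArg (fun T : K →L[ℂ] K => T x) hu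
  have : blockSchur (fun i => a i ∘L u) φ B = blockSchur a φ B := by
    ext x
    rw [blockSchur_apply, blockSchur_apply]
    simp only [ContinuousLinearMap.adjoint_comp, ContinuousLinearMap.comp_apply, hu']
  rw [this]
  exact h B hB

end Compression
-- Reading off finite multipliers from matrix units.
section Extraction

variable {H : Type v} [NormedAddCommGroup H] [InnerProductSpace ℂ H] [CompleteSpace H]
variable {ι : Type*} [Fintype ι] {p : ℝ≥0∞} [Fact (1 ≤ p)] {C : ℝ≥0}
variable {M : (H →L[ℂ] H) → (H →L[ℂ] H)} {x : ι → H} {ψ : ι → ι → ℂ}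

open Classical in
theorem SchattenNormLE.schurBound_plainIsom (hM : SchattenNormLE p M C) (hx : Orthonormal ℂ x)
    (h : ∀ i j k l, inner ℂ (x k) (M (InnerProductSpace.rankOne ℂ (x i) (x j)) (x l)) =
      if i = k ∧ j = l then ψ i j else 0) : SchurBound p (plainIsom x) ψ C := by
  refine hM.schurBound hx.orthoIsom_plainIsom fun b _ i j k l => ?_
  have h1 : plainIsom x i ∘L b ∘L (plainIsom x j).adjoint =
      b 1 • InnerProductSpace.rankOne ℂ (x i) (x j) := by
    ext z
    have h2 : ∀ c : ℂ, b c = c * b 1 := fun c => by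
      rw [← smul_eq_mul, ← map_smul, smul_eq_mul, mul_one]
    simp only [ContinuousLinearMap.comp_apply, adjoint_plainIsom_apply, plainIsom_apply,
      smul_apply, InnerProductSpace.rankOne_apply, smul_smul]
    rw [h2, mul_comm]
  rw [h1, hM.1.map_smul _ _ (rankOne_mem_schattenClass _ _)]
  ext
  simp only [ContinuousLinearMap.comp_apply, adjoint_plainIsom_apply, plainIsom_apply,
    smul_apply, one_smul, inner_smul_right, h]
  split_ifs <;> simp [mul_comm]

-- The extension to H ⊗₂ K is prescribed only on elementary tensors, but these include every
-- single-block operator built from x.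
open Classical in
theorem SchattenCBNormLE.schurBound_tensorIsom (hM : SchattenCBNormLE.{v, w} p M C)
    (hx : Orthonormal ℂ x)
    (h : ∀ i j k l, inner ℂ (x k) (M (InnerProductSpace.rankOne ℂ (x i) (x j)) (x l)) =
      if i = k ∧ j = l then ψ i j else 0)
    (K : Type w) [NormedAddCommGroup K] [InnerProductSpace ℂ K] [CompleteSpace K] :
    SchurBound p (tensorIsom K x) ψ C := by
  obtain ⟨N, hN, hNM⟩ := hM.2 K
  refine hN.schurBound hx.orthoIsom_tensorIsom fun b hb i j k l => ?_
  have h1 : tensorIsom K x i ∘L b ∘L (tensorIsom K x j).adjoint =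
      opTensor (InnerProductSpace.rankOne ℂ (x i) (x j)) b := (opTensor_rankOne _ _ _).symm
  rw [h1, hNM _ (rankOne_mem_schattenClass _ _) _ hb]
  simp only [tensorIsom]
  rw [adjoint_tensorLeft_comp_opTensor, h]
  split_ifs <;> simp

theorem SchurBound.of_tensorIsom
    (h : ∀ (K : Type w) [NormedAddCommGroup K] [InnerProductSpace ℂ K] [CompleteSpace K],
      SchurBound p (tensorIsom K x) ψ C) (hx : Orthonormal ℂ x) :
    SchurBound p (plainIsom x) ψ C := by
  -- A one-dimensional space in `Type w`, in place of ℂ, for the universe over which K is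
  -- quantified.
  let K := EuclideanSpace ℂ PUnit.{w + 1}
  let e : PUnit.{w + 1} → K := fun i => EuclideanSpace.single i 1
  have he : Orthonormal ℂ e := EuclideanSpace.orthonormal_single
  let t : ℂ →L[ℂ] K := plainIsom e PUnit.unit
  have ht : t ∘L t.adjoint = ContinuousLinearMap.id ℂ K := by
    ext z i
    simp only [t, ContinuousLinearMap.comp_apply, adjoint_plainIsom_apply, plainIsom_apply]
    have h1 : inner ℂ (e PUnit.unit) z = z i :=
      (EuclideanSpace.inner_single_left PUnit.unit 1 z).trans (by simp)
    have h2 : e PUnit.unit i = 1 := by simp [e]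
    rw [h1, PiLp.smul_apply, h2, smul_eq_mul, mul_one]; rfl
  have ht' : t.adjoint ∘L t = ContinuousLinearMap.id ℂ ℂ := by
    have := he.orthoIsom_plainIsom PUnit.unit PUnit.unit
    rwa [if_pos rfl] at this
  have ho : OrthoIsom fun i => tensorIsom K x i ∘L t := by
    classical
    intro i j
    ext
    have h1 := hx.orthoIsom_tensorIsom (K := K).adjoint_apply i j (t 1)
    simp only [ContinuousLinearMap.adjoint_comp, ContinuousLinearMap.comp_apply, h1]
    have h2 : t.adjoint (t 1) = 1 := congrArg (fun T : ℂ →L[ℂ] ℂ => T 1) ht'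
    split_ifs
    · rw [h2]; rfl
    · simp
  exact ((h K).comp_unitary t ht).transfer ho hx.orthoIsom_plainIsom

end Extraction

/-! ### Schur multipliers on matrices. -/

section MatrixSchur

variable {n : Type u} [Fintype n] [DecidableEq n] {p : ℝ≥0∞} [Fact (1 ≤ p)] {C : ℝ≥0}

/-- The standard basis of `ℓ²_n`. -/
def stdVec (n : Type u) [Fintype n] [DecidableEq n] (i : n) : EuclideanSpace ℂ n :=
  EuclideanSpace.single i 1

theorem orthonormal_stdVec : Orthonormal ℂ (stdVec n) := EuclideanSpace.orthonormal_single

theorem inner_stdVec (i : n) (x : EuclideanSpace ℂ n) : inner ℂ (stdVec n i) x = x i := by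
  simp [stdVec, EuclideanSpace.inner_single_left]

theorem matrixSchur_eq_blockSchur (φ : n → n → ℂ)
    (A : EuclideanSpace ℂ n →L[ℂ] EuclideanSpace ℂ n) :
    matrixSchur (Matrix.of φ) A = blockSchur (plainIsom (stdVec n)) φ A := by
  obtain ⟨m, rfl⟩ : ∃ m, Matrix.toEuclideanCLM (n := n) (𝕜 := ℂ) m = A :=
    ⟨_, (Matrix.toEuclideanCLM (n := n) (𝕜 := ℂ)).apply_symm_apply A⟩
  ext x i
  rw [matrixSchur, StarAlgEquiv.symm_apply_apply, blockSchur_apply]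
  simp only [plainIsom_apply, adjoint_plainIsom_apply, inner_stdVec]
  simp [stdVec, Matrix.mulVec, dotProduct, Pi.single_apply, mul_assoc, mul_comm]

theorem inner_matrixSchur_rankOne (φ : n → n → ℂ) (i j k l : n) :
    inner ℂ (stdVec n k) (matrixSchur (Matrix.of φ)
      (InnerProductSpace.rankOne ℂ (stdVec n i) (stdVec n j)) (stdVec n l)) =
      if i = k ∧ j = l then φ i j else 0 := by
  rw [matrixSchur_eq_blockSchur, inner_blockSchur]
  have ho := orthonormal_iff_ite.1 (orthonormal_stdVec (n := n))
  simp only [plainIsom_apply, adjoint_plainIsom_apply, ho, InnerProductSpace.rankOne_apply,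
    map_smul, inner_smul_left, inner_smul_right]
  rw [Finset.sum_eq_single i, Finset.sum_eq_single j]
  · by_cases h1 : i = k <;> by_cases h2 : j = l <;> simp [h1, h2]
  · intro b _ hb; simp [hb.symm]
  · simp
  · intro b _ hb; simp [hb]
  · simp

theorem schattenNormLE_matrixSchur_iff (φ : n → n → ℂ) :
    SchattenNormLE p (matrixSchur (Matrix.of φ)) C ↔ SchurBound p (plainIsom (stdVec n)) φ C := by
  have h : matrixSchur (Matrix.of φ) = blockSchur (plainIsom (stdVec n)) φ :=
    funext (matrixSchur_eq_blockSchur φ)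
  rw [h]
  exact ⟨fun h => h.2, fun h => h.schattenNormLE⟩

theorem schattenCBNormLE_matrixSchur_iff (φ : n → n → ℂ) :
    SchattenCBNormLE.{u, w} p (matrixSchur (Matrix.of φ)) C ↔
      ∀ (K : Type w) [NormedAddCommGroup K] [InnerProductSpace ℂ K] [CompleteSpace K],
        SchurBound p (tensorIsom K (stdVec n)) φ C := by
  classical
  constructor
  · intro h K _ _ _
    refine h.schurBound_tensorIsom orthonormal_stdVec (fun i j k l => ?_) K
    rw [inner_matrixSchur_rankOne]
    congr
  · intro h
    refine ⟨((schattenNormLE_matrixSchur_iff φ).2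
      (SchurBound.of_tensorIsom h orthonormal_stdVec)).1, fun K _ _ _ =>
      ⟨blockSchur (tensorIsom K (stdVec n)) φ, (h K).schattenNormLE, fun A _ B _ => ?_⟩⟩
    rw [blockSchur_tensorIsom_opTensor, matrixSchur_eq_blockSchur]

theorem SchattenCBNormLE.schattenNormLE_matrixSchur {φ : n → n → ℂ}
    (h : SchattenCBNormLE.{u, w} p (matrixSchur (Matrix.of φ)) C) : SchattenNormLE p (matrixSchur (Matrix.of φ)) C :=
  (schattenNormLE_matrixSchur_iff φ).2
    (SchurBound.of_tensorIsom ((schattenCBNormLE_matrixSchur_iff φ).1 h) orthonormal_stdVec)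

/-- The entries of a bounded Schur multiplier are bounded by its norm. -/
theorem SchattenNormLE.norm_apply_le {φ : n → n → ℂ}
    (h : SchattenNormLE p (matrixSchur (Matrix.of φ)) C) (i j : n) : ‖φ i j‖ ≤ C := by
  have h1 := h.2 _ (rankOne_mem_schattenClass (stdVec n i) (stdVec n j))
  have h2 : schattenNorm p (InnerProductSpace.rankOne ℂ (stdVec n i) (stdVec n j)) ≤ 1 := by
    refine (schattenNorm_rankOne_le _ _).trans ?_
    rw [← ofReal_norm, ← ofReal_norm, orthonormal_stdVec.1, orthonormal_stdVec.1]; simp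
  have h3 : ‖φ i j‖ₑ ≤ ‖matrixSchur (Matrix.of φ)
      (InnerProductSpace.rankOne ℂ (stdVec n i) (stdVec n j))‖ₑ := by
    rw [enorm_le_iff_norm_le]
    have h4 := inner_matrixSchur_rankOne φ i j i j
    rw [if_pos ⟨rfl, rfl⟩] at h4
    rw [← h4]
    refine (norm_inner_le_norm _ _).trans ?_
    rw [orthonormal_stdVec.1, one_mul]
    refine (ContinuousLinearMap.le_opNorm _ _).trans ?_
    rw [orthonormal_stdVec.1, mul_one]
  have h5 : ‖φ i j‖ₑ ≤ C := by
    refine h3.trans ((enorm_le_schattenNorm (p := p) _).trans (h1.trans ?_))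
    exact mul_le_of_le_one_right' h2
  rw [enorm_eq_nnnorm, ENNReal.coe_le_coe] at h5
  exact_mod_cast h5

end MatrixSchur
-- Weak operator limits along ultrafilters.
section WeakLimit

variable {H : Type v} [NormedAddCommGroup H] [InnerProductSpace ℂ H] [CompleteSpace H]
variable {α : Type*}

/-- `L` is the limit of `F` in the weak operator topology. -/
def IsWeakLimit (l : Filter α) (F : α → H →L[ℂ] H) (L : H →L[ℂ] H) : Prop :=
  ∀ x y, Filter.Tendsto (fun i => inner ℂ x (F i y)) l (nhds (inner ℂ x (L y)))

theorem IsWeakLimit.unique {l : Filter α} [l.NeBot] {F : α → H →L[ℂ] H} {L L' : H →L[ℂ] H}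
    (h : IsWeakLimit l F L) (h' : IsWeakLimit l F L') : L = L' := by
  ext y
  exact ext_inner_left ℂ fun x => tendsto_nhds_unique (h x y) (h' x y)

theorem IsWeakLimit.add {l : Filter α} {F G : α → H →L[ℂ] H} {L M : H →L[ℂ] H}
    (h : IsWeakLimit l F L) (h' : IsWeakLimit l G M) :
    IsWeakLimit l (fun i => F i + G i) (L + M) := by
  intro x y
  simpa [inner_add_right] using (h x y).add (h' x y)

theorem IsWeakLimit.smul {l : Filter α} {F : α → H →L[ℂ] H} {L : H →L[ℂ] H}
    (h : IsWeakLimit l F L) (c : ℂ) : IsWeakLimit l (fun i => c • F i) (c • L) := by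
  intro x y
  simpa [inner_smul_right] using (h x y).const_mul c

/-- Each bounded family of scalars ⟨x, F i y⟩ converges along U, and the limits form a bounded
sesquilinear form, which is represented by an operator. -/
theorem exists_isWeakLimit (U : Ultrafilter α) {F : α → H →L[ℂ] H} {c : ℝ}
    (hF : ∀ i, ‖F i‖ ≤ c) : ∃ L, IsWeakLimit (U : Filter α) F L := by
  have hb : ∀ x y i, ‖inner ℂ x (F i y)‖ ≤ c * ‖x‖ * ‖y‖ := by
    intro x y i
    refine (norm_inner_le_norm _ _).trans ?_
    have := (F i).le_of_opNorm_le (hF i) y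
    calc ‖x‖ * ‖F i y‖ ≤ ‖x‖ * (c * ‖y‖) := by gcongr
      _ = _ := by ring
  have hex : ∀ x y, ∃ g : ℂ, ‖g‖ ≤ c * ‖x‖ * ‖y‖ ∧
      Filter.Tendsto (fun i => inner ℂ x (F i y)) U (nhds g) := by
    intro x y
    obtain ⟨g, hg, hle⟩ := (isCompact_closedBall (0 : ℂ) (c * ‖x‖ * ‖y‖)).ultrafilter_le_nhds
      (U.map fun i => inner ℂ x (F i y)) (Filter.tendsto_principal.2
        (Filter.Eventually.of_forall fun i => mem_closedBall_zero_iff.2 (hb x y i)))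
    exact ⟨g, by rwa [mem_closedBall_zero_iff] at hg, hle⟩
  choose g hg hlim using hex
  let B : H →ₗ⋆[ℂ] H →ₗ[ℂ] ℂ := LinearMap.mk₂'ₛₗ (starRingEnd ℂ) (RingHom.id ℂ) g
    (fun x x' y => tendsto_nhds_unique (hlim (x + x') y) (by
      simpa only [inner_add_left] using (hlim x y).add (hlim x' y)))
    (fun a x y => tendsto_nhds_unique (hlim (a • x) y) (by
      simpa only [inner_smul_left, smul_eq_mul] using (hlim x y).const_mul _))
    (fun x y y' => tendsto_nhds_unique (hlim x (y + y')) (by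
      simpa only [map_add, inner_add_right] using (hlim x y).add (hlim x y')))
    (fun a x y => tendsto_nhds_unique (hlim x (a • y)) (by
      simpa only [map_smul, inner_smul_right, RingHom.id_apply, smul_eq_mul] using (hlim x y).const_mul _))
  let B' := B.mkContinuous₂ c hg
  refine ⟨(InnerProductSpace.continuousLinearMapOfBilin B').adjoint, fun x y => ?_⟩
  rw [ContinuousLinearMap.adjoint_inner_right,
    InnerProductSpace.continuousLinearMapOfBilin_apply]
  exact hlim x y

open Classical in
/-- The weak limit of a family of operators along an ultrafilter (zero if there is none). -/
def weakLimit (U : Ultrafilter α) (F : α → H →L[ℂ] H) : H →L[ℂ] H :=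
  if h : ∃ L, IsWeakLimit (U : Filter α) F L then h.choose else 0

theorem IsWeakLimit.weakLimit_eq {U : Ultrafilter α} {F : α → H →L[ℂ] H} {L : H →L[ℂ] H}
    (h : IsWeakLimit (U : Filter α) F L) : weakLimit U F = L := by
  have hex : ∃ L, IsWeakLimit (U : Filter α) F L := ⟨L, h⟩
  rw [weakLimit, dif_pos hex]
  exact hex.choose_spec.unique h

theorem isWeakLimit_weakLimit (U : Ultrafilter α) {F : α → H →L[ℂ] H} {c : ℝ}
    (hF : ∀ i, ‖F i‖ ≤ c) : IsWeakLimit (U : Filter α) F (weakLimit U F) := by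
  obtain ⟨L, hL⟩ := exists_isWeakLimit U hF
  rwa [hL.weakLimit_eq]

/-- The uniform bound gives the ampliated family some weak limit; it agrees with L ⊗ B on elementary
tensors, whose span is dense. -/
theorem IsWeakLimit.opTensor {K : Type w} [NormedAddCommGroup K] [InnerProductSpace ℂ K]
    [CompleteSpace K] {U : Ultrafilter α} {F : α → H →L[ℂ] H} {L : H →L[ℂ] H}
    (h : IsWeakLimit (U : Filter α) F L) {c : ℝ} (hF : ∀ i, ‖F i‖ ≤ c) (B : K →L[ℂ] K) :
    IsWeakLimit (U : Filter α) (fun i => opTensor (F i) B) (opTensor L B) := by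
  have hb : ∀ i, ‖_root_.opTensor (F i) B‖ ≤ c * ‖B‖ := fun i =>
    (norm_opTensor_le _ _).trans (mul_le_mul_of_nonneg_right (hF i) (norm_nonneg _))
  have h1 := isWeakLimit_weakLimit U hb
  convert h1 using 1
  refine hilbertTensor_clm_ext fun y k => ?_
  have h2 : innerSL ℂ (_root_.opTensor L B (tensorLeft K y k)) = innerSL ℂ
      (weakLimit U (fun i => _root_.opTensor (F i) B) (tensorLeft K y k)) := by
    refine hilbertTensor_clm_ext fun x l => ?_
    rw [innerSL_apply_apply, innerSL_apply_apply, ← inner_conj_symm, ← inner_conj_symm (weakLimit _ _ _)]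
    congr 1
    refine tendsto_nhds_unique ?_ (h1 (tensorLeft K x l) (tensorLeft K y k))
    simp_rw [opTensor_tensorLeft, inner_tensorLeft]
    exact (h x y).mul_const _
  refine ext_inner_right ℂ fun z => ?_
  exact congrArg (fun T : HilbertTensor H K →L[ℂ] ℂ => T z) h2

end WeakLimit

/-! ### Weak limits of maps on Schatten classes. -/

section Approximation

variable {H : Type v} [NormedAddCommGroup H] [InnerProductSpace ℂ H] [CompleteSpace H]

/-- Compact operators on a Hilbert space are norm limits of finite rank operators. -/
theorem IsCompactOperator.exists_sum_rankOne_norm_sub_le {A : H →L[ℂ] H}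
    (hA : IsCompactOperator A) {ε : ℝ} (hε : 0 < ε) : ∃ (m : ℕ) (x y : Fin m → H),
      ‖A - ∑ i, InnerProductSpace.rankOne ℂ (x i) (y i)‖ ≤ ε := by
  have hc : TotallyBounded (A '' Metric.closedBall 0 1) :=
    ((hA.isCompact_closure_image_closedBall 1).totallyBounded).subset subset_closure
  -- t is an ε-net for the image of the unit ball; projecting onto its span moves each A x by at
  -- most its distance to t.
  obtain ⟨t, ht, hcov⟩ := Metric.totallyBounded_iff.1 hc ε hε
  let V : Submodule ℂ H := Submodule.span ℂ t
  have : FiniteDimensional ℂ V := FiniteDimensional.span_of_finite ℂ ht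
  let b := stdOrthonormalBasis ℂ V
  refine ⟨Module.finrank ℂ V, fun i => b i, fun i => A.adjoint (b i), ?_⟩
  have h1 : ∑ i, InnerProductSpace.rankOne ℂ (b i : H) (A.adjoint (b i)) =
      V.starProjection ∘L A := by
    rw [b.starProjection_eq_sum_rankOne]
    ext z
    simp [ContinuousLinearMap.adjoint_inner_left]
  rw [h1]
  refine ContinuousLinearMap.opNorm_le_of_unit_norm hε.le fun x hx => ?_
  obtain ⟨y, hy, hxy⟩ := Set.mem_iUnion₂.1
    (hcov ⟨x, by rw [mem_closedBall_zero_iff, hx], rfl⟩)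
  rw [Metric.mem_ball, dist_eq_norm] at hxy
  have hyV : V.starProjection y = y :=
    Submodule.starProjection_eq_self_iff.2 (Submodule.subset_span hy)
  have h2 : (A - V.starProjection ∘L A) x = (A x - y) - V.starProjection (A x - y) := by
    simp [hyV]
  rw [h2]
  refine le_trans ?_ hxy.le
  have := V.norm_sq_eq_add_norm_sq_starProjection (A x - y)
  rw [V.starProjection_orthogonal_val] at this
  refine abs_le_of_sq_le_sq' ?_ (norm_nonneg _) |>.2
  nlinarith [sq_nonneg ‖V.starProjection (A x - y)‖]

variable {α : Type*} {p : ℝ≥0∞} [Fact (1 ≤ p)] {C : ℝ≥0}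

theorem norm_le_toReal_of_schattenNorm_le {A : H →L[ℂ] H} {c : ℝ≥0∞} (hc : c ≠ ∞)
    (h : schattenNorm p A ≤ c) : ‖A‖ ≤ c.toReal := by
  have h1 := (enorm_le_schattenNorm (p := p) A).trans h
  rw [← ofReal_norm] at h1
  exact (ENNReal.ofReal_le_iff_le_toReal hc).1 h1

theorem isWeakLimit_of_schattenNorm_le (U : Ultrafilter α) {F : α → H →L[ℂ] H} {c : ℝ≥0∞}
    (hc : c ≠ ∞) (hF : ∀ i, schattenNorm p (F i) ≤ c) :
    IsWeakLimit (U : Filter α) F (weakLimit U F) ∧ schattenNorm p (weakLimit U F) ≤ c := by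
  have h := isWeakLimit_weakLimit U fun i => norm_le_toReal_of_schattenNorm_le hc (hF i)
  exact ⟨h, schattenNorm_le_of_tendsto h (Filter.Eventually.of_forall hF)⟩

/-- The weak limit of uniformly bounded maps on the Schatten class is a bounded map on the Schatten
class, provided the maps are also uniformly Hilbert-Schmidt valued on rank one operators. -/
theorem schattenNormLE_weakLimit (U : Ultrafilter α)
    {T : α → (H →L[ℂ] H) →ₗ[ℂ] (H →L[ℂ] H)}
    (hT : ∀ i, ∀ B ∈ schattenClass p H, schattenNorm p (T i B) ≤ C * schattenNorm p B)
    (h2 : ∀ i x y, schattenNorm 2 (T i (InnerProductSpace.rankOne ℂ x y)) ≤ C * (‖x‖ₑ * ‖y‖ₑ)) :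
    SchattenNormLE p (fun B => weakLimit U fun i => T i B) C := by
  have hfin : ∀ B ∈ schattenClass p H, C * schattenNorm p B ≠ ∞ := fun B hB =>
    (ENNReal.mul_lt_top ENNReal.coe_lt_top (schattenNorm_lt_top hB)).ne
  have hlim : ∀ B ∈ schattenClass p H,
      IsWeakLimit (U : Filter α) (fun i => T i B) (weakLimit U fun i => T i B) := fun B hB =>
    (isWeakLimit_of_schattenNorm_le U (hfin B hB) fun i => hT i B hB).1
  have hnorm : ∀ B ∈ schattenClass p H,
      schattenNorm p (weakLimit U fun i => T i B) ≤ C * schattenNorm p B := fun B hB =>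
    (isWeakLimit_of_schattenNorm_le U (hfin B hB) fun i => hT i B hB).2
  have hadd : ∀ A ∈ schattenClass p H, ∀ B ∈ schattenClass p H,
      (weakLimit U fun i => T i (A + B)) =
        (weakLimit U fun i => T i A) + weakLimit U fun i => T i B := fun A hA B hB => by
    simp only [map_add]
    exact ((hlim A hA).add (hlim B hB)).weakLimit_eq
  have hsmul : ∀ (c : ℂ), ∀ A ∈ schattenClass p H,
      (weakLimit U fun i => T i (c • A)) = c • weakLimit U fun i => T i A := fun c A hA => by
    simp only [map_smul]
    exact ((hlim A hA).smul c).weakLimit_eq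
  refine ⟨⟨fun A hA => ?_, hadd, hsmul⟩, hnorm⟩
  rcases ne_or_eq p ∞ with hp | rfl
  · exact (mem_schattenClass_of_ne_top hp).2 ((hnorm A hA).trans_lt (hfin A hA).lt_top)
  -- For p = ∞ a norm bound does not give compactness. A finite rank D near A has a limit of finite
  -- Hilbert-Schmidt norm by `h2`, hence compact, and the norm bound makes it close to the limit for
  -- A.
  have hcl : IsClosed {S : H →L[ℂ] H | IsCompactOperator S} := isClosed_setOfPred_isCompactOperator
  rw [mem_schattenClass_top]
  rw [← Set.mem_ofPred_eq (p := fun S : H →L[ℂ] H => IsCompactOperator S), ← hcl.closure_eq,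
    Metric.mem_closure_iff]
  intro ε hε
  -- C + 1 rather than C, since C may be zero.
  have hC : (0 : ℝ) < C + 1 := by positivity
  obtain ⟨m, x, y, hxy⟩ := (mem_schattenClass_top.1 hA).exists_sum_rankOne_norm_sub_le
    (div_pos hε (mul_pos two_pos hC))
  set D : H →L[ℂ] H := ∑ i, InnerProductSpace.rankOne ℂ (x i) (y i) with hD
  have hDm : D ∈ schattenClass ∞ H :=
    sum_mem_schattenClass _ fun i _ => rankOne_mem_schattenClass _ _
  refine ⟨weakLimit U fun i => T i D, ?_, ?_⟩
  · refine isCompactOperator_of_varNorm (p := 2) ENNReal.ofNat_ne_top ?_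
    rw [← schattenNorm_eq_varNorm]
    have hsum : ∑ i, (C : ℝ≥0∞) * (‖x i‖ₑ * ‖y i‖ₑ) < ∞ := ENNReal.sum_lt_top.2 fun i _ =>
      ENNReal.mul_lt_top ENNReal.coe_lt_top (ENNReal.mul_lt_top enorm_lt_top enorm_lt_top)
    refine ((isWeakLimit_of_schattenNorm_le (p := 2) U hsum.ne fun i => ?_).2.trans_lt hsum).ne
    rw [hD, map_sum]
    exact (schattenNorm_sum_le _ _).trans (Finset.sum_le_sum fun j _ => h2 i _ _)
  · have hm : (-1 : ℂ) • D ∈ schattenClass ∞ H := smul_mem_schattenClass _ hDm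
    have h3 : (weakLimit U fun i => T i A) - (weakLimit U fun i => T i D) =
        weakLimit U fun i => T i (A + (-1 : ℂ) • D) := by
      rw [hadd A hA _ hm, hsmul _ D hDm, neg_one_smul, sub_eq_add_neg]
    have h4 := hnorm _ (add_mem_schattenClass hA hm)
    have h5 : A + (-1 : ℂ) • D = A - D := by rw [neg_one_smul, sub_eq_add_neg]
    rw [← h3, h5, schattenNorm, if_pos rfl, schattenNorm, if_pos rfl] at h4
    rw [dist_eq_norm]
    have h6 : ‖(weakLimit U fun i => T i A) - (weakLimit U fun i => T i D)‖ ≤ C * ‖A - D‖ := by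
      rw [enorm_eq_nnnorm, enorm_eq_nnnorm, ← ENNReal.coe_mul, ENNReal.coe_le_coe] at h4
      exact_mod_cast h4
    calc _ ≤ C * ‖A - D‖ := h6
      _ ≤ (C + 1) * (ε / (2 * (C + 1))) := by gcongr; linarith
      _ = ε / 2 := by field_simp
      _ < ε := by linarith

end Approximation
-- Hilbert-Schmidt kernels and indicator functions.
section Kernel

variable {X : Type u} [MeasurableSpace X] {μ : Measure X}

open Classical in
variable (μ) in
/-- The indicator function of a measurable set of finite measure, as a vector of `L²(X, μ)`. -/
def indVec (s : Set X) : Lp ℂ 2 μ :=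
  if h : MeasurableSet s ∧ μ s ≠ ∞ then indicatorConstLp 2 h.1 h.2 1 else 0

theorem inner_indVec {s : Set X} (hs : MeasurableSet s) (hμ : μ s ≠ ∞) (f : Lp ℂ 2 μ) :
    inner ℂ (indVec μ s) f = ∫ x in s, f x ∂μ := by
  rw [indVec, dif_pos ⟨hs, hμ⟩, L2.inner_indicatorConstLp_one]

theorem coeFn_indVec {s : Set X} (hs : MeasurableSet s) (hμ : μ s ≠ ∞) :
    indVec μ s =ᵐ[μ] s.indicator fun _ => (1 : ℂ) := by
  rw [indVec, dif_pos ⟨hs, hμ⟩]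
  exact indicatorConstLp_coeFn

theorem inner_indVec_indVec {s t : Set X} (hs : MeasurableSet s) (hμs : μ s ≠ ∞)
    (ht : MeasurableSet t) (hμt : μ t ≠ ∞) :
    inner ℂ (indVec μ s) (indVec μ t) = ((μ.real (s ∩ t) : ℝ) : ℂ) := by
  rw [inner_indVec hs hμs, setIntegral_congr_ae₀ hs.nullMeasurableSet
    ((coeFn_indVec ht hμt).mono fun x hx _ => hx), setIntegral_indicator ht, setIntegral_const]
  simp

variable [SigmaFinite μ]

theorem MeasureTheory.MemLp.integrableOn_prod_of_two {k : X × X → ℂ} (hk : MemLp k 2 (μ.prod μ))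
    {s t : Set X} (hμs : μ s ≠ ∞) (hμt : μ t ≠ ∞) : IntegrableOn k (s ×ˢ t) (μ.prod μ) := by
  have hfin : (μ.prod μ) (s ×ˢ t) < ∞ := by
    rw [Measure.prod_prod]; exact ENNReal.mul_lt_top hμs.lt_top hμt.lt_top
  have : IsFiniteMeasure ((μ.prod μ).restrict (s ×ˢ t)) := ⟨by simpa using hfin⟩
  exact (hk.restrict _).integrable one_le_two

theorem HasKernel.inner_indVec {A : Lp ℂ 2 μ →L[ℂ] Lp ℂ 2 μ} {k : X × X → ℂ}
    (h : HasKernel μ A k) {s t : Set X} (hs : MeasurableSet s) (hμs : μ s ≠ ∞)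
    (ht : MeasurableSet t) (hμt : μ t ≠ ∞) :
    inner ℂ (indVec μ s) (A (indVec μ t)) = ∫ z in s ×ˢ t, k z ∂(μ.prod μ) := by
  rw [_root_.inner_indVec hs hμs, setIntegral_prod _ (h.1.integrableOn_prod_of_two hμs hμt)]
  refine setIntegral_congr_ae₀ hs.nullMeasurableSet ?_
  filter_upwards [h.2 (indVec μ t)] with x hx _
  rw [hx, ← integral_indicator ht]
  refine integral_congr_ae ?_
  filter_upwards [coeFn_indVec ht hμt] with y hy
  rw [hy]
  by_cases hyt : y ∈ t <;> simp [hyt]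

theorem hasKernel_rankOne_indVec {s t : Set X} (hs : MeasurableSet s) (hμs : μ s ≠ ∞)
    (ht : MeasurableSet t) (hμt : μ t ≠ ∞) :
    HasKernel μ (InnerProductSpace.rankOne ℂ (indVec μ s) (indVec μ t))
      ((s ×ˢ t).indicator fun _ => 1) := by
  have hfin : (μ.prod μ) (s ×ˢ t) ≠ ∞ := by
    rw [Measure.prod_prod]; exact ENNReal.mul_ne_top hμs hμt
  refine ⟨memLp_indicator_const 2 (hs.prod ht) 1 (Or.inr hfin), fun ξ => ?_⟩
  rw [InnerProductSpace.rankOne_apply, inner_indVec ht hμt]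
  filter_upwards [Lp.coeFn_smul (∫ y in t, ξ y ∂μ) (indVec μ s), coeFn_indVec hs hμs]
    with x hx1 hx2
  rw [hx1, Pi.smul_apply, hx2]
  by_cases hxs : x ∈ s
  · rw [Set.indicator_of_mem hxs, smul_eq_mul, mul_one, ← integral_indicator ht]
    refine integral_congr_ae (Filter.Eventually.of_forall fun y => ?_)
    by_cases hyt : y ∈ t <;> simp [hyt, hxs]
  · rw [Set.indicator_of_notMem hxs]
    simp [Set.indicator, hxs]

theorem eLpNorm_two_eq {α : Type*} [MeasurableSpace α] {ν : Measure α} (f : α → ℂ) :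
    eLpNorm f 2 ν = (∫⁻ x, ‖f x‖ₑ ^ (2 : ℝ) ∂ν) ^ (1 / 2 : ℝ) := by
  rw [eLpNorm_eq_lintegral_rpow_enorm_toReal two_ne_zero ENNReal.ofNat_ne_top]
  simp

/-- Cauchy-Schwarz in y for almost every x, then integration in x. -/
theorem lintegral_enorm_integral_mul_le {k : X × X → ℂ} (hk : MemLp k 2 (μ.prod μ))
    (ξ : Lp ℂ 2 μ) : ∫⁻ x, ‖∫ y, k (x, y) * ξ y ∂μ‖ₑ ^ (2 : ℝ) ∂μ ≤
      (∫⁻ z, ‖k z‖ₑ ^ (2 : ℝ) ∂(μ.prod μ)) * ∫⁻ y, ‖ξ y‖ₑ ^ (2 : ℝ) ∂μ := by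
  have hm : AEMeasurable (fun z => ‖k z‖ₑ ^ (2 : ℝ)) (μ.prod μ) := hk.1.enorm.pow_const _
  rw [lintegral_prod _ hm, ← lintegral_mul_const'' _ hm.lintegral_prod_right']
  refine lintegral_mono_ae ?_
  filter_upwards [hk.1.prodMk_left] with x hx
  have h1 := ENNReal.lintegral_mul_le_Lp_mul_Lq μ Real.HolderConjugate.two_two
    hx.enorm (Lp.aestronglyMeasurable ξ).enorm
  have h2 : ‖∫ y, k (x, y) * ξ y ∂μ‖ₑ ≤
      (∫⁻ y, ‖k (x, y)‖ₑ ^ (2 : ℝ) ∂μ) ^ (1 / 2 : ℝ) * (∫⁻ y, ‖ξ y‖ₑ ^ (2 : ℝ) ∂μ) ^ (1 / 2 : ℝ) := by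
    refine (enorm_integral_le_lintegral_enorm _).trans (le_trans (le_of_eq ?_) h1)
    simp [enorm_mul]
  refine (ENNReal.rpow_le_rpow h2 (by norm_num)).trans (le_of_eq ?_)
  rw [ENNReal.mul_rpow_of_nonneg _ _ (by norm_num), ← ENNReal.rpow_mul, ← ENNReal.rpow_mul]
  norm_num

/-- A square integrable kernel defines a bounded operator on `L²(X, μ)`. -/
theorem exists_hasKernel {k : X × X → ℂ} (hk : MemLp k 2 (μ.prod μ)) :
    ∃ A : Lp ℂ 2 μ →L[ℂ] Lp ℂ 2 μ, HasKernel μ A k := by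
  have hfin : ∀ {α : Type u} [MeasurableSpace α] {ν : Measure α} {f : α → ℂ}, MemLp f 2 ν →
      ∫⁻ x, ‖f x‖ₑ ^ (2 : ℝ) ∂ν < ∞ := by
    intro α _ ν f hf
    have := (eLpNorm_lt_top_iff_lintegral_rpow_enorm_lt_top two_ne_zero ENNReal.ofNat_ne_top).1 hf.2
    simpa using this
  have hbound : ∀ ξ : Lp ℂ 2 μ, eLpNorm (fun x => ∫ y, k (x, y) * ξ y ∂μ) 2 μ ≤
      eLpNorm k 2 (μ.prod μ) * eLpNorm ξ 2 μ := by
    intro ξ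
    rw [eLpNorm_two_eq, eLpNorm_two_eq, eLpNorm_two_eq,
      ← ENNReal.mul_rpow_of_nonneg _ _ (by norm_num)]
    exact ENNReal.rpow_le_rpow (lintegral_enorm_integral_mul_le hk ξ) (by norm_num)
  have hmem : ∀ ξ : Lp ℂ 2 μ, MemLp (fun x => ∫ y, k (x, y) * ξ y ∂μ) 2 μ := by
    intro ξ
    refine ⟨?_, (hbound ξ).trans_lt (ENNReal.mul_lt_top hk.2 (Lp.memLp ξ).2)⟩
    have : AEStronglyMeasurable (fun z : X × X => k z * ξ z.2) (μ.prod μ) :=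
      hk.1.mul ((Lp.aestronglyMeasurable ξ).comp_quasiMeasurePreserving
        Measure.quasiMeasurePreserving_snd)
    exact this.integral_prod_right'
  -- Almost every section of k is square integrable, so the exceptional null set is independent of
  -- ξ.
  have hint : ∀ᵐ x ∂μ, ∀ ξ : Lp ℂ 2 μ, Integrable (fun y => k (x, y) * ξ y) μ := by
    have hm : AEMeasurable (fun z => ‖k z‖ₑ ^ (2 : ℝ)) (μ.prod μ) := hk.1.enorm.pow_const _
    have h1 := hfin hk
    rw [lintegral_prod _ hm] at h1
    filter_upwards [hk.1.prodMk_left, ae_lt_top' hm.lintegral_prod_right' h1.ne] with x hx hlt ξ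
    have : MemLp (fun y => k (x, y)) 2 μ := by
      refine ⟨hx, (eLpNorm_lt_top_iff_lintegral_rpow_enorm_lt_top two_ne_zero
        ENNReal.ofNat_ne_top).2 ?_⟩
      simpa using hlt
    exact this.integrable_mul (Lp.memLp ξ)
  let T : Lp ℂ 2 μ →ₗ[ℂ] Lp ℂ 2 μ :=
    { toFun := fun ξ => (hmem ξ).toLp _
      map_add' := fun ξ η => by
        rw [← MemLp.toLp_add, MemLp.toLp_eq_toLp_iff]
        filter_upwards [hint] with x hx
        rw [Pi.add_apply, ← integral_add (hx ξ) (hx η)]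
        refine integral_congr_ae ?_
        filter_upwards [Lp.coeFn_add ξ η] with y hy
        rw [hy, Pi.add_apply, mul_add]
      map_smul' := fun c ξ => by
        rw [RingHom.id_apply, ← MemLp.toLp_const_smul, MemLp.toLp_eq_toLp_iff]
        refine Filter.Eventually.of_forall fun x => ?_
        change ∫ y, k (x, y) * (c • ξ : Lp ℂ 2 μ) y ∂μ = c • ∫ y, k (x, y) * ξ y ∂μ
        rw [smul_eq_mul, ← integral_const_mul]
        refine integral_congr_ae ?_
        filter_upwards [Lp.coeFn_smul c ξ] with y hy
        rw [hy, Pi.smul_apply, smul_eq_mul, mul_left_comm] }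
  refine ⟨T.mkContinuous (eLpNorm k 2 (μ.prod μ)).toReal fun ξ => ?_, hk, fun ξ => ?_⟩
  · change ‖(hmem ξ).toLp _‖ ≤ _
    rw [Lp.norm_toLp, Lp.norm_def, ← ENNReal.toReal_mul]
    exact ENNReal.toReal_mono (ENNReal.mul_lt_top hk.2 (Lp.memLp ξ).2).ne (hbound ξ)
  · exact (hmem ξ).coeFn_toLp

end Kernel

section NormalizedIndicator

variable {X : Type u} [MeasurableSpace X] {μ : Measure X}

variable (μ) in
/-- The normalized indicator function of a set. -/
def unitVec (s : Set X) : Lp ℂ 2 μ := (((√(μ.real s))⁻¹ : ℝ) : ℂ) • indVec μ s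

theorem orthonormal_unitVec {ι : Type*} {s : ι → Set X} (hs : ∀ i, MeasurableSet (s i))
    (h0 : ∀ i, 0 < μ (s i)) (hμ : ∀ i, μ (s i) ≠ ∞)
    (hd : Pairwise (Function.onFun Disjoint s)) : Orthonormal ℂ fun i => unitVec μ (s i) := by
  classical
  rw [orthonormal_iff_ite]
  intro i j
  simp only [unitVec, inner_smul_left, inner_smul_right,
    inner_indVec_indVec (hs i) (hμ i) (hs j) (hμ j)]
  split_ifs with hij
  · subst hij
    have : 0 < μ.real (s i) := ENNReal.toReal_pos (h0 i).ne' (hμ i)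
    rw [Set.inter_self, Complex.conj_ofReal, ← Complex.ofReal_mul, ← Complex.ofReal_mul,
      ← Complex.ofReal_one]
    congr 1
    have h2 := Real.sqrt_pos.2 this
    field_simp
    exact (Real.sq_sqrt this.le).symm
  · rw [(hd hij).inter_eq]; simp

end NormalizedIndicator
-- Indicators of compact sets determine vectors and operators.
section Density

variable {X : Type u} [TopologicalSpace X] [T2Space X] [MeasurableSpace X] [BorelSpace X]
  {μ : Measure X} [IsFiniteMeasureOnCompacts μ] [μ.InnerRegularCompactLTTop]

/-- By inner regularity a set of finite measure differs from a compact subset by measure at most ε,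
and the integral of f over the difference is at most √ε ‖f‖. -/
theorem Lp_eq_zero_of_forall_inner_indVec {f : Lp ℂ 2 μ}
    (h : ∀ K : Set X, IsCompact K → inner ℂ (indVec μ K) f = 0) : f = 0 := by
  have hint : ∀ s : Set X, MeasurableSet s → μ s < ∞ → IntegrableOn f s μ := by
    intro s _ hs
    have : IsFiniteMeasure (μ.restrict s) := ⟨by simpa using hs⟩
    exact ((Lp.memLp f).restrict s).integrable one_le_two
  refine (Lp.eq_zero_iff_ae_eq_zero).2 (Lp.ae_eq_zero_of_forall_setIntegral_eq_zero f two_ne_zero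
    ENNReal.ofNat_ne_top hint fun s hs hμ => ?_)
  have hle : ∀ ε : ℝ, 0 < ε → ‖∫ x in s, f x ∂μ‖ ^ 2 ≤ ε * ‖f‖ ^ 2 := by
    intro ε hε
    obtain ⟨K, hKs, hK, hKμ⟩ := hs.exists_isCompact_sdiff_lt hμ.ne
      (ENNReal.ofReal_pos.2 hε).ne'
    have hKm := hK.measurableSet
    have hd : μ (s \ K) ≠ ∞ := (measure_mono Set.sdiff_subset |>.trans_lt hμ).ne
    have h1 : ∫ x in s, f x ∂μ = inner ℂ (indVec μ (s \ K)) f := by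
      rw [inner_indVec (hs.diff hKm) hd, setIntegral_sdiff hKm (hint s hs hμ) hKs,
        ← inner_indVec hKm hK.measure_lt_top.ne, h K hK, sub_zero]
    have h2 : ‖indVec μ (s \ K)‖ ^ 2 ≤ ε := by
      have h3 := inner_indVec_indVec (hs.diff hKm) hd (hs.diff hKm) hd
      rw [inner_self_eq_norm_sq_to_K, Set.inter_self] at h3
      have h4 : ‖indVec μ (s \ K)‖ ^ 2 = μ.real (s \ K) :=
        Complex.ofReal_injective (by rw [← h3]; push_cast; rfl)
      rw [h4]
      exact ENNReal.toReal_le_of_le_ofReal hε.le hKμ.le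
    rw [h1]
    calc ‖inner ℂ (indVec μ (s \ K)) f‖ ^ 2 ≤ (‖indVec μ (s \ K)‖ * ‖f‖) ^ 2 := by
          gcongr; exact norm_inner_le_norm _ _
      _ ≤ ε * ‖f‖ ^ 2 := by rw [mul_pow]; gcongr
  have h0 : ‖∫ x in s, f x ∂μ‖ ^ 2 ≤ 0 := by
    have ht : Filter.Tendsto (fun ε : ℝ => ε * ‖f‖ ^ 2) (nhdsWithin 0 (Set.Ioi 0)) (nhds 0) := by
      have : Filter.Tendsto (fun ε : ℝ => ε * ‖f‖ ^ 2) (nhds 0) (nhds (0 * ‖f‖ ^ 2)) :=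
        (continuous_id.mul continuous_const).tendsto 0
      rw [zero_mul] at this
      exact this.mono_left nhdsWithin_le_nhds
    exact ge_of_tendsto ht (Filter.eventually_of_mem self_mem_nhdsWithin hle)
  exact norm_eq_zero.1 (pow_eq_zero_iff two_ne_zero |>.1 (le_antisymm h0 (by positivity)))

theorem clm_eq_of_inner_indVec_eq {L D : Lp ℂ 2 μ →L[ℂ] Lp ℂ 2 μ}
    (h : ∀ R S : Set X, IsCompact R → IsCompact S →
      inner ℂ (indVec μ R) (L (indVec μ S)) = inner ℂ (indVec μ R) (D (indVec μ S))) : L = D := by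
  have h1 : ∀ S : Set X, IsCompact S → (L - D) (indVec μ S) = 0 := fun S hS =>
    Lp_eq_zero_of_forall_inner_indVec fun R hR => by
      rw [sub_apply, inner_sub_right, h R S hR hS, sub_self]
  have h2 : (L - D).adjoint = 0 := by
    ext1 g
    refine Lp_eq_zero_of_forall_inner_indVec fun S hS => ?_
    rw [ContinuousLinearMap.adjoint_inner_right, h1 S hS, inner_zero_left]
  exact sub_eq_zero.1 ((LinearIsometryEquiv.map_eq_zero_iff _).1 h2)

end Density

/-! ### Finite partitions on which φ has small oscillation. -/

section Atoms

variable {X : Type u}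

open Classical in
/-- The sets of the family `𝒜` that contain `z`. -/
def signature (𝒜 : Finset (Set X)) (z : X) : Finset (Set X) := 𝒜.filter (z ∈ ·)

/-- The atom of `z` in the finite algebra of sets generated by `𝒜`. -/
def atomOf (𝒜 : Finset (Set X)) (z : X) : Set X := {y | signature 𝒜 y = signature 𝒜 z}

theorem mem_iff_of_signature_eq {𝒜 : Finset (Set X)} {y z : X}
    (h : signature 𝒜 y = signature 𝒜 z) {A : Set X} (hA : A ∈ 𝒜) : y ∈ A ↔ z ∈ A := by
  have := congrArg (A ∈ ·) h
  simpa [signature, hA] using this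

theorem finite_range_signature (𝒜 : Finset (Set X)) : (Set.range (signature 𝒜)).Finite := by
  classical
  refine (𝒜.powerset : Finset (Finset (Set X))).finite_toSet.subset ?_
  rintro _ ⟨z, rfl⟩
  exact Finset.mem_coe.2 (Finset.mem_powerset.2 (Finset.filter_subset _ _))

theorem measurableSet_signature_eq [MeasurableSpace X] {𝒜 : Finset (Set X)}
    (h𝒜 : ∀ A ∈ 𝒜, MeasurableSet A) (s : Finset (Set X)) :
    MeasurableSet {y | signature 𝒜 y = s} := by
  classical
  by_cases hs : s ⊆ 𝒜
  · have h1 : {y | signature 𝒜 y = s} = ⋂ A ∈ 𝒜, {y | y ∈ A ↔ A ∈ s} := by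
      ext y
      simp only [Set.mem_ofPred_eq, Set.mem_iInter, signature, Finset.ext_iff, Finset.mem_filter]
      constructor
      · intro h A hA; simpa [hA] using h A
      · intro h A
        by_cases hA : A ∈ 𝒜
        · simpa [hA] using h A hA
        · simpa [hA] using fun h' => hA (hs h')
    rw [h1]
    refine Finset.measurableSet_biInter _ fun A hA => ?_
    by_cases hAs : A ∈ s
    · simpa [hAs] using h𝒜 A hA
    · simp only [hAs, iff_false]
      exact (h𝒜 A hA).compl
  · have h1 : {y | signature 𝒜 y = s} = ∅ := by
      ext y
      simp only [Set.mem_ofPred_eq, Set.mem_empty_iff_false, iff_false]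
      rintro rfl
      exact hs (Finset.filter_subset _ _)
    rw [h1]; exact MeasurableSet.empty

theorem measurableSet_atomOf [MeasurableSpace X] {𝒜 : Finset (Set X)}
    (h𝒜 : ∀ A ∈ 𝒜, MeasurableSet A) (z : X) : MeasurableSet (atomOf 𝒜 z) :=
  measurableSet_signature_eq h𝒜 _

theorem disjoint_atomOf {𝒜 : Finset (Set X)} {y z : X}
    (h : signature 𝒜 y ≠ signature 𝒜 z) : Disjoint (atomOf 𝒜 y) (atomOf 𝒜 z) :=
  Set.disjoint_left.2 fun _ h1 h2 => h (h1.symm.trans h2)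

/-- Compactness of K gives neighbourhoods that control φ uniformly in the other variable; finitely
many cover K. Points with equal signatures share a member of the cover and are compared through its
centre, one variable at a time. -/
theorem exists_finset_oscillation_le [TopologicalSpace X] {φ : X × X → ℂ} (hφ : Continuous φ)
    {K : Set X} (hK : IsCompact K) {ε : ℝ} (hε : 0 < ε) :
    ∃ 𝒜 : Finset (Set X), (∀ A ∈ 𝒜, IsOpen A) ∧ ∀ x ∈ K, ∀ x' ∈ K, ∀ y ∈ K, ∀ y' ∈ K,
      signature 𝒜 x = signature 𝒜 x' → signature 𝒜 y = signature 𝒜 y' →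
        ‖φ (x, y) - φ (x', y')‖ ≤ ε := by
  classical
  have hnhds : ∀ x : X, ∃ O : Set X, IsOpen O ∧ x ∈ O ∧ ∀ x' ∈ O, ∀ y ∈ K,
      ‖φ (x', y) - φ (x, y)‖ < ε / 4 ∧ ‖φ (y, x') - φ (y, x)‖ < ε / 4 := by
    intro x
    have h1 : ∀ᶠ x' in nhds x, ∀ y ∈ K,
        ‖φ (x', y) - φ (x, y)‖ < ε / 4 ∧ ‖φ (y, x') - φ (y, x)‖ < ε / 4 := by
      refine hK.eventually_forall_of_forall_eventually fun y _ => ?_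
      have c1 : Continuous fun z : X × X => ‖φ (z.1, z.2) - φ (x, z.2)‖ := by fun_prop
      have c2 : Continuous fun z : X × X => ‖φ (z.2, z.1) - φ (z.2, x)‖ := by fun_prop
      exact (c1.continuousAt.eventually_lt continuousAt_const (by simpa using by positivity)).and
        (c2.continuousAt.eventually_lt continuousAt_const (by simpa using by positivity))
    obtain ⟨O, hO, hOo, hxO⟩ := eventually_nhds_iff.1 h1
    exact ⟨O, hOo, hxO, hO⟩
  choose O hOo hxO hO using hnhds
  obtain ⟨t, ht⟩ := hK.elim_finite_subcover O hOo fun x _ => Set.mem_iUnion.2 ⟨x, hxO x⟩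
  refine ⟨t.image O, by simpa using fun a _ => hOo a, ?_⟩
  have key : ∀ x ∈ K, ∀ x' ∈ K, signature (t.image O) x = signature (t.image O) x' →
      ∀ y ∈ K, ‖φ (x, y) - φ (x', y)‖ ≤ ε / 2 ∧ ‖φ (y, x) - φ (y, x')‖ ≤ ε / 2 := by
    intro x hx x' _ h y hy
    obtain ⟨i, hi, hxi⟩ := Set.mem_iUnion₂.1 (ht hx)
    have hxi' := (mem_iff_of_signature_eq h (Finset.mem_image_of_mem O hi)).1 hxi
    have a := hO i x hxi y hy
    have b := hO i x' hxi' y hy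
    have e : ∀ u v w : ℂ, ‖u - w‖ < ε / 4 → ‖v - w‖ < ε / 4 → ‖u - v‖ ≤ ε / 2 := by
      intro u v w h1 h2
      have := norm_sub_le (u - w) (v - w)
      rw [sub_sub_sub_cancel_right] at this
      linarith
    exact ⟨e _ _ _ a.1 b.1, e _ _ _ a.2 b.2⟩
  intro x hx x' hx' y hy y' hy' h1 h2
  have a := (key x hx x' hx' h1 y hy).1
  have b := (key y hy y' hy' h2 x' hx').2
  have := norm_add_le (φ (x, y) - φ (x', y)) (φ (x', y) - φ (x', y'))
  rw [sub_add_sub_cancel] at this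
  linarith

end Atoms
-- Measurability and essential boundedness of φ.
section SymbolMeasurability

theorem measurable_comp_signature {X : Type u} [MeasurableSpace X] {𝒜 : Finset (Set X)}
    (h𝒜 : ∀ A ∈ 𝒜, MeasurableSet A) (G : Finset (Set X) → Finset (Set X) → ℂ) :
    Measurable fun z : X × X => G (signature 𝒜 z.1) (signature 𝒜 z.2) := by
  let R := Set.range (signature 𝒜)
  have : Finite R := (finite_range_signature 𝒜).to_subtype
  let _ : MeasurableSpace R := ⊤
  have hσ : Measurable fun z : X => (⟨signature 𝒜 z, z, rfl⟩ : R) := by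
    refine measurable_to_countable' fun s => ?_
    convert measurableSet_signature_eq h𝒜 s.1 using 1
    ext z
    simp [Subtype.ext_iff]
  have hG : Measurable fun s : R × R => G s.1 s.2 := measurable_of_countable _
  exact hG.comp ((hσ.comp measurable_fst).prodMk (hσ.comp measurable_snd))

variable {X : Type u} [TopologicalSpace X] [T2Space X] [MeasurableSpace X] [BorelSpace X]
  {μ : Measure X} {φ : X × X → ℂ}

/-- X is not assumed second countable, so continuity alone does not give measurability for the
product σ-algebra. Instead φ is a uniform limit on K × K of functions of finite signatures. -/
theorem aestronglyMeasurable_restrict_prod (hφ : Continuous φ) {K : Set X} (hK : IsCompact K) :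
    AEStronglyMeasurable φ ((μ.prod μ).restrict (K ×ˢ K)) := by
  rcases K.eq_empty_or_nonempty with rfl | ⟨z₀, _⟩
  · simp
  choose 𝒜 hopen hosc using fun n : ℕ =>
    exists_finset_oscillation_le hφ hK (ε := 1 / ((n : ℝ) + 1)) (by positivity)
  -- The representative depends on the signature only; z₀ is a default for signatures not attained
  -- in K.
  have hrep : ∀ (n : ℕ) (s : Finset (Set X)), ∃ r : X,
      ∀ z ∈ K, signature (𝒜 n) z = s → r ∈ K ∧ signature (𝒜 n) r = s := by
    intro n s
    by_cases h : ∃ z ∈ K, signature (𝒜 n) z = s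
    · obtain ⟨z, hz⟩ := h
      exact ⟨z, fun _ _ _ => hz⟩
    · exact ⟨z₀, fun z hz hs => (h ⟨z, hz, hs⟩).elim⟩
  choose r hr using hrep
  refine aestronglyMeasurable_of_tendsto_ae Filter.atTop (f := fun n z =>
    φ (r n (signature (𝒜 n) z.1), r n (signature (𝒜 n) z.2))) (fun n => ?_) ?_
  · exact (measurable_comp_signature (fun A hA => (hopen n A hA).measurableSet)
      fun s t => φ (r n s, r n t)).aestronglyMeasurable
  · filter_upwards [ae_restrict_mem (hK.measurableSet.prod hK.measurableSet)] with z hz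
    refine tendsto_iff_norm_sub_tendsto_zero.2 (squeeze_zero (fun _ => norm_nonneg _)
      (fun n => ?_) tendsto_one_div_add_atTop_nhds_zero_nat)
    have h1 := hr n _ z.1 hz.1 rfl
    have h2 := hr n _ z.2 hz.2 rfl
    exact hosc n _ h1.1 _ hz.1 _ h2.1 _ hz.2 h1.2 h2.2

variable [SigmaFinite μ] [μ.InnerRegularCompactLTTop]

theorem exists_seq_isCompact_ae_mem (μ : Measure X) [SigmaFinite μ] [μ.InnerRegularCompactLTTop] :
    ∃ K : ℕ × ℕ → Set X, (∀ n, IsCompact (K n)) ∧ ∀ᵐ x ∂μ, ∃ n, x ∈ K n := by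
  have h := fun n : ℕ × ℕ => (measurableSet_spanningSets μ n.1).exists_isCompact_sdiff_lt
    (measure_spanningSets_lt_top μ n.1).ne (ε := ((n.2 : ℝ≥0∞) + 1)⁻¹)
    (ENNReal.inv_ne_zero.2 (by finiteness))
  choose K hKs hK hKμ using h
  refine ⟨K, hK, ?_⟩
  have h0 : ∀ n, μ (spanningSets μ n \ ⋃ m, K (n, m)) = 0 := by
    intro n
    have ht : Filter.Tendsto (fun m : ℕ => ((m : ℝ≥0∞) + 1)⁻¹) Filter.atTop (nhds 0) := by
      exact_mod_cast ENNReal.tendsto_inv_nat_nhds_zero.comp (Filter.tendsto_add_atTop_nat 1)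
    exact le_antisymm (ge_of_tendsto' ht fun m =>
      (measure_mono (Set.sdiff_subset_sdiff_right (Set.subset_iUnion _ m))).trans
        (hKμ (n, m)).le) zero_le
  have h1 : ∀ᵐ x ∂μ, ∀ n, x ∉ spanningSets μ n \ ⋃ m, K (n, m) :=
    ae_all_iff.2 fun n => measure_eq_zero_iff_ae_notMem.1 (h0 n)
  filter_upwards [h1] with x hx
  obtain ⟨n, hn⟩ := Set.mem_iUnion.1 ((iUnion_spanningSets μ).symm ▸ Set.mem_univ x)
  by_contra hcon
  push Not at hcon
  exact hx n ⟨hn, fun hmem => by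
    obtain ⟨m, hm⟩ := Set.mem_iUnion.1 hmem
    exact hcon _ hm⟩

theorem aestronglyMeasurable_prod_of_continuous (hφ : Continuous φ) :
    AEStronglyMeasurable φ (μ.prod μ) := by
  obtain ⟨K, hK, hcov⟩ := exists_seq_isCompact_ae_mem μ
  have h1 : AEStronglyMeasurable φ ((μ.prod μ).restrict
      (⋃ n : (ℕ × ℕ) × (ℕ × ℕ), (K n.1 ∪ K n.2) ×ˢ (K n.1 ∪ K n.2))) :=
    aestronglyMeasurable_iUnion_iff.2 fun n =>
      aestronglyMeasurable_restrict_prod hφ ((hK n.1).union (hK n.2))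
  rwa [Measure.restrict_eq_self_of_ae_mem] at h1
  filter_upwards [Measure.quasiMeasurePreserving_fst.ae hcov,
    Measure.quasiMeasurePreserving_snd.ae hcov] with z ⟨n, hn⟩ ⟨m, hm⟩
  exact Set.mem_iUnion.2 ⟨(n, m), Or.inl hn, Or.inr hm⟩

/-- Inner regularity makes the support conull, so a bound there is an essential bound. -/
theorem memLp_top_of_continuous (hφ : Continuous φ) {C : ℝ}
    (h : ∀ x ∈ μ.support, ∀ y ∈ μ.support, ‖φ (x, y)‖ ≤ C) : MemLp φ ∞ (μ.prod μ) := by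
  have hs : ∀ᵐ x ∂μ, x ∈ μ.support := Measure.support_mem_ae_of_innerRegular
  refine memLp_top_of_bound (aestronglyMeasurable_prod_of_continuous hφ) C ?_
  filter_upwards [Measure.quasiMeasurePreserving_fst.ae hs,
    Measure.quasiMeasurePreserving_snd.ae hs] with z h1 h2
  exact h _ h1 _ h2

end SymbolMeasurability

/-! ### Atoms of positive measure and step symbols. -/

section Steps

variable {X : Type u} [TopologicalSpace X] [MeasurableSpace X] [BorelSpace X]

theorem exists_finset_atoms (μ : Measure X) [SigmaFinite μ] [μ.InnerRegularCompactLTTop]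
    (𝒜 : Finset (Set X)) (K : Set X) :
    ∃ F : Finset X, (∀ i ∈ F, i ∈ K ∧ i ∈ μ.support ∧ 0 < μ (atomOf 𝒜 i)) ∧
      (∀ i ∈ F, ∀ j ∈ F, signature 𝒜 i = signature 𝒜 j → i = j) ∧
      ∀ᵐ z ∂μ, z ∈ K → ∃ i ∈ F, signature 𝒜 z = signature 𝒜 i := by
  let Q : Set X := {z | z ∈ K ∧ z ∈ μ.support ∧ 0 < μ (atomOf 𝒜 z)}
  obtain ⟨F, hFQ, hF⟩ := Set.exists_subset_bijOn Q (signature 𝒜)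
  have hfin : F.Finite := Set.Finite.of_finite_image
    ((finite_range_signature 𝒜).subset (Set.image_subset_range _ _)) hF.injOn
  refine ⟨hfin.toFinset, fun i hi => hFQ (by simpa using hi), fun i hi j hj h =>
    hF.injOn (by simpa using hi) (by simpa using hj) h, ?_⟩
  have hs : ∀ᵐ x ∂μ, x ∈ μ.support := Measure.support_mem_ae_of_innerRegular
  have h0 : ∀ᵐ z ∂μ, 0 < μ (atomOf 𝒜 z) := by
    -- There are finitely many atoms, so the null ones may be discarded together.
    have hN : μ (⋃ s ∈ {s ∈ Set.range (signature 𝒜) | μ {y | signature 𝒜 y = s} = 0},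
        {y | signature 𝒜 y = s}) = 0 :=
      (measure_biUnion_null_iff ((finite_range_signature 𝒜).subset
        (Set.sep_subset _ _)).countable).2 fun s hs => hs.2
    filter_upwards [measure_eq_zero_iff_ae_notMem.1 hN] with z hz
    refine pos_iff_ne_zero.2 fun h => hz (Set.mem_iUnion₂.2 ⟨signature 𝒜 z, ⟨⟨z, rfl⟩, h⟩, rfl⟩)
  filter_upwards [hs, h0] with z h1 h2 h3
  obtain ⟨i, hi, hiz⟩ := hF.surjOn ⟨z, ⟨h3, h1, h2⟩, rfl⟩
  exact ⟨i, by simpa using hi, hiz.symm⟩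

end Steps
section StepSymbols

variable {X : Type u} [MeasurableSpace X] {μ : Measure X}

/-- Since U lies inside or outside R, projecting the indicator of R to the line of U loses nothing;
no compression error appears later. -/
theorem inner_unitVec_indVec_smul {U R : Set X} (hU : MeasurableSet U) (h0 : 0 < μ U)
    (hμU : μ U ≠ ∞) (hR : MeasurableSet R) (hμR : μ R ≠ ∞) (h : U ⊆ R ∨ Disjoint U R) :
    inner ℂ (unitVec μ U) (indVec μ R) • unitVec μ U = indVec μ (U ∩ R) := by
  have hpos : 0 < μ.real U := ENNReal.toReal_pos h0.ne' hμU
  rw [unitVec, inner_smul_left, inner_indVec_indVec hU hμU hR hμR, smul_smul]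
  rcases h with h | h
  · rw [Set.inter_eq_left.2 h, Complex.conj_ofReal, ← Complex.ofReal_mul, ← Complex.ofReal_mul]
    have : (√(μ.real U))⁻¹ * μ.real U * (√(μ.real U))⁻¹ = 1 := by
      have h2 := Real.sqrt_pos.2 hpos
      field_simp
      exact (Real.sq_sqrt hpos.le).symm
    rw [this, Complex.ofReal_one, one_smul]
  · have h1 : indVec μ (∅ : Set X) = 0 := by
      refine (Lp.eq_zero_iff_ae_eq_zero).2 ?_
      filter_upwards [coeFn_indVec (μ := μ) MeasurableSet.empty (by simp)] with x hx
      rw [hx]; simp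
    rw [h.inter_eq, h1]; simp

variable {ι : Type*} [Fintype ι]

theorem setIntegral_prod_eq_sum {U : ι → Set X} (hU : ∀ i, MeasurableSet (U i))
    (hd : Pairwise (Function.onFun Disjoint U)) {R S : Set X} (hR : MeasurableSet R)
    (hS : MeasurableSet S) (hcR : ∀ᵐ z ∂μ, z ∈ R → ∃ i, z ∈ U i)
    (hcS : ∀ᵐ z ∂μ, z ∈ S → ∃ i, z ∈ U i) {E : Type*} [NormedAddCommGroup E] [NormedSpace ℝ E]
    {f : X × X → E} (hf : IntegrableOn f (R ×ˢ S) (μ.prod μ)) :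
    ∫ z in R ×ˢ S, f z ∂(μ.prod μ) =
      ∑ i, ∑ j, ∫ z in (U i ∩ R) ×ˢ (U j ∩ S), f z ∂(μ.prod μ) := by
  have h1 : (⋃ q : ι × ι, (U q.1 ∩ R) ×ˢ (U q.2 ∩ S)) =ᵐ[μ.prod μ] (R ×ˢ S : Set (X × X)) := by
    filter_upwards [Measure.quasiMeasurePreserving_fst.ae hcR,
      Measure.quasiMeasurePreserving_snd.ae hcS] with z h1 h2
    refine propext ⟨fun hz => ?_, fun hz => ?_⟩
    · obtain ⟨q, hq⟩ := Set.mem_iUnion.1 hz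
      exact ⟨hq.1.2, hq.2.2⟩
    · obtain ⟨i, hi⟩ := h1 hz.1
      obtain ⟨j, hj⟩ := h2 hz.2
      exact Set.mem_iUnion.2 ⟨(i, j), ⟨hi, hz.1⟩, ⟨hj, hz.2⟩⟩
  rw [← setIntegral_congr_set h1, integral_iUnion_fintype, ← Fintype.sum_prod_type']
  · exact fun q => ((hU _).inter hR).prod ((hU _).inter hS)
  · rintro ⟨i, j⟩ ⟨k, l⟩ hne
    refine Set.disjoint_left.2 fun z h1 h2 => hne ?_
    have e1 : i = k := by
      by_contra hik
      exact Set.disjoint_left.1 (hd hik) h1.1.1 h2.1.1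
    have e2 : j = l := by
      by_contra hjl
      exact Set.disjoint_left.1 (hd hjl) h1.2.1 h2.2.1
    rw [e1, e2]
  · exact fun q => hf.mono_set (Set.prod_mono Set.inter_subset_right Set.inter_subset_right)

/-- The coefficient is exactly ∑ c i j ∫ k over the rectangles of the partition, and on each
rectangle c i j differs from φ by at most ε. -/
theorem norm_inner_blockSchur_sub_le [SigmaFinite μ] {U : ι → Set X} (hU : ∀ i, MeasurableSet (U i))
    (h0 : ∀ i, 0 < μ (U i)) (hμU : ∀ i, μ (U i) ≠ ∞)
    (hd : Pairwise (Function.onFun Disjoint U)) {R S : Set X} (hR : MeasurableSet R)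
    (hS : MeasurableSet S) (hμR : μ R ≠ ∞) (hμS : μ S ≠ ∞)
    (hUR : ∀ i, U i ⊆ R ∨ Disjoint (U i) R) (hUS : ∀ i, U i ⊆ S ∨ Disjoint (U i) S)
    (hcR : ∀ᵐ z ∂μ, z ∈ R → ∃ i, z ∈ U i) (hcS : ∀ᵐ z ∂μ, z ∈ S → ∃ i, z ∈ U i)
    {φ : X × X → ℂ} (hφ : MemLp φ ∞ (μ.prod μ)) {c : ι → ι → ℂ} {ε : ℝ}
    (hc : ∀ i j, ∀ z ∈ U i, ∀ w ∈ U j, ‖c i j - φ (z, w)‖ ≤ ε)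
    {A : Lp ℂ 2 μ →L[ℂ] Lp ℂ 2 μ} {k : X × X → ℂ} (hA : HasKernel μ A k) :
    ‖inner ℂ (indVec μ R)
        (blockSchur (plainIsom fun i => unitVec μ (U i)) c A (indVec μ S)) -
      ∫ z in R ×ˢ S, φ z * k z ∂(μ.prod μ)‖ ≤ ε * ∫ z in R ×ˢ S, ‖k z‖ ∂(μ.prod μ) := by
  have hk := hA.1.integrableOn_prod_of_two hμR hμS
  have hφk : IntegrableOn (fun z => φ z * k z) (R ×ˢ S) (μ.prod μ) :=
    (hA.1.mul' hφ (r := 2)).integrableOn_prod_of_two hμR hμS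
  rw [setIntegral_prod_eq_sum hU hd hR hS hcR hcS hφk,
    setIntegral_prod_eq_sum hU hd hR hS hcR hcS hk.norm, inner_blockSchur]
  simp only [plainIsom_apply, adjoint_plainIsom_apply,
    inner_unitVec_indVec_smul (hU _) (h0 _) (hμU _) hR hμR (hUR _),
    inner_unitVec_indVec_smul (hU _) (h0 _) (hμU _) hS hμS (hUS _)]
  rw [← Finset.sum_sub_distrib, Finset.mul_sum]
  refine norm_sum_le_of_le _ fun i _ => ?_
  rw [← Finset.sum_sub_distrib, Finset.mul_sum]
  refine norm_sum_le_of_le _ fun j _ => ?_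
  have hsub : (U i ∩ R) ×ˢ (U j ∩ S) ⊆ R ×ˢ S :=
    Set.prod_mono Set.inter_subset_right Set.inter_subset_right
  have hmeas : MeasurableSet ((U i ∩ R) ×ˢ (U j ∩ S)) :=
    ((hU _).inter hR).prod ((hU _).inter hS)
  rw [hA.inner_indVec ((hU i).inter hR)
    (measure_mono Set.inter_subset_right |>.trans_lt hμR.lt_top).ne ((hU j).inter hS)
    (measure_mono Set.inter_subset_right |>.trans_lt hμS.lt_top).ne, ← integral_const_mul,
    ← integral_sub ((hk.mono_set hsub).const_mul _) (hφk.mono_set hsub), ← integral_const_mul]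
  refine norm_integral_le_of_norm_le ((hk.mono_set hsub).norm.const_mul _) ?_
  filter_upwards [ae_restrict_mem hmeas] with z hz
  rw [← sub_mul, norm_mul]
  exact mul_le_mul_of_nonneg_right (hc i j _ hz.1.1 _ hz.2.1) (norm_nonneg _)

end StepSymbols

section ExistsStep

variable {X : Type u} [TopologicalSpace X] [T2Space X] [MeasurableSpace X] [BorelSpace X]
  {μ : Measure X} [IsFiniteMeasureOnCompacts μ] [SigmaFinite μ] [μ.InnerRegularCompactLTTop]

-- The finite set and the orthonormal family depend on 𝒮 and ε but not on the operator, so one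
-- choice serves a whole linear map.
open Classical in
theorem exists_step {φ : X × X → ℂ} (hφ : Continuous φ) (hm : MemLp φ ∞ (μ.prod μ))
    (𝒮 : Finset (TopologicalSpace.Compacts X)) {ε : ℝ} (hε : 0 < ε) :
    ∃ (F : Finset X) (x : F → Lp ℂ 2 μ), (F : Set X) ⊆ μ.support ∧ Orthonormal ℂ x ∧
      ∀ R ∈ 𝒮, ∀ S ∈ 𝒮, ∀ (A : Lp ℂ 2 μ →L[ℂ] Lp ℂ 2 μ) (k : X × X → ℂ), HasKernel μ A k →
        ‖inner ℂ (indVec μ R) (blockSchur (plainIsom x) (fun i j => φ (i, j)) A (indVec μ S)) -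
          ∫ z in (R : Set X) ×ˢ (S : Set X), φ z * k z ∂(μ.prod μ)‖ ≤
        ε * ∫ z in (R : Set X) ×ˢ (S : Set X), ‖k z‖ ∂(μ.prod μ) := by
  let K : Set X := ⋃ (S : TopologicalSpace.Compacts X) (_ : S ∈ 𝒮), (S : Set X)
  have hK : IsCompact K := 𝒮.isCompact_biUnion fun S _ => S.isCompact
  obtain ⟨ℬ, hℬo, hℬ⟩ := exists_finset_oscillation_le hφ hK hε
  -- Adding the sets of 𝒮 makes each of them, and hence K, a union of atoms; in particular atoms
  -- inside K have finite measure.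
  let 𝒜 : Finset (Set X) := ℬ ∪ 𝒮.image fun S : TopologicalSpace.Compacts X => (S : Set X)
  have h𝒜 : ∀ A ∈ 𝒜, MeasurableSet A := by
    intro A hA
    rcases Finset.mem_union.1 hA with h | h
    · exact (hℬo A h).measurableSet
    · obtain ⟨S, _, rfl⟩ := Finset.mem_image.1 h
      exact S.isCompact.measurableSet
  have hS𝒜 : ∀ S : TopologicalSpace.Compacts X, S ∈ 𝒮 → (S : Set X) ∈ 𝒜 := fun S hS =>
    Finset.mem_union_right _ (Finset.mem_image_of_mem _ hS)
  have hsub : ∀ z w, signature 𝒜 z = signature 𝒜 w → signature ℬ z = signature ℬ w := by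
    intro z w h
    refine Finset.filter_congr fun A hA => ?_
    exact mem_iff_of_signature_eq h (Finset.mem_union_left _ hA)
  have hKatom : ∀ z w, signature 𝒜 z = signature 𝒜 w → w ∈ K → z ∈ K := by
    intro z w h hw
    obtain ⟨S, hS, hwS⟩ := Set.mem_iUnion₂.1 hw
    exact Set.mem_iUnion₂.2 ⟨S, hS, (mem_iff_of_signature_eq h (hS𝒜 S hS)).2 hwS⟩
  obtain ⟨F, hF, hinj, hcov⟩ := exists_finset_atoms μ 𝒜 K
  have hd : Pairwise (Function.onFun Disjoint fun i : F => atomOf 𝒜 (i : X)) := fun i j hij =>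
    disjoint_atomOf fun h => hij (Subtype.ext (hinj i i.2 j j.2 h))
  have hU : ∀ i : F, MeasurableSet (atomOf 𝒜 (i : X)) := fun i => measurableSet_atomOf h𝒜 _
  have hμU : ∀ i : F, μ (atomOf 𝒜 (i : X)) ≠ ∞ := fun i =>
    ((measure_mono fun z hz => hKatom z i hz (hF i i.2).1).trans_lt hK.measure_lt_top).ne
  have h0 : ∀ i : F, 0 < μ (atomOf 𝒜 (i : X)) := fun i => (hF i i.2).2.2
  have hdich : ∀ R : TopologicalSpace.Compacts X, R ∈ 𝒮 → ∀ i : F,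
      atomOf 𝒜 (i : X) ⊆ R ∨ Disjoint (atomOf 𝒜 (i : X)) (R : Set X) := by
    intro R hR i
    by_cases hi : (i : X) ∈ (R : Set X)
    · exact Or.inl fun z hz => (mem_iff_of_signature_eq hz (hS𝒜 R hR)).2 hi
    · exact Or.inr (Set.disjoint_left.2 fun z hz hzR =>
        hi ((mem_iff_of_signature_eq hz (hS𝒜 R hR)).1 hzR))
  have hcov' : ∀ R : TopologicalSpace.Compacts X, R ∈ 𝒮 → ∀ᵐ z ∂μ, z ∈ (R : Set X) → ∃ i : F, z ∈ atomOf 𝒜 (i : X) := by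
    intro R hR
    filter_upwards [hcov] with z hz hzR
    obtain ⟨i, hi, hiz⟩ := hz (Set.mem_iUnion₂.2 ⟨R, hR, hzR⟩)
    exact ⟨⟨i, hi⟩, hiz⟩
  refine ⟨F, fun i => unitVec μ (atomOf 𝒜 (i : X)), fun i hi => (hF i hi).2.1,
    orthonormal_unitVec hU h0 hμU hd, fun R hR S hS A k hA => ?_⟩
  refine norm_inner_blockSchur_sub_le hU h0 hμU hd R.isCompact.measurableSet
    S.isCompact.measurableSet R.isCompact.measure_lt_top.ne S.isCompact.measure_lt_top.ne
    (hdich R hR) (hdich S hS) (hcov' R hR) (hcov' S hS) hm (fun i j z hz w hw => ?_) hA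
  exact hℬ _ (hF i i.2).1 _ (hKatom z i hz (hF i i.2).1) _ (hF j j.2).1 _
    (hKatom w j hw (hF j j.2).1) (hsub _ _ hz.symm) (hsub _ _ hw.symm)

end ExistsStep
-- Finite sections realized on arbitrary orthonormal families.
section FinsetSchur

variable {X : Type u} {φ : X × X → ℂ} {F : Finset X} {p : ℝ≥0∞} [Fact (1 ≤ p)] {C : ℝ≥0}
  {H : Type v} [NormedAddCommGroup H] [InnerProductSpace ℂ H] [CompleteSpace H] {x : F → H}

theorem schattenNormLE_finsetSchur_iff (hx : Orthonormal ℂ x) :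
    SchattenNormLE p (finsetSchur φ F) C ↔
      SchurBound p (plainIsom x) (fun i j => φ (i, j)) C := by
  classical
  unfold finsetSchur
  rw [schattenNormLE_matrixSchur_iff]
  exact ⟨fun h => h.transfer orthonormal_stdVec.orthoIsom_plainIsom hx.orthoIsom_plainIsom,
    fun h => h.transfer hx.orthoIsom_plainIsom orthonormal_stdVec.orthoIsom_plainIsom⟩

theorem schattenCBNormLE_finsetSchur_iff (hx : Orthonormal ℂ x) :
    SchattenCBNormLE.{u, w} p (finsetSchur φ F) C ↔
      ∀ (K : Type w) [NormedAddCommGroup K] [InnerProductSpace ℂ K] [CompleteSpace K],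
        SchurBound p (tensorIsom K x) (fun i j => φ (i, j)) C := by
  classical
  unfold finsetSchur
  rw [schattenCBNormLE_matrixSchur_iff]
  exact ⟨fun h K _ _ _ =>
      (h K).transfer orthonormal_stdVec.orthoIsom_tensorIsom hx.orthoIsom_tensorIsom,
    fun h K _ _ _ =>
      (h K).transfer hx.orthoIsom_tensorIsom orthonormal_stdVec.orthoIsom_tensorIsom⟩

theorem norm_le_of_forall_finsetSchur {s : Set X}
    (h : ∀ F : Finset X, (F : Set X) ⊆ s → SchattenNormLE p (finsetSchur φ F) C) :
    ∀ y ∈ s, ∀ z ∈ s, ‖φ (y, z)‖ ≤ C := by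
  classical
  intro y hy z hz
  have h1 := h {y, z} (by
    intro t ht
    rcases Finset.mem_insert.1 (Finset.mem_coe.1 ht) with rfl | ht
    · exact hy
    · rwa [Finset.mem_singleton.1 ht])
  unfold finsetSchur at h1
  exact h1.norm_apply_le (⟨y, by simp⟩ : ({y, z} : Finset X)) ⟨z, by simp⟩

theorem SchattenCBNormLE.schattenNormLE_finsetSchur 
    (h : SchattenCBNormLE.{u, w} p (finsetSchur φ F) C) :
    SchattenNormLE p (finsetSchur φ F) C := by
  classical
  unfold finsetSchur at h ⊢
  exact h.schattenNormLE_matrixSchur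

end FinsetSchur

/-! ### From finite sections to the multiplier on L²(X, μ). -/

section OfFinset

variable {X : Type u} [TopologicalSpace X] [T2Space X] [MeasurableSpace X] [BorelSpace X]
  {μ : Measure X} [IsFiniteMeasureOnCompacts μ] [SigmaFinite μ] [μ.InnerRegularCompactLTTop]
  {φ : X × X → ℂ}

/-- The multiplication of kernels by a continuous bounded symbol is a weak limit of Schur
multipliers with symbols the restrictions of `φ` to finite subsets of the support. -/
theorem exists_blockSchur_approximation (hφ : Continuous φ) (hm : MemLp φ ∞ (μ.prod μ)) :
    ∃ (α : Type u) (U : Ultrafilter α) (F : α → Finset X) (x : ∀ a, F a → Lp ℂ 2 μ),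
      (∀ a, (F a : Set X) ⊆ μ.support) ∧ (∀ a, Orthonormal ℂ (x a)) ∧
      ∀ (A D L : Lp ℂ 2 μ →L[ℂ] Lp ℂ 2 μ) (k : X × X → ℂ), HasKernel μ A k →
        HasKernel μ D (fun z => φ z * k z) →
        IsWeakLimit (U : Filter α)
          (fun a => blockSchur (plainIsom (x a)) (fun i j => φ (i, j)) A) L → L = D := by
  classical
  -- Directed by inclusion of test sets and by precision: any two compact sets are eventually among
  -- the tests.
  let α := Finset (TopologicalSpace.Compacts X) × ℕ
  choose F x hF hx hstep using fun a : α =>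
    exists_step hφ hm a.1 (ε := 1 / ((a.2 : ℝ) + 1)) (by positivity)
  let U : Ultrafilter α := Ultrafilter.of Filter.atTop
  have hU : (U : Filter α) ≤ Filter.atTop := Ultrafilter.of_le _
  refine ⟨α, U, F, x, hF, hx, fun A D L k hA hD hL => ?_⟩
  refine clm_eq_of_inner_indVec_eq fun R S hR hS => ?_
  refine tendsto_nhds_unique (hL (indVec μ R) (indVec μ S)) ?_
  rw [hD.inner_indVec hR.measurableSet hR.measure_lt_top.ne hS.measurableSet
    hS.measure_lt_top.ne]
  refine Filter.Tendsto.mono_left ?_ hU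
  let c : ℝ := ∫ z in R ×ˢ S, ‖k z‖ ∂(μ.prod μ)
  have hlim : Filter.Tendsto (fun a : α => 1 / ((a.2 : ℝ) + 1) * c) Filter.atTop (nhds 0) := by
    have h1 : Filter.Tendsto (fun n : ℕ => 1 / ((n : ℝ) + 1) * c) Filter.atTop (nhds 0) := by
      simpa using (tendsto_one_div_add_atTop_nhds_zero_nat (𝕜 := ℝ)).mul_const c
    refine h1.comp ?_
    rw [← Filter.prod_atTop_atTop_eq]
    exact Filter.tendsto_snd
  refine tendsto_iff_norm_sub_tendsto_zero.2 (squeeze_zero' (Filter.Eventually.of_forall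
    fun _ => norm_nonneg _) ?_ hlim)
  filter_upwards [Filter.eventually_ge_atTop
    (({⟨R, hR⟩, ⟨S, hS⟩} : Finset (TopologicalSpace.Compacts X)), 0)] with a ha
  exact hstep a ⟨R, hR⟩ (ha.1 (by simp)) ⟨S, hS⟩ (ha.1 (by simp)) A k hA

variable {p : ℝ≥0∞} [Fact (1 ≤ p)] {C : ℝ≥0}

theorem isWeakLimit_blockSchur {α : Type*} (U : Ultrafilter α) {ι : α → Type*}
    [∀ a, Fintype (ι a)] {H : Type v} [NormedAddCommGroup H] [InnerProductSpace ℂ H]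
    [CompleteSpace H] {K : Type w} [NormedAddCommGroup K] [InnerProductSpace ℂ K] [CompleteSpace K]
    {b : ∀ a, ι a → K →L[ℂ] H} {ψ : ∀ a, ι a → ι a → ℂ} (h : ∀ a, SchurBound p (b a) (ψ a) C)
    {A : H →L[ℂ] H} (hA : A ∈ schattenClass p H) :
    IsWeakLimit (U : Filter α) (fun a => blockSchur (b a) (ψ a) A)
      (weakLimit U fun a => blockSchur (b a) (ψ a) A) :=
  (isWeakLimit_of_schattenNorm_le U
    (ENNReal.mul_lt_top ENNReal.coe_lt_top (schattenNorm_lt_top hA)).ne fun a => h a A hA).1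

theorem schurNormLE_of_forall_finsetSchur (hφ : Continuous φ)
    (h : ∀ F : Finset X, (F : Set X) ⊆ μ.support → SchattenNormLE p (finsetSchur φ F) C) :
    SchurNormLE φ μ p C := by
  have hb := norm_le_of_forall_finsetSchur h
  have hm : MemLp φ ∞ (μ.prod μ) := memLp_top_of_continuous hφ hb
  obtain ⟨α, U, F, x, hF, hx, hlim⟩ := exists_blockSchur_approximation hφ hm
  have hs := fun a => (schattenNormLE_finsetSchur_iff (hx a)).1 (h (F a) (hF a))
  refine ⟨hm, fun A => weakLimit U fun a =>
    blockSchur (plainIsom (x a)) (fun i j => φ (i, j)) A, fun A hA k hk => ?_, ?_⟩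
  -- The Hilbert-Schmidt operator with kernel φ k exists independently of the limit, which is then
  -- identified with it.
  · obtain ⟨D, hD⟩ := exists_hasKernel (hk.1.mul' hm (r := 2))
    rw [← hlim A D _ k hk hD (isWeakLimit_blockSchur U hs hA)] at hD
    exact hD
  · exact schattenNormLE_weakLimit U hs fun a y z => schattenNorm_two_blockSchur_rankOne_le
      (hx a).orthoIsom_plainIsom (fun i j => hb _ (hF a i.2) _ (hF a j.2)) y z

/-- The same ultrafilter serves every K: the ampliation is the weak limit of the ampliated finite
multipliers, and limits commute with tensoring by B. -/
theorem schurCBNormLE_of_forall_finsetSchur (hφ : Continuous φ)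
    (h : ∀ F : Finset X, (F : Set X) ⊆ μ.support →
      SchattenCBNormLE.{u, w} p (finsetSchur φ F) C) :
    SchurCBNormLE.{u, w} φ μ p C := by
  have h' := fun F hF => (h F hF).schattenNormLE_finsetSchur
  have hb := norm_le_of_forall_finsetSchur h'
  have hm : MemLp φ ∞ (μ.prod μ) := memLp_top_of_continuous hφ hb
  obtain ⟨α, U, F, x, hF, hx, hlim⟩ := exists_blockSchur_approximation hφ hm
  have hs := fun a => (schattenNormLE_finsetSchur_iff (hx a)).1 (h' (F a) (hF a))
  have hbF : ∀ a, ∀ i j : F a, ‖φ (i, j)‖ ≤ C := fun a i j => hb _ (hF a i.2) _ (hF a j.2)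
  refine ⟨hm, fun A => weakLimit U fun a =>
    blockSchur (plainIsom (x a)) (fun i j => φ (i, j)) A, fun A hA k hk => ?_,
    (schattenNormLE_weakLimit U hs fun a y z => schattenNorm_two_blockSchur_rankOne_le
      (hx a).orthoIsom_plainIsom (hbF a) y z).1, fun K _ _ _ => ?_⟩
  · obtain ⟨D, hD⟩ := exists_hasKernel (hk.1.mul' hm (r := 2))
    rw [← hlim A D _ k hk hD (isWeakLimit_blockSchur U hs hA)] at hD
    exact hD
  · have hsK := fun a => (schattenCBNormLE_finsetSchur_iff (hx a)).1 (h (F a) (hF a)) K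
    refine ⟨fun B => weakLimit U fun a =>
      blockSchur (tensorIsom K (x a)) (fun i j => φ (i, j)) B,
      schattenNormLE_weakLimit U hsK fun a y z => schattenNorm_two_blockSchur_rankOne_le
        (hx a).orthoIsom_tensorIsom (hbF a) y z, fun A hA B _ => ?_⟩
    refine IsWeakLimit.weakLimit_eq ?_
    simp_rw [blockSchur_tensorIsom_opTensor]
    exact (isWeakLimit_blockSchur U hs hA).opTensor (fun a => norm_le_toReal_of_schattenNorm_le
      (ENNReal.mul_lt_top ENNReal.coe_lt_top (schattenNorm_lt_top hA)).ne (hs a A hA)) B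

end OfFinset
-- From the multiplier on L²(X, μ) to finite sections.
section Neighborhoods

variable {X : Type u} [TopologicalSpace X] [T2Space X] [LocallyCompactSpace X] {φ : X × X → ℂ}

theorem exists_open_nhds_oscillation_le (hφ : Continuous φ) (F : Finset X) {ε : ℝ} (hε : 0 < ε) :
    ∃ U : F → Set X, (∀ i, IsOpen (U i)) ∧ (∀ i, (i : X) ∈ U i) ∧
      (∀ i, ∃ K, IsCompact K ∧ U i ⊆ K) ∧ Pairwise (Function.onFun Disjoint U) ∧
      ∀ i j, ∀ z ∈ U i, ∀ w ∈ U j, ‖φ (z, w) - φ (i, j)‖ ≤ ε := by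
  obtain ⟨V, hV, hVd⟩ := F.finite_toSet.t2_separation
  have hosc : ∀ i j : F, ∃ A ∈ nhds (i : X), ∃ B ∈ nhds (j : X),
      ∀ z ∈ A, ∀ w ∈ B, ‖φ (z, w) - φ (i, j)‖ ≤ ε := by
    intro i j
    have h1 : {z : X × X | ‖φ z - φ (i, j)‖ ≤ ε} ∈ nhds ((i : X), (j : X)) := by
      have c : Continuous fun z : X × X => ‖φ z - φ (i, j)‖ := by fun_prop
      filter_upwards [c.continuousAt.eventually_lt continuousAt_const
        (by simpa using hε : ‖φ ((i : X), (j : X)) - φ (i, j)‖ < ε)] with z hz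
      exact hz.le
    obtain ⟨A, hA, B, hB, hAB⟩ := mem_nhds_prod_iff.1 h1
    exact ⟨A, hA, B, hB, fun z hz w hw => hAB ⟨hz, hw⟩⟩
  choose A hA B hB hAB using hosc
  choose K hK hKn using fun i : F => exists_compact_mem_nhds (i : X)
  let N : F → Set X := fun i => V i ∩ K i ∩ ⋂ j, (A i j ∩ B j i)
  have hN : ∀ i : F, N i ∈ nhds (i : X) := fun i =>
    Filter.inter_mem (Filter.inter_mem ((hV i).2.mem_nhds (hV i).1) (hKn i))
      (Filter.iInter_mem.2 fun j => Filter.inter_mem (hA i j) (hB j i))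
  refine ⟨fun i => interior (N i), fun i => isOpen_interior,
    fun i => mem_interior_iff_mem_nhds.2 (hN i), fun i => ⟨K i, hK i, fun z hz =>
      (interior_subset hz).1.2⟩, fun i j hij => ?_, fun i j z hz w hw => ?_⟩
  · exact (hVd i.2 j.2 (Subtype.coe_injective.ne hij)).mono
      (fun z hz => (interior_subset hz).1.1) fun z hz => (interior_subset hz).1.1
  · exact hAB i j z (Set.mem_iInter.1 (interior_subset hz).2 j).1 w
      (Set.mem_iInter.1 (interior_subset hw).2 i).2

variable [MeasurableSpace X] [BorelSpace X] {μ : Measure X} [IsFiniteMeasureOnCompacts μ]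
  [SigmaFinite μ] {p : ℝ≥0∞} [Fact (1 ≤ p)] {C : ℝ≥0}

open Classical in
/-- The matrix coefficients of the multiplication of kernels by `φ`, relative to normalized
indicator functions of small neighborhoods, are close to the values of `φ`. -/
theorem exists_compression (hφ : Continuous φ) (hm : MemLp φ ∞ (μ.prod μ)) {F : Finset X}
    (hF : (F : Set X) ⊆ μ.support) {ε : ℝ} (hε : 0 < ε) :
    ∃ (x : F → Lp ℂ 2 μ) (ψ : F → F → ℂ), Orthonormal ℂ x ∧
      (∀ i j, ‖ψ i j - φ (i, j)‖ ≤ ε) ∧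
      ∀ M : (Lp ℂ 2 μ →L[ℂ] Lp ℂ 2 μ) → (Lp ℂ 2 μ →L[ℂ] Lp ℂ 2 μ),
        ExtendsKernelMul φ μ p M → IsSchattenLinear p M → ∀ i j k l,
          inner ℂ (x k) (M (InnerProductSpace.rankOne ℂ (x i) (x j)) (x l)) =
            if i = k ∧ j = l then ψ i j else 0 := by
  obtain ⟨U, hUo, hUF, hUK, hd, hosc⟩ := exists_open_nhds_oscillation_le hφ F hε
  have hU : ∀ i, MeasurableSet (U i) := fun i => (hUo i).measurableSet
  have h0 : ∀ i, 0 < μ (U i) := fun i =>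
    (Measure.mem_support_iff_forall _).1 (hF i.2) _ ((hUo i).mem_nhds (hUF i))
  have hμ : ∀ i, μ (U i) ≠ ∞ := fun i => by
    obtain ⟨K, hK, hs⟩ := hUK i
    exact ((measure_mono hs).trans_lt hK.measure_lt_top).ne
  have hprod : ∀ i j, (μ.prod μ) (U i ×ˢ U j) ≠ ∞ := fun i j => by
    rw [Measure.prod_prod]; exact ENNReal.mul_ne_top (hμ i) (hμ j)
  refine ⟨fun i => unitVec μ (U i), fun i j => ⨍ z in U i ×ˢ U j, φ z ∂(μ.prod μ),
    orthonormal_unitVec hU h0 hμ hd, fun i j => ?_, fun M hM hlin i j k l => ?_⟩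
  · have : IsFiniteMeasure ((μ.prod μ).restrict (U i ×ˢ U j)) :=
      ⟨by simpa using (hprod i j).lt_top⟩
    -- The average of values lying in a closed ball around φ(i, j) lies in that ball.
    have hmem := (convex_closedBall (φ (i, j)) ε).set_average_mem
      Metric.isClosed_closedBall (μ := μ.prod μ) (t := U i ×ˢ U j) (f := φ)
      (by rw [Measure.prod_prod]; exact (ENNReal.mul_pos (h0 i).ne' (h0 j).ne').ne')
      (hprod i j) ?_ ((hm.restrict _).integrable le_top)
    · rwa [mem_closedBall_iff_norm] at hmem
    · filter_upwards [ae_restrict_mem ((hU i).prod (hU j))] with z hz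
      exact mem_closedBall_iff_norm.2 (hosc i j _ hz.1 _ hz.2)
  · have hker := hM _ (rankOne_mem_schattenClass _ _) _
      (hasKernel_rankOne_indVec (hU i) (hμ i) (hU j) (hμ j))
    have hin := hker.inner_indVec (hU k) (hμ k) (hU l) (hμ l)
    have hsmul : InnerProductSpace.rankOne ℂ (unitVec μ (U i)) (unitVec μ (U j)) =
        ((((√(μ.real (U i)))⁻¹ * (√(μ.real (U j)))⁻¹ : ℝ) : ℂ)) •
          InnerProductSpace.rankOne ℂ (indVec μ (U i)) (indVec μ (U j)) := by
      ext1 z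
      simp only [unitVec, InnerProductSpace.rankOne_apply, inner_smul_left, smul_apply, smul_smul,
        Complex.conj_ofReal]
      congr 1
      push_cast
      ring
    change inner ℂ (unitVec μ (U k)) (M (InnerProductSpace.rankOne ℂ (unitVec μ (U i))
      (unitVec μ (U j))) (unitVec μ (U l))) = _
    rw [hsmul, hlin.map_smul _ _ (rankOne_mem_schattenClass _ _), smul_apply, inner_smul_right,
      unitVec, unitVec, map_smul, inner_smul_left, inner_smul_right, hin]
    -- Multiplying a kernel by φ keeps its support, so disjointness of the neighbourhoods makes M
    -- diagonal on these matrix units.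
    have hind : ∫ z in U k ×ˢ U l, φ z * (U i ×ˢ U j).indicator (fun _ => 1) z ∂(μ.prod μ) =
        if i = k ∧ j = l then ∫ z in U i ×ˢ U j, φ z ∂(μ.prod μ) else 0 := by
      split_ifs with h
      · obtain ⟨rfl, rfl⟩ := h
        refine setIntegral_congr_fun ((hU i).prod (hU j)) fun z hz => ?_
        simp only [Set.indicator_of_mem hz, mul_one]
      · refine setIntegral_eq_zero_of_forall_eq_zero fun z hz => ?_
        rw [Set.indicator_of_notMem, mul_zero]
        refine fun hz' => h ⟨?_, ?_⟩
        · by_contra hik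
          exact Set.disjoint_left.1 (hd hik) hz'.1 hz.1
        · by_contra hjl
          exact Set.disjoint_left.1 (hd hjl) hz'.2 hz.2
    rw [hind]
    split_ifs with h
    · obtain ⟨rfl, rfl⟩ := h
      change _ = ⨍ z in U i ×ˢ U j, φ z ∂(μ.prod μ)
      have hi2 : (((√(μ.real (U i)))⁻¹ : ℝ) : ℂ) * (((√(μ.real (U i)))⁻¹ : ℝ) : ℂ) =
          (((μ.real (U i))⁻¹ : ℝ) : ℂ) := by
        rw [← Complex.ofReal_mul, ← mul_inv, Real.mul_self_sqrt measureReal_nonneg]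
      have hj2 : (((√(μ.real (U j)))⁻¹ : ℝ) : ℂ) * (((√(μ.real (U j)))⁻¹ : ℝ) : ℂ) =
          (((μ.real (U j))⁻¹ : ℝ) : ℂ) := by
        rw [← Complex.ofReal_mul, ← mul_inv, Real.mul_self_sqrt measureReal_nonneg]
      rw [setAverage_eq, measureReal_prod_prod, Complex.conj_ofReal, ← Complex.coe_smul, mul_inv,
        Complex.ofReal_mul, Complex.ofReal_mul, ← hi2, ← hj2, smul_eq_mul]
      ring
    · simp

theorem SchurNormLE.schattenNormLE_finsetSchur (hφ : Continuous φ) (h : SchurNormLE φ μ p C)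
    {F : Finset X} (hF : (F : Set X) ⊆ μ.support) : SchattenNormLE p (finsetSchur φ F) C := by
  classical
  obtain ⟨hm, M, hM, hMC⟩ := h
  refine (schattenNormLE_finsetSchur_iff (orthonormal_stdVec (n := F))).2
    (SchurBound.of_approx fun ε hε => ?_)
  obtain ⟨x, ψ, hx, hψ, hxM⟩ := exists_compression (p := p) hφ hm hF hε
  exact ⟨ψ, hψ, (hMC.schurBound_plainIsom hx (fun i j k l => (hxM M hM hMC.1 i j k l).trans (by congr))).transfer hx.orthoIsom_plainIsom
    orthonormal_stdVec.orthoIsom_plainIsom⟩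

theorem SchurCBNormLE.schattenCBNormLE_finsetSchur (hφ : Continuous φ)
    (h : SchurCBNormLE.{u, w} φ μ p C) {F : Finset X} (hF : (F : Set X) ⊆ μ.support) :
    SchattenCBNormLE.{u, w} p (finsetSchur φ F) C := by
  classical
  obtain ⟨hm, M, hM, hMC⟩ := h
  refine (schattenCBNormLE_finsetSchur_iff (orthonormal_stdVec (n := F))).2
    fun K _ _ _ => SchurBound.of_approx fun ε hε => ?_
  obtain ⟨x, ψ, hx, hψ, hxM⟩ := exists_compression (p := p) hφ hm hF hε
  exact ⟨ψ, hψ, (hMC.schurBound_tensorIsom hx (fun i j k l => (hxM M hM hMC.1 i j k l).trans (by congr)) K).transfer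
    hx.orthoIsom_tensorIsom orthonormal_stdVec.orthoIsom_tensorIsom⟩

end Neighborhoods
-- Supports without isolated points: splitting points.
section Inflation

variable {X : Type u} {φ : X × X → ℂ} {p : ℝ≥0∞} [Fact (1 ≤ p)] {C : ℝ≥0}

theorem SchattenNormLE.schurBound_stdVec {κ : Type v} [Fintype κ] [DecidableEq κ] {y : κ → X}
    (hy : Function.Injective y) {F : Finset X} (hF : ∀ z, z ∈ F ↔ ∃ s, y s = z)
    (h : SchattenNormLE p (finsetSchur φ F) C) :
    SchurBound p (plainIsom (stdVec κ)) (fun s t => φ (y s, y t)) C := by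
  classical
  let σ : κ ≃ F := Equiv.ofBijective (fun s => ⟨y s, (hF _).2 ⟨s, rfl⟩⟩)
    ⟨fun s t hst => hy (congrArg Subtype.val hst), fun z => by
      obtain ⟨s, hs⟩ := (hF z).1 z.2
      exact ⟨s, Subtype.ext hs⟩⟩
  have hF' := (orthonormal_stdVec (n := F)).orthoIsom_plainIsom
  have h1 := (schattenNormLE_finsetSchur_iff orthonormal_stdVec).1 h
  have h2 : SchurBound p (fun s => plainIsom (stdVec F) (σ s)) (fun s t => φ (y s, y t)) C := by
    intro B hB
    exact (congrArg (schattenNorm p) (blockSchur_comp_equiv σ (plainIsom (stdVec F))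
      (fun i j => φ (i, j)) B)).trans_le (h1 B hB)
  exact h2.transfer (hF'.comp_injective σ.injective) orthonormal_stdVec.orthoIsom_plainIsom

variable [TopologicalSpace X] [T2Space X] [LocallyCompactSpace X]

/-- Every neighbourhood of a point of s contains infinitely many points of s, so m distinct ones can
be chosen; disjoint neighbourhoods separate the clusters. -/
theorem exists_injective_oscillation_le (hφ : Continuous φ) {s : Set X} (hs : Preperfect s)
    {F : Finset X} (hF : (F : Set X) ⊆ s) (m : ℕ) {ε : ℝ} (hε : 0 < ε) :
    ∃ y : F × Fin m → X, Function.Injective y ∧ (∀ q, y q ∈ s) ∧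
      ∀ q r, ‖φ (y q, y r) - φ (q.1, r.1)‖ ≤ ε := by
  obtain ⟨U, hUo, hUF, -, hd, hosc⟩ := exists_open_nhds_oscillation_le hφ F hε
  have hinf : ∀ i : F, (U i ∩ s).Infinite := fun i =>
    Set.Infinite.of_accPt ((hs i (hF i.2)).nhds_inter ((hUo i).mem_nhds (hUF i)))
  let y : F × Fin m → X := fun q => (hinf q.1).natEmbedding _ q.2
  have hy : ∀ q, y q ∈ U q.1 ∩ s := fun q => ((hinf q.1).natEmbedding _ q.2).2
  refine ⟨y, ?_, fun q => (hy q).2, fun q r => hosc _ _ _ (hy q).1 _ (hy r).1⟩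
  rintro ⟨i, a⟩ ⟨j, b⟩ hab
  obtain rfl : i = j := by
    by_contra hij
    exact Set.disjoint_left.1 (hd hij) (hy (i, a)).1 (hab ▸ (hy (j, b)).1)
  have := ((hinf i).natEmbedding _).injective (Subtype.ext hab)
  exact Prod.ext rfl (Fin.ext this)

/-- On sets without isolated points, the norms of the finite sections of a continuous Schur
multiplier control their completely bounded norms. -/
theorem schattenCBNormLE_finsetSchur_of_preperfect (hφ : Continuous φ) {s : Set X}
    (hs : Preperfect s)
    (h : ∀ F : Finset X, (F : Set X) ⊆ s → SchattenNormLE p (finsetSchur φ F) C)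
    {F : Finset X} (hF : (F : Set X) ⊆ s) : SchattenCBNormLE.{u, w} p (finsetSchur φ F) C := by
  classical
  refine (schattenCBNormLE_finsetSchur_iff (orthonormal_stdVec (n := F))).2 fun K _ _ _ => ?_
  -- The inflated symbol is approximated by genuine finite sections of φ on m|F| points of s, to
  -- which the hypothesis applies.
  refine schurBound_of_inflation (fun m => ⟨EuclideanSpace ℂ (F × Fin m), inferInstance,
    inferInstance, inferInstance, plainIsom (stdVec (F × Fin m)),
    orthonormal_stdVec.orthoIsom_plainIsom, SchurBound.of_approx fun ε hε => ?_⟩)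
    orthonormal_stdVec.orthoIsom_tensorIsom
  obtain ⟨y, hy, hys, hyφ⟩ := exists_injective_oscillation_le hφ hs hF m hε
  refine ⟨_, hyφ, (h (Finset.univ.image y) fun z hz => ?_).schurBound_stdVec hy fun z => by simp⟩
  obtain ⟨q, _, rfl⟩ := Finset.mem_image.1 (Finset.mem_coe.1 hz)
  exact hys q

end Inflation

end

theorem theorem1p19 {X : Type u} [TopologicalSpace X] [T2Space X] [LocallyCompactSpace X]
    [MeasurableSpace X] [BorelSpace X]
    (μ : Measure X) [IsFiniteMeasureOnCompacts μ] [μ.InnerRegularCompactLTTop] [SigmaFinite μ]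
    (φ : X × X → ℂ) (hφ : Continuous φ) (p : ℝ≥0∞) (hp : 1 ≤ p) :
    (∀ C : ℝ≥0, SchurNormLE φ μ p C ↔
      ∀ F : Finset X, (F : Set X) ⊆ μ.support →
        SchattenNormLE p (finsetSchur φ F) C) ∧
    (∀ C : ℝ≥0, SchurCBNormLE.{u, w} φ μ p C ↔
      ∀ F : Finset X, (F : Set X) ⊆ μ.support →
        SchattenCBNormLE.{u, w} p (finsetSchur φ F) C) ∧
    (∀ (ν : Measure X) [IsFiniteMeasureOnCompacts ν] [ν.InnerRegularCompactLTTop] [SigmaFinite ν],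
      ν.support = μ.support →
        schurNorm φ ν p = schurNorm φ μ p ∧
          schurCBNorm.{u, w} φ ν p = schurCBNorm.{u, w} φ μ p) ∧
    (Preperfect μ.support → schurNorm φ μ p = schurCBNorm.{u, w} φ μ p) := by
  have : Fact (1 ≤ p) := ⟨hp⟩
  have ha : ∀ (ν : Measure X) [IsFiniteMeasureOnCompacts ν] [ν.InnerRegularCompactLTTop]
      [SigmaFinite ν] (C : ℝ≥0), SchurNormLE φ ν p C ↔
        ∀ F : Finset X, (F : Set X) ⊆ ν.support → SchattenNormLE p (finsetSchur φ F) C :=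
    fun ν _ _ _ C => ⟨fun h F hF => h.schattenNormLE_finsetSchur hφ hF,
      schurNormLE_of_forall_finsetSchur hφ⟩
  have hb : ∀ (ν : Measure X) [IsFiniteMeasureOnCompacts ν] [ν.InnerRegularCompactLTTop]
      [SigmaFinite ν] (C : ℝ≥0), SchurCBNormLE.{u, w} φ ν p C ↔
        ∀ F : Finset X, (F : Set X) ⊆ ν.support →
          SchattenCBNormLE.{u, w} p (finsetSchur φ F) C :=
    fun ν _ _ _ C => ⟨fun h F hF => h.schattenCBNormLE_finsetSchur hφ hF,
      schurCBNormLE_of_forall_finsetSchur hφ⟩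
  refine ⟨ha μ, hb μ, fun ν _ _ _ hν => ⟨?_, ?_⟩, fun hperf => ?_⟩
  -- The finite criterion mentions the measure only through its support.
  · simp only [schurNorm, ha, hν]
  · simp only [schurCBNorm, hb, hν]
  · simp only [schurNorm, schurCBNorm, ha, hb]
    have hiff : ∀ C : ℝ≥0,
        (∀ F : Finset X, (F : Set X) ⊆ μ.support → SchattenNormLE p (finsetSchur φ F) C) ↔
        ∀ F : Finset X, (F : Set X) ⊆ μ.support →
          SchattenCBNormLE.{u, w} p (finsetSchur φ F) C := fun C =>
      ⟨fun h F hF => schattenCBNormLE_finsetSchur_of_preperfect hφ hperf h hF,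
        fun h F hF => (h F hF).schattenNormLE_finsetSchur⟩
    simp only [hiff]
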